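/- **Setting.** Let $G=(V,E)$ be a finite directed graph with $n=|V|$ nodes in which every edge $e$ has a propagation probability $p(e)\in(0,1]$ (independent cascade model). A realization $\phi$ keeps each edge $e$ live with probability $p(e)$, independently of the others; $I_\phi(S)$ is the number of nodes reachable from $S\subseteq V$ along live edges. Let $\eta\in\{1,\dots,n\}$ be the target, $b\ge 1$ an integer (the batch size) and $\varepsilon\in(0,1)$. A *batched policy* selects seeds in rounds until at least $\eta$ nodes are active. In each round it chooses, possibly at random and depending on everything observed so far, a batch of exactly $b$ inactive nodes (all inactive nodes, if fewer than $b$ are left), and then observes the nodes that become active and the status of the edges leaving them. Let $S(\pi,\phi)$ be the set of all seeds that $\pi$ selects under $\phi$, and let $\mathbb E|S(\pi,\Phi)|$ be the expected number of seeds, over the random realization $\Phi$ and the coins of $\pi$. The policy is feasible if always $I_\phi(S(\pi,\phi))\ge\eta$. **Algorithm.** ASTI instantiated with TRIM-B is the batched policy that in each round runs TRIM-B, with fresh randomness, on the residual graph $G_i$ induced by the $n_i$ inactive nodes $V_i$, with shortfall $\eta_i=\eta-(n-n_i)$ and batch size $b_i=\min\{b,n_i\}$. A random mRR-set of $G_i$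 is the set of nodes that reach $K$ in a random realization of $G_i$, where $K\subseteq V_i$ is uniformly random of size $k$, and $k$ equals $\lfloor n_i/\eta_i\rfloor+1$ with probability $n_i/\eta_i-\lfloor n_i/\eta_i\rfloor$ and $\lfloor n_i/\eta_i\rfloor$ otherwise. For a collection $\mathcal R$ of mRR-sets, $\Lambda_{\mathcal R}(S)$ is the number of members that meet $S$. Put $\rho_b=1-(1-1/b)^b$ and, writing $b$ for $b_i$ in the rest of this paragraph, $$\delta=\frac{\varepsilon}{100(1-1/e)(1-\varepsilon)\eta_i},\qquad \hat\varepsilon=\frac{99\varepsilon}{100-\varepsilon},\qquad \theta_{\max}=\frac{2n_i\Big(\sqrt{\ln\frac6\delta}+\sqrt{\big(\ln\binom{n_i}{b}+\ln\frac6\delta\big)/\rho_b}\Big)^2}{b\hat\varepsilon^2},$$ $$\theta_\circ=\frac{\theta_{\max}\,b\,\hat\varepsilon^2}{n_i},\qquad T=\Big\lceil\log_2\frac{\theta_{\max}}{\theta_\circ}\Big\rceil+1,\qquad a_1=\ln\frac{3T}{\delta}+\ln\binom{n_i}{b},\qquad a_2=\ln\frac{3T}{\delta}$$ (with $\sqrt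 x=0$ for $x<0$ and $x/0=\log_2 0=0$). TRIM-B draws $\lceil\theta_\circ\rceil$ independent mRR-sets. For $t=1,\dots,T$ it computes a set $S_b$ of $b$ nodes of $V_i$ by the greedy algorithm for maximum coverage of $\mathcal R$ (ties broken by any fixed rule), and it returns $S_b$ if $t=T$ or if $\Lambda^l/\Lambda^u\ge\rho_b(1-\hat\varepsilon)$, where $$\Lambda^l=\Big(\sqrt{\Lambda_{\mathcal R}(S_b)+\tfrac{2a_1}{9}}-\sqrt{\tfrac{a_1}{2}}\Big)^2-\tfrac{a_1}{18},\qquad \Lambda^u=\Big(\sqrt{\Lambda_{\mathcal R}(S_b)/\rho_b+\tfrac{a_2}{2}}+\sqrt{\tfrac{a_2}{2}}\Big)^2;$$ otherwise it doubles the size of $\mathcal R$ by fresh independent mRR-sets and continues. **Theorem.** ASTI instantiated with TRIM-B is a feasible batched policy with batch size $b$, and it achieves an expected approximation ratio of $\frac{(\ln\eta+1)^2}{\rho_b(1-1/e)(1-\varepsilon)}$: for every feasible batched policy $\pi$ with batch size $b$, $$\mathbb E\big|S(\text{ASTI with TRIM-B},\Phi)\big|\;\le\;\frac{(\ln\eta+1)^2}{\rho_b\,(1-1/e)\,(1-\varepsilon)}\;\mathbb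 E\big|S(\pi,\Phi)\big| .$$ -/

import Mathlib

open scoped ENNReal NNReal

noncomputable section

/-- A probabilistic social network: a finite directed graph whose edges `e` carry a propagation
probability `prob e ∈ (0, 1]`. The values of `prob` outside `edges` are irrelevant. -/
structure SocialNetwork (V : Type*) [DecidableEq V] where
  nodes : Finset V
  edges : Finset (V × V)
  prob : V × V → ℝ
  edges_subset : edges ⊆ nodes ×ˢ nodes
  prob_pos : ∀ e ∈ edges, 0 < prob e
  prob_le_one : ∀ e ∈ edges, prob e ≤ 1

namespace SocialNetwork

variable {V : Type*} [DecidableEq V]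

/-- The subgraph induced by the nodes that lie in `W`. -/
def induce (G : SocialNetwork V) (W : Finset V) : SocialNetwork V where
  nodes := G.nodes ∩ W
  edges := G.edges.filter fun e => e.1 ∈ W ∧ e.2 ∈ W
  prob := G.prob
  edges_subset := by
    intro e he
    have h1 := Finset.mem_filter.1 he
    have h2 := Finset.mem_product.1 (G.edges_subset h1.1)
    exact Finset.mem_product.2
      ⟨Finset.mem_inter.2 ⟨h2.1, h1.2.1⟩, Finset.mem_inter.2 ⟨h2.2, h1.2.2⟩⟩
  prob_pos := fun e he => G.prob_pos e (Finset.mem_filter.1 he).1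
  prob_le_one := fun e he => G.prob_le_one e (Finset.mem_filter.1 he).1

/-- A realization is given by its set `φ ⊆ G.edges` of live edges. This is its probability: every
edge `e` is live with probability `prob e`, independently of the others. -/
def weight (G : SocialNetwork V) (φ : Finset (V × V)) : ℝ :=
  (∏ e ∈ φ, G.prob e) * ∏ e ∈ G.edges \ φ, (1 - G.prob e)

theorem weight_nonneg (G : SocialNetwork V) {φ : Finset (V × V)} (hφ : φ ⊆ G.edges) :
    0 ≤ G.weight φ := by
  refine mul_nonneg (Finset.prod_nonneg fun e he => (G.prob_pos e (hφ he)).le)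
    (Finset.prod_nonneg fun e he => ?_)
  have := G.prob_le_one e (Finset.mem_sdiff.1 he).1
  linarith

theorem sum_weight (G : SocialNetwork V) : ∑ φ ∈ G.edges.powerset, G.weight φ = 1 := by
  have h := Finset.prod_add G.prob (fun e => 1 - G.prob e) G.edges
  simp only [add_sub_cancel, Finset.prod_const_one] at h
  exact h.symm

/-- The law of a random realization `Φ` of `G`. -/
def realization (G : SocialNetwork V) : PMF (Finset (V × V)) :=
  PMF.ofFinset (fun φ => if φ ⊆ G.edges then ENNReal.ofReal (G.weight φ) else 0)
    G.edges.powerset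
    (by
      rw [Finset.sum_congr rfl fun φ hφ => if_pos (Finset.mem_powerset.1 hφ),
        ← ENNReal.ofReal_sum_of_nonneg fun φ hφ => G.weight_nonneg (Finset.mem_powerset.1 hφ),
        G.sum_weight, ENNReal.ofReal_one])
    (fun φ hφ => if_neg fun h => hφ (Finset.mem_powerset.2 h))

/-- `v` can be reached from `u` along edges of `G` that are live in `φ`. -/
def Reaches (G : SocialNetwork V) (φ : Finset (V × V)) (u v : V) : Prop :=
  Relation.ReflTransGen (fun x y => (x, y) ∈ G.edges ∧ (x, y) ∈ φ) u v

open Classical in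
/-- The nodes of `G` influenced by the seed set `S` under `φ`. -/
def influenced (G : SocialNetwork V) (φ : Finset (V × V)) (S : Finset V) : Finset V :=
  G.nodes.filter fun v => ∃ u ∈ S, G.Reaches φ u v

/-- The spread `I_φ(S)`. -/
def spread (G : SocialNetwork V) (φ : Finset (V × V)) (S : Finset V) : ℕ :=
  (G.influenced φ S).card

end SocialNetwork

section Policies

variable {V : Type*} [DecidableEq V]

/-- What is recorded in one round: the batch of seeds, the nodes newly influenced by it, and the
live ones among the edges that leave these nodes. -/
structure Observation (V : Type*) where
  batch : Finset V
  newlyActive : Finset V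
  live : Finset (V × V)

/-- An (adaptive, possibly randomized) policy maps the observations made so far, the latest one
first, to a distribution over the next batch of seeds. -/
def Policy (V : Type*) : Type _ := List (Observation V) → PMF (Finset V)

/-- All seeds selected so far. -/
def seedsOf : List (Observation V) → Finset V
  | [] => ∅
  | o :: h => o.batch ∪ seedsOf h

/-- All nodes activated so far. -/
def activeOf : List (Observation V) → Finset V
  | [] => ∅
  | o :: h => o.newlyActive ∪ activeOf h

/-- The residual graph, induced by the nodes that are still inactive. -/
def residualGraph (G : SocialNetwork V) (h : List (Observation V)) : SocialNetwork V :=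
  G.induce (G.nodes \ activeOf h)

/-- The observation made after history `h` when the batch `B` is seeded and the realization
is `φ`. -/
def observe (G : SocialNetwork V) (φ : Finset (V × V)) (h : List (Observation V))
    (B : Finset V) : Observation V where
  batch := B
  newlyActive := (residualGraph G h).influenced φ B
  live := φ.filter fun e => e.1 ∈ (residualGraph G h).influenced φ B

/-- Law of the seed set obtained by continuing from history `h` under realization `φ`: as long as
fewer than `η` nodes are active, the policy selects a further batch and observes its influence.
The first explicit argument bounds the number of further rounds. -/
def runFrom (G : SocialNetwork V) (η : ℕ) (π : Policy V) (φ : Finset (V × V)) :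
    ℕ → List (Observation V) → PMF (Finset V)
  | 0, h => PMF.pure (seedsOf h)
  | k + 1, h =>
    if η ≤ (activeOf h).card then PMF.pure (seedsOf h)
    else (π h).bind fun B => runFrom G η π φ k (observe G φ h B :: h)

/-- Law of the seed set `S(π, φ)`. A policy that selects at least one inactive node per round
needs at most `G.nodes.card` rounds, so that the bound on the rounds is never effective for it. -/
def seedSet (G : SocialNetwork V) (η : ℕ) (π : Policy V) (φ : Finset (V × V)) :
    PMF (Finset V) :=
  runFrom G η π φ G.nodes.card []

/-- The expected number of seeds, over the realization and the coin tosses of the policy. -/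
def expectedSeeds [Fintype V] (G : SocialNetwork V) (η : ℕ) (π : Policy V) : ℝ :=
  ∑ φ ∈ G.edges.powerset, G.weight φ * ∑ S : Finset V, (seedSet G η π φ S).toReal * (S.card : ℝ)

/-- Under every realization, every seed set the policy may select influences `η` nodes or more. -/
def IsFeasible (G : SocialNetwork V) (η : ℕ) (π : Policy V) : Prop :=
  ∀ φ ∈ G.edges.powerset, ∀ S ∈ (seedSet G η π φ).support, η ≤ G.spread φ S

/-- A policy of the batched model: every round selects exactly `b` inactive nodes, or all of them
if there are fewer than `b`. -/
def IsBatched (G : SocialNetwork V) (b : ℕ) (π : Policy V) : Prop :=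
  ∀ h : List (Observation V), ∀ B ∈ (π h).support,
    B ⊆ (residualGraph G h).nodes ∧ B.card = min b (residualGraph G h).nodes.card

end Policies

section TrimB

variable {V : Type*} [DecidableEq V]

/-- A uniformly random `k`-element subset of `W` (and `∅` in the void case `k > W.card`). -/
def uniformSubset (W : Finset V) (k : ℕ) : PMF (Finset V) :=
  if hk : (W.powersetCard k).Nonempty then PMF.uniformOfFinset (W.powersetCard k) hk
  else PMF.pure ∅

/-- A coin that shows `true` with probability `r`. -/
def coin (r : ℝ) (h0 : 0 ≤ r) (h1 : r ≤ 1) : PMF Bool :=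
  PMF.ofFintype (fun c => if c then ENNReal.ofReal r else ENNReal.ofReal (1 - r)) (by
    rw [Fintype.sum_bool, if_pos rfl, if_neg Bool.false_ne_true,
      ← ENNReal.ofReal_add h0 (sub_nonneg.2 h1), add_sub_cancel, ENNReal.ofReal_one])

/-- The random root set of a multi-root reverse reachable (mRR) set: a uniformly random set of `k`
nodes, where `k` is the randomized rounding of `n / η`, that is `⌊n / η⌋ + 1` with probability
equal to the fractional part of `n / η`, and `⌊n / η⌋` otherwise. -/
def rootSet (G : SocialNetwork V) (η : ℕ) : PMF (Finset V) :=
  (coin (Int.fract ((G.nodes.card : ℝ) / (η : ℝ))) (Int.fract_nonneg _)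
    (Int.fract_lt_one _).le).bind fun up =>
      uniformSubset G.nodes (⌊(G.nodes.card : ℝ) / (η : ℝ)⌋₊ + if up then 1 else 0)

open Classical in
/-- A random mRR-set: the nodes that reach the random root set in a random realization. -/
def mrrSet (G : SocialNetwork V) (η : ℕ) : PMF (Finset V) :=
  G.realization.bind fun φ => (rootSet G η).map fun K =>
    G.nodes.filter fun v => ∃ w ∈ K, G.Reaches φ v w

/-- `k` independent samples. -/
def iidSamples {α : Type*} (μ : PMF α) : ℕ → PMF (List α)
  | 0 => PMF.pure []
  | k + 1 => μ.bind fun a => (iidSamples μ k).map fun l => a :: l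

/-- The number of members of the collection `R` that meet `S`. -/
def coverage (R : List (Finset V)) (S : Finset V) : ℕ :=
  R.countP fun r => (S ∩ r).Nonempty

/-- The nodes of `W` outside `S` whose addition to `S` maximizes the coverage. -/
def greedyCandidates (R : List (Finset V)) (W S : Finset V) : Finset V :=
  (W \ S).filter fun v => ∀ u ∈ W \ S, coverage R (insert u S) ≤ coverage R (insert v S)

/-- A rule for breaking ties: from every nonempty set `M` of maximizers it picks a member. The
choice may depend on the collection `R` and on the set `S` of nodes chosen already. -/
def IsTieBreak (pick : List (Finset V) → Finset V → Finset V → V) : Prop :=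
  ∀ R S M, M.Nonempty → pick R S M ∈ M

/-- The greedy algorithm for maximum coverage with `k` nodes out of `W`. -/
def greedy (pick : List (Finset V) → Finset V → Finset V → V) (R : List (Finset V))
    (W : Finset V) : ℕ → Finset V
  | 0 => ∅
  | k + 1 =>
    insert (pick R (greedy pick R W k) (greedyCandidates R W (greedy pick R W k)))
      (greedy pick R W k)

/-- `ρ_b = 1 - (1 - 1/b)^b`. -/
def rho (b : ℕ) : ℝ := 1 - (1 - 1 / (b : ℝ)) ^ b

/-- `δ` for shortfall `η`. -/
def trimDelta (ε : ℝ) (η : ℕ) : ℝ :=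
  ε / (100 * (1 - 1 / Real.exp 1) * (1 - ε) * (η : ℝ))

/-- `ε̂`. -/
def trimEps (ε : ℝ) : ℝ := 99 * ε / (100 - ε)

/-- `θ_max` for a graph with `n` nodes. -/
def thetaMax (n η : ℕ) (ε : ℝ) (b : ℕ) : ℝ :=
  2 * (n : ℝ) *
      (√(Real.log (6 / trimDelta ε η)) +
        √((Real.log (n.choose b : ℝ) + Real.log (6 / trimDelta ε η)) / rho b)) ^ 2 /
    ((b : ℝ) * trimEps ε ^ 2)

/-- `θ_∘`. -/
def thetaInit (n η : ℕ) (ε : ℝ) (b : ℕ) : ℝ :=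
  thetaMax n η ε b * (b : ℝ) * trimEps ε ^ 2 / (n : ℝ)

/-- The maximal number `T` of iterations. -/
def maxIter (n η : ℕ) (ε : ℝ) (b : ℕ) : ℕ :=
  ⌈Real.logb 2 (thetaMax n η ε b / thetaInit n η ε b)⌉₊ + 1

/-- `a₂ = ln (3T/δ)`. -/
def aTwo (n η : ℕ) (ε : ℝ) (b : ℕ) : ℝ :=
  Real.log (3 * (maxIter n η ε b : ℝ) / trimDelta ε η)

/-- `a₁ = ln (3T/δ) + ln (n choose b)`. -/
def aOne (n η : ℕ) (ε : ℝ) (b : ℕ) : ℝ :=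
  aTwo n η ε b + Real.log (n.choose b : ℝ)

/-- `Λˡ` as a function of the coverage `x`. -/
def coverLower (n η : ℕ) (ε : ℝ) (b : ℕ) (x : ℝ) : ℝ :=
  (√(x + 2 * aOne n η ε b / 9) - √(aOne n η ε b / 2)) ^ 2 - aOne n η ε b / 18

/-- `Λᵘ` as a function of the coverage `x`. -/
def coverUpper (n η : ℕ) (ε : ℝ) (b : ℕ) (x : ℝ) : ℝ :=
  (√(x / rho b + aTwo n η ε b / 2) + √(aTwo n η ε b / 2)) ^ 2

open Classical in
/-- The loop of TRIM-B on the current collection `R`, when `k` further iterations are allowed: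
return the greedy solution if it passes the test or if this is the last iteration, otherwise double
the number of mRR-sets by fresh independent ones. -/
def trimBLoop (pick : List (Finset V) → Finset V → Finset V → V) (G : SocialNetwork V) (η : ℕ)
    (ε : ℝ) (b : ℕ) : ℕ → List (Finset V) → PMF (Finset V)
  | 0, R => PMF.pure (greedy pick R G.nodes b)
  | k + 1, R =>
    if rho b * (1 - trimEps ε) ≤
        coverLower G.nodes.card η ε b (coverage R (greedy pick R G.nodes b)) /
          coverUpper G.nodes.card η ε b (coverage R (greedy pick R G.nodes b)) then
      PMF.pure (greedy pick R G.nodes b)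
    else (iidSamples (mrrSet G η) R.length).bind fun R' => trimBLoop pick G η ε b k (R ++ R')

/-- TRIM-B on the graph `G` with shortfall `η`, error threshold `ε` and batch size `b`: the law of
the seed set that it returns. -/
def trimB (pick : List (Finset V) → Finset V → Finset V → V) (G : SocialNetwork V) (η : ℕ)
    (ε : ℝ) (b : ℕ) : PMF (Finset V) :=
  (iidSamples (mrrSet G η) ⌈thetaInit G.nodes.card η ε b⌉₊).bind
    (trimBLoop pick G η ε b (maxIter G.nodes.card η ε b - 1))

/-- ASTI instantiated with TRIM-B, as a policy: in each round TRIM-B is run with fresh coins on the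
residual graph, with the remaining shortfall `η - |active nodes|`, and with batch size `b`, or the
number of inactive nodes if this is smaller. -/
def astiTrimB (pick : List (Finset V) → Finset V → Finset V → V) (G : SocialNetwork V) (η : ℕ)
    (ε : ℝ) (b : ℕ) : Policy V := fun h =>
  trimB pick (residualGraph G h) (η - (activeOf h).card) ε (min b (residualGraph G h).nodes.card)

end TrimB

end

/-! Write `α = ρ_b (1 - 1/e) (1 - ε)` and `L = ln η + 1`. The proof has a sampling half and a
comparison half, joined by `IsApproxGreedy`.

Sampling half, `mul_truncInfluence_le_expect_trimB`: the batch returned by TRIM-B has expected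
truncated influence at least `α` times that of every batch. A root set with `n/η` roots on average
hits a fixed set of `x` nodes with probability between `(1 - 1/e) min(x, η)/η` and `min(x, η)/η`, so
`η * hitProb` estimates the truncated influence up to the factor `1 - 1/e`. Greedy coverage costs
`ρ_b`. Chernoff bounds, with a union bound over all `b`-sets because the greedy set depends on the
sample, cost `1 - ε`.

Comparison half: let `γ` be `α`-greedy, let `π` be any batched policy, and run both on the same
realization with independent coins. Fix a history of `γ` with active set `A` and shortfall `X`, and
let `D` be the largest truncated influence of a batch in the residual network. The history reveals
only edges leaving `A`. Hence each round of `π` adds at most `D` in expectation to the union of `A`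
with the active set of `π`, and `t` rounds add at most `t D`. If `π` has finished by then, at least
`X` has been added, so `X * P(π done within t)` is at most `t D`, given the history. The next batch
of `γ` gains at least `α D` in expectation, so the potential `1 + ln X` drops by at least `α D / X`.
Averaged over histories (`mul_expectedPotential_succ_add_le`), with `a r` and `o t` the
probabilities that `γ` and `π` are unfinished after `r` and `t` rounds, and `p r ≤ L * a r` the
expected potential, this reads `α * a r ≤ t * (p r - p (r + 1)) + α * o t` for all `r` and `t`.

Taking `t = ⌊r/c⌋` and summing by parts (`mul_sum_sub_le_of_drop`) bounds the expected number of
rounds `A = ∑ a` in terms of `O = ∑ o`: `α A ≤ α c O + (L/c) A`. With `c` near `2L/α` this gives `A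
≤ (4L/α) O`, which is linear in `L`. The claimed `L²/α` follows once `L` exceeds `4` with some room
for rounding `c`. For smaller `η` it suffices that every unfinished round activates new nodes.

Passing from rounds to seeds is lossless for `b = 1`. For `b ≥ 2` the final batch of `π` may be
short, so only its first batch and its non-final ones are counted as full. This shifts `t` by one
and raises the constant `4` to `3 + 2√2`, while `ρ_b ≤ 3/4` lowers `α` and widens the range of `η`
settled trivially. -/

namespace PMF

/-! ### Expectations and probabilities of discrete laws, valued in `ℝ≥0∞` to avoid integrability
conditions. -/

variable {α β : Type*}

/-- The expectation of a nonnegative function. -/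
noncomputable def expect (μ : PMF α) (f : α → ℝ≥0∞) : ℝ≥0∞ := ∑' a, μ a * f a

open Classical in
/-- The probability of an event. -/
noncomputable def prob (μ : PMF α) (s : α → Prop) : ℝ≥0∞ := μ.expect fun a => if s a then 1 else 0

theorem expect_pure (a : α) (f : α → ℝ≥0∞) : (PMF.pure a).expect f = f a := by
  classical
  unfold expect
  rw [tsum_eq_single a]
  · simp
  · intro b hb
    simp [hb]

theorem expect_bind (μ : PMF α) (ν : α → PMF β) (f : β → ℝ≥0∞) :
    (μ.bind ν).expect f = μ.expect fun a => (ν a).expect f := by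
  unfold expect
  simp only [PMF.bind_apply, ← ENNReal.tsum_mul_right, ← ENNReal.tsum_mul_left]
  rw [ENNReal.tsum_comm]
  simp only [mul_assoc]

theorem expect_map (μ : PMF α) (g : α → β) (f : β → ℝ≥0∞) :
    (μ.map g).expect f = μ.expect fun a => f (g a) := by
  rw [← PMF.bind_pure_comp, expect_bind]
  simp [expect_pure]

theorem expect_mono_support (μ : PMF α) {f g : α → ℝ≥0∞} (h : ∀ a ∈ μ.support, f a ≤ g a) :
    μ.expect f ≤ μ.expect g := by
  refine ENNReal.tsum_le_tsum fun a => ?_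
  by_cases ha : μ a = 0
  · simp [ha]
  · exact mul_le_mul_right (h a ((PMF.mem_support_iff _ _).2 ha)) _

theorem expect_congr_support (μ : PMF α) {f g : α → ℝ≥0∞} (h : ∀ a ∈ μ.support, f a = g a) :
    μ.expect f = μ.expect g :=
  le_antisymm (expect_mono_support μ fun a ha => (h a ha).le)
    (expect_mono_support μ fun a ha => (h a ha).ge)

theorem expect_mono (μ : PMF α) {f g : α → ℝ≥0∞} (h : ∀ a, f a ≤ g a) :
    μ.expect f ≤ μ.expect g :=
  expect_mono_support μ fun a _ => h a

theorem expect_const (μ : PMF α) (c : ℝ≥0∞) : (μ.expect fun _ => c) = c := by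
  simp [expect, ENNReal.tsum_mul_right, μ.tsum_coe]

theorem expect_const_mul (μ : PMF α) (c : ℝ≥0∞) (f : α → ℝ≥0∞) :
    (μ.expect fun a => c * f a) = c * μ.expect f := by
  simp only [expect, ← ENNReal.tsum_mul_left]
  exact tsum_congr fun a => by ring

theorem expect_mul_const (μ : PMF α) (c : ℝ≥0∞) (f : α → ℝ≥0∞) :
    (μ.expect fun a => f a * c) = μ.expect f * c := by
  simp only [expect, ← ENNReal.tsum_mul_right, mul_assoc]

theorem expect_add (μ : PMF α) (f g : α → ℝ≥0∞) :
    (μ.expect fun a => f a + g a) = μ.expect f + μ.expect g := by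
  simp only [expect, mul_add, ENNReal.tsum_add]

theorem expect_finset_sum {ι : Type*} (μ : PMF α) (s : Finset ι) (f : ι → α → ℝ≥0∞) :
    (μ.expect fun a => ∑ i ∈ s, f i a) = ∑ i ∈ s, μ.expect (f i) := by
  classical
  induction s using Finset.induction_on with
  | empty => simp [expect]
  | insert i s hi ih => simp only [Finset.sum_insert hi, expect_add, ih]

theorem expect_tsum {ι : Type*} (μ : PMF α) (f : ι → α → ℝ≥0∞) :
    (μ.expect fun a => ∑' i, f i a) = ∑' i, μ.expect (f i) := by
  simp only [expect, ← ENNReal.tsum_mul_left]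
  exact ENNReal.tsum_comm

theorem expect_comm (μ : PMF α) (ν : PMF β) (f : α → β → ℝ≥0∞) :
    (μ.expect fun a => ν.expect (f a)) = ν.expect fun b => μ.expect fun a => f a b := by
  simp only [expect, ← ENNReal.tsum_mul_left]
  rw [ENNReal.tsum_comm]
  exact tsum_congr fun a => tsum_congr fun b => by ring

theorem prob_mono_support (μ : PMF α) {s t : α → Prop} (h : ∀ a ∈ μ.support, s a → t a) :
    μ.prob s ≤ μ.prob t := by
  classical
  refine expect_mono_support μ fun a ha => ?_
  by_cases hs : s a
  · simp [hs, h a ha hs]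
  · simp [hs]

theorem prob_mono (μ : PMF α) {s t : α → Prop} (h : ∀ a, s a → t a) : μ.prob s ≤ μ.prob t :=
  prob_mono_support μ fun a _ => h a

theorem prob_le_one (μ : PMF α) (s : α → Prop) : μ.prob s ≤ 1 := by
  classical
  calc μ.prob s ≤ μ.expect fun _ => 1 := expect_mono μ fun a => by split_ifs <;> simp
    _ = 1 := expect_const μ 1

theorem prob_ne_top (μ : PMF α) (s : α → Prop) : μ.prob s ≠ ∞ :=
  ne_top_of_le_ne_top ENNReal.one_ne_top (prob_le_one μ s)

theorem prob_or_le (μ : PMF α) (s t : α → Prop) :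
    μ.prob (fun a => s a ∨ t a) ≤ μ.prob s + μ.prob t := by
  classical
  unfold prob
  rw [← expect_add]
  refine expect_mono μ fun a => ?_
  by_cases hs : s a <;> by_cases ht : t a <;> simp [hs, ht]

theorem prob_exists_le {ι : Type*} (μ : PMF α) (I : Finset ι) (s : ι → α → Prop) :
    μ.prob (fun a => ∃ i ∈ I, s i a) ≤ ∑ i ∈ I, μ.prob (s i) := by
  classical
  unfold prob
  rw [← expect_finset_sum]
  refine expect_mono μ fun a => ?_
  split_ifs with h
  · obtain ⟨i, hi, h⟩ := h
    refine le_trans ?_ (Finset.single_le_sum (f := fun i => if s i a then (1 : ℝ≥0∞) else 0)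
      (fun _ _ => zero_le) hi)
    simp [h]
  · exact zero_le

theorem prob_add_prob_not (μ : PMF α) (s : α → Prop) :
    μ.prob s + μ.prob (fun a => ¬ s a) = 1 := by
  classical
  unfold prob
  rw [← expect_add, ← expect_const μ 1]
  congr 1
  funext a
  by_cases hs : s a <;> simp [hs, expect_const]

theorem prob_bind (μ : PMF α) (ν : α → PMF β) (s : β → Prop) :
    (μ.bind ν).prob s = μ.expect fun a => (ν a).prob s := expect_bind _ _ _

theorem prob_map (μ : PMF α) (g : α → β) (s : β → Prop) :
    (μ.map g).prob s = μ.prob fun a => s (g a) := expect_map _ _ _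

open Classical in
theorem prob_pure (a : α) (s : α → Prop) :
    (PMF.pure a).prob s = if s a then 1 else 0 := expect_pure _ _

/-- Markov's inequality. -/
theorem prob_mul_le_expect (μ : PMF α) {s : α → Prop} {f : α → ℝ≥0∞} {c : ℝ≥0∞}
    (h : ∀ a, s a → c ≤ f a) : μ.prob s * c ≤ μ.expect f := by
  classical
  unfold prob
  rw [← expect_mul_const]
  refine expect_mono μ fun a => ?_
  by_cases hs : s a
  · simpa [hs] using h a hs
  · simp [hs]

theorem prob_mul_le_expect_support (μ : PMF α) {s : α → Prop} {f : α → ℝ≥0∞} {c : ℝ≥0∞}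
    (h : ∀ a ∈ μ.support, s a → c ≤ f a) : μ.prob s * c ≤ μ.expect f := by
  classical
  unfold prob
  rw [← expect_mul_const]
  refine expect_mono_support μ fun a ha => ?_
  by_cases hs : s a
  · simpa [hs] using h a ha hs
  · simp [hs]

end PMF

/-! ### Chernoff bounds for independent samples. -/

section Chernoff

variable {α : Type*}

theorem length_of_mem_support_iidSamples (μ : PMF α) (k : ℕ) {l : List α}
    (h : l ∈ (iidSamples μ k).support) : l.length = k := by
  induction k generalizing l with
  | zero => simp [iidSamples] at h; simp [h]
  | succ k ih =>
    simp only [iidSamples, PMF.mem_support_bind_iff, PMF.mem_support_map_iff] at h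
    obtain ⟨a, -, l', hl', rfl⟩ := h
    simp [ih hl']

/-- Doubling a collection by fresh samples again gives an independent collection; the analysis of
the TRIM-B loop rests on this. -/
theorem iidSamples_add (μ : PMF α) (m k : ℕ) :
    iidSamples μ (m + k) = (iidSamples μ m).bind fun l => (iidSamples μ k).map fun l' => l ++ l' := by
  induction m with
  | zero =>
    simp only [iidSamples, PMF.pure_bind, List.nil_append, Nat.zero_add]
    exact (PMF.map_id _).symm
  | succ m ih =>
    rw [Nat.succ_add]
    simp only [iidSamples, ih, PMF.bind_bind, PMF.map_bind, PMF.bind_map, PMF.map_comp]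
    rfl

/-- The exponential moments of the number of samples with a given property. -/
theorem expect_exp_countP (μ : PMF α) (p : α → Bool) (s : ℝ) (k : ℕ) :
    ((iidSamples μ k).expect fun l => ENNReal.ofReal (Real.exp (s * (l.countP p : ℝ)))) =
      ENNReal.ofReal ((1 + (μ.prob fun a => p a = true).toReal * (Real.exp s - 1)) ^ k) := by
  classical
  set q := (μ.prob fun a => p a = true).toReal with hq
  have hq0 : 0 ≤ q := ENNReal.toReal_nonneg
  have hq1 : q ≤ 1 := by
    rw [hq, ← ENNReal.toReal_one]
    exact ENNReal.toReal_mono ENNReal.one_ne_top (PMF.prob_le_one _ _)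
  have hpos : 0 ≤ 1 + q * (Real.exp s - 1) := by nlinarith [Real.exp_pos s]
  have hone : (μ.expect fun a => ENNReal.ofReal (Real.exp (s * (if p a then 1 else 0)))) =
      ENNReal.ofReal (1 + q * (Real.exp s - 1)) := by
    have hsplit : (μ.expect fun a => ENNReal.ofReal (Real.exp (s * (if p a then 1 else 0)))) =
        (μ.prob fun a => p a = true) * ENNReal.ofReal (Real.exp s) +
          (μ.prob fun a => ¬ p a = true) * 1 := by
      unfold PMF.prob
      rw [← PMF.expect_mul_const, ← PMF.expect_mul_const, ← PMF.expect_add]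
      congr 1
      funext a
      by_cases h : p a = true <;> simp [h]
    have hq' : (μ.prob fun a => p a = true) = ENNReal.ofReal q :=
      (ENNReal.ofReal_toReal (PMF.prob_ne_top _ _)).symm
    have hnot : (μ.prob fun a => ¬ p a = true) = ENNReal.ofReal (1 - q) := by
      have h := μ.prob_add_prob_not fun a => p a = true
      rw [hq'] at h
      rw [ENNReal.ofReal_sub _ hq0, ENNReal.ofReal_one, ← h]
      exact (ENNReal.add_sub_cancel_left ENNReal.ofReal_ne_top).symm
    rw [hsplit, hq', hnot, mul_one, ← ENNReal.ofReal_mul hq0,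
      ← ENNReal.ofReal_add (by positivity) (by linarith)]
    congr 1
    ring
  induction k with
  | zero => simp [iidSamples, PMF.expect_pure]
  | succ k ih =>
    simp only [iidSamples, PMF.expect_bind, PMF.expect_map, List.countP_cons]
    have h : ∀ (a : α) (l : List α),
        ENNReal.ofReal (Real.exp (s * ((l.countP p + if p a then 1 else 0 : ℕ) : ℝ))) =
        ENNReal.ofReal (Real.exp (s * (if p a then 1 else 0))) *
          ENNReal.ofReal (Real.exp (s * (l.countP p : ℝ))) := by
      intro a l
      rw [← ENNReal.ofReal_mul (Real.exp_nonneg _), ← Real.exp_add]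
      congr 2
      push_cast
      ring
    simp only [h, PMF.expect_const_mul, ih, PMF.expect_mul_const, hone]
    rw [← ENNReal.ofReal_mul hpos, pow_succ']

/-- Since `(n + 2)! ≥ 2 * 3 ^ n`, a geometric series dominates the exponential series from the
quadratic term on. This is the source of the term `2 * lam / 3` in the upper tail. -/
theorem Real.exp_le_one_add_add_sq_div {s : ℝ} (h0 : 0 ≤ s) (h3 : s < 3) :
    Real.exp s ≤ 1 + s + s ^ 2 / (2 * (1 - s / 3)) := by
  have hgeo : HasSum (fun n : ℕ => s ^ 2 / 2 * (s / 3) ^ n) (s ^ 2 / 2 * (1 - s / 3)⁻¹) :=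
    (hasSum_geometric_of_lt_one (by positivity) (by linarith)).mul_left _
  have hexp := NormedSpace.expSeries_div_hasSum_exp (𝔸 := ℝ) s
  rw [← Real.exp_eq_exp_ℝ] at hexp
  have hexp2 := (hasSum_nat_add_iff' 2).2 hexp
  have hle := hasSum_le (fun n => ?_) hexp2 hgeo
  · simp only [Finset.sum_range_succ, Finset.sum_range_zero] at hle
    have : s ^ 2 / (2 * (1 - s / 3)) = s ^ 2 / 2 * (1 - s / 3)⁻¹ := by
      rw [div_mul_eq_div_div, div_eq_mul_inv (s ^ 2 / 2)]
    rw [this]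
    norm_num at hle
    linarith
  · have hfac : (2 * 3 ^ n : ℝ) ≤ ((n + 2).factorial : ℝ) := by
      have : 2 * 3 ^ n ≤ (n + 2).factorial := by
        induction n with
        | zero => simp
        | succ n ih =>
          rw [show n + 1 + 2 = (n + 2) + 1 by ring, Nat.factorial_succ, pow_succ]
          nlinarith [Nat.factorial_pos (n + 2)]
      exact_mod_cast this
    rw [show s ^ 2 / 2 * (s / 3) ^ n = s ^ (n + 2) / (2 * 3 ^ n) by
      rw [div_pow, pow_add]; field_simp]
    gcongr

/-- `exp s ≥ 1 + s + s²/2`, and `(1 + s + s²/2)(1 - s + s²/2) = 1 + s⁴/4 ≥ 1`. -/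
theorem Real.exp_neg_le_one_sub_add_sq {s : ℝ} (h0 : 0 ≤ s) :
    Real.exp (-s) ≤ 1 - s + s ^ 2 / 2 := by
  have h1 : 0 < 1 + s + s ^ 2 / 2 := by positivity
  have h2 := Real.quadratic_le_exp_of_nonneg h0
  rw [Real.exp_neg, inv_le_comm₀ (Real.exp_pos s) (by nlinarith [sq_nonneg (s - 1)])]
  refine le_trans ?_ h2
  rw [inv_le_iff_one_le_mul₀ (by nlinarith [sq_nonneg (s - 1)])]
  nlinarith [sq_nonneg (s ^ 2)]

/-- Upper tail of the number of samples with a given property, for an upper bound `M` on its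
mean. -/
theorem prob_le_countP (μ : PMF α) (p : α → Bool) (k : ℕ) {M lam : ℝ} (hM : 0 ≤ M) (hl : 0 ≤ lam)
    (hq : k * (μ.prob fun a => p a = true).toReal ≤ M) :
    (iidSamples μ k).prob (fun l => M + lam ≤ (l.countP p : ℝ)) ≤
      ENNReal.ofReal (Real.exp (-(lam ^ 2 / (2 * M + 2 * lam / 3)))) := by
  set q := (μ.prob fun a => p a = true).toReal with hqdef
  have hq0 : 0 ≤ q := ENNReal.toReal_nonneg
  -- With this exponent `1 - s/3 = M / (M + lam/3)`, and the estimate of `exp s` yields exactly the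
  -- claimed exponent.
  set s := lam / (M + lam / 3) with hs
  have hs0 : 0 ≤ s := by positivity
  have hmark := PMF.prob_mul_le_expect (iidSamples μ k)
    (s := fun l => M + lam ≤ (l.countP p : ℝ))
    (f := fun l => ENNReal.ofReal (Real.exp (s * (l.countP p : ℝ))))
    (c := ENNReal.ofReal (Real.exp (s * (M + lam)))) (fun l hl' =>
      ENNReal.ofReal_le_ofReal (Real.exp_le_exp.2 (mul_le_mul_of_nonneg_left hl' hs0)))
  rw [expect_exp_countP, ← hqdef] at hmark
  have hes : 0 ≤ Real.exp s - 1 := by linarith [Real.add_one_le_exp s]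
  have hmgf : (1 + q * (Real.exp s - 1)) ^ k ≤ Real.exp (M * (Real.exp s - 1)) := by
    calc (1 + q * (Real.exp s - 1)) ^ k ≤ Real.exp (q * (Real.exp s - 1)) ^ k := by
          gcongr
          linarith [Real.add_one_le_exp (q * (Real.exp s - 1))]
      _ = Real.exp (k * q * (Real.exp s - 1)) := by
          rw [← Real.exp_nat_mul]; congr 1; ring
      _ ≤ _ := Real.exp_le_exp.2 (mul_le_mul_of_nonneg_right hq hes)
  have hexponent : M * (Real.exp s - 1) ≤ s * (M + lam) - lam ^ 2 / (2 * M + 2 * lam / 3) := by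
    -- For `M = 0` the exponent `s` equals `3` (or `0/0 = 0` if `lam = 0`), so the estimate for `s <
    -- 3` is not available; the left side is then `0`.
    rcases hM.eq_or_lt with hM0 | hM
    · rcases hl.eq_or_lt with hl0 | hl
      · simp [← hM0, ← hl0]
      · have : s * (M + lam) - lam ^ 2 / (2 * M + 2 * lam / 3) = 3 / 2 * lam := by
          rw [hs, ← hM0]; field_simp; ring
        rw [this, ← hM0]
        linarith
    have hden : 0 < M + lam / 3 := by positivity
    have hs3 : s < 3 := by rw [hs, div_lt_iff₀ hden]; linarith
    have h1 := Real.exp_le_one_add_add_sq_div hs0 hs3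
    have h2 : 1 - s / 3 = M / (M + lam / 3) := by rw [hs]; field_simp; ring
    have h3 : M * (s ^ 2 / (2 * (1 - s / 3))) = lam ^ 2 / (2 * M + 2 * lam / 3) := by
      rw [h2, hs]; field_simp
    have h4 : s * lam = 2 * (lam ^ 2 / (2 * M + 2 * lam / 3)) := by rw [hs]; field_simp
    nlinarith [mul_le_mul_of_nonneg_left h1 hM.le]
  have hE : ENNReal.ofReal (Real.exp (s * (M + lam))) ≠ 0 := by
    simp [Real.exp_pos]
  refine (ENNReal.mul_le_mul_iff_left hE ENNReal.ofReal_ne_top).1 (hmark.trans ?_)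
  rw [← ENNReal.ofReal_mul (Real.exp_nonneg _), ← Real.exp_add]
  refine ENNReal.ofReal_le_ofReal (hmgf.trans (Real.exp_le_exp.2 ?_))
  linarith

/-- Lower tail of the number of samples with a given property. -/
theorem prob_countP_le (μ : PMF α) (p : α → Bool) (k : ℕ) {M lam : ℝ} (hM : 0 < M) (hl : 0 ≤ lam)
    (hq : k * (μ.prob fun a => p a = true).toReal = M) :
    (iidSamples μ k).prob (fun l => (l.countP p : ℝ) ≤ M - lam) ≤
      ENNReal.ofReal (Real.exp (-(lam ^ 2 / (2 * M)))) := by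
  set q := (μ.prob fun a => p a = true).toReal with hqdef
  have hq0 : 0 ≤ q := ENNReal.toReal_nonneg
  have hq1 : q ≤ 1 := by
    rw [hqdef, ← ENNReal.toReal_one]
    exact ENNReal.toReal_mono ENNReal.one_ne_top (PMF.prob_le_one _ _)
  -- The minimizer of `M s²/2 - s lam`.
  set s := lam / M with hs
  have hs0 : 0 ≤ s := by positivity
  have hmark := PMF.prob_mul_le_expect (iidSamples μ k)
    (s := fun l => (l.countP p : ℝ) ≤ M - lam)
    (f := fun l => ENNReal.ofReal (Real.exp (-s * (l.countP p : ℝ))))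
    (c := ENNReal.ofReal (Real.exp (-s * (M - lam)))) (fun l hl' =>
      ENNReal.ofReal_le_ofReal (Real.exp_le_exp.2 (by nlinarith)))
  rw [expect_exp_countP, ← hqdef] at hmark
  have hmgf : (1 + q * (Real.exp (-s) - 1)) ^ k ≤ Real.exp (M * (Real.exp (-s) - 1)) := by
    calc (1 + q * (Real.exp (-s) - 1)) ^ k ≤ Real.exp (q * (Real.exp (-s) - 1)) ^ k := by
          have : 0 ≤ 1 + q * (Real.exp (-s) - 1) := by nlinarith [Real.exp_pos (-s)]
          gcongr
          linarith [Real.add_one_le_exp (q * (Real.exp (-s) - 1))]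
      _ = Real.exp (M * (Real.exp (-s) - 1)) := by
          rw [← Real.exp_nat_mul, ← hq]; congr 1; ring
  have hexponent : M * (Real.exp (-s) - 1) ≤ -s * (M - lam) - lam ^ 2 / (2 * M) := by
    have h1 := Real.exp_neg_le_one_sub_add_sq hs0
    have h3 : M * (s ^ 2 / 2) = lam ^ 2 / (2 * M) := by rw [hs]; field_simp
    have h4 : s * lam = 2 * (lam ^ 2 / (2 * M)) := by rw [hs]; field_simp
    nlinarith [mul_le_mul_of_nonneg_left h1 hM.le]
  have hE : ENNReal.ofReal (Real.exp (-s * (M - lam))) ≠ 0 := by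
    simp [Real.exp_pos]
  refine (ENNReal.mul_le_mul_iff_left hE ENNReal.ofReal_ne_top).1 (hmark.trans ?_)
  rw [← ENNReal.ofReal_mul (Real.exp_nonneg _), ← Real.exp_add]
  refine ENNReal.ofReal_le_ofReal (hmgf.trans (Real.exp_le_exp.2 ?_))
  linarith

end Chernoff

/-! ### Greedy maximum coverage. -/

section Greedy

variable {V : Type*} [DecidableEq V]

theorem coverage_cons (r : Finset V) (R : List (Finset V)) (S : Finset V) :
    coverage (r :: R) S = coverage R S + if (S ∩ r).Nonempty then 1 else 0 := by
  simp [coverage, List.countP_cons]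

theorem coverage_mono (R : List (Finset V)) {S T : Finset V} (h : S ⊆ T) :
    coverage R S ≤ coverage R T := by
  unfold coverage
  refine List.countP_mono_left fun r _ hr => ?_
  simp only [decide_eq_true_eq] at hr ⊢
  exact hr.mono (Finset.inter_subset_inter_right h)

/-- Submodularity of coverage, checked one mRR-set at a time: if `S` meets `r` and `T` does not,
some `u ∈ S` contributes `1` to the sum of marginal gains. -/
theorem coverage_le_add_sum (R : List (Finset V)) (S T : Finset V) :
    (coverage R S : ℝ) ≤ coverage R T +
      ∑ u ∈ S, ((coverage R (insert u T) : ℝ) - coverage R T) := by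
  induction R with
  | nil => simp [coverage]
  | cons r R ih =>
    have hterm : ∀ u, (0 : ℝ) ≤ (if (insert u T ∩ r).Nonempty then (1 : ℝ) else 0) -
        (if (T ∩ r).Nonempty then 1 else 0) := by
      intro u
      by_cases h : (T ∩ r).Nonempty
      · have : (insert u T ∩ r).Nonempty :=
          h.mono (Finset.inter_subset_inter_right (Finset.subset_insert _ _))
        simp [h, this]
      · simp only [h, if_false, sub_zero]
        split_ifs <;> simp
    have hone : (if (S ∩ r).Nonempty then (1 : ℝ) else 0) ≤ (if (T ∩ r).Nonempty then 1 else 0) +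
        ∑ u ∈ S, ((if (insert u T ∩ r).Nonempty then (1 : ℝ) else 0) -
          (if (T ∩ r).Nonempty then 1 else 0)) := by
      have hsum := Finset.sum_nonneg fun u (_ : u ∈ S) => hterm u
      by_cases hS : (S ∩ r).Nonempty
      · by_cases hT : (T ∩ r).Nonempty
        · rw [if_pos hS, if_pos hT]
          rw [if_pos hT] at hsum
          linarith
        · obtain ⟨u, hu⟩ := hS
          have hu' := Finset.mem_inter.1 hu
          have h1 := Finset.single_le_sum (fun u (_ : u ∈ S) => hterm u) hu'.1
          have h2 : (insert u T ∩ r).Nonempty :=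
            ⟨u, Finset.mem_inter.2 ⟨Finset.mem_insert_self _ _, hu'.2⟩⟩
          rw [if_pos h2, if_neg hT] at h1
          rw [if_pos ⟨u, hu⟩, if_neg hT]
          linarith
      · rw [if_neg hS]
        refine add_nonneg (by split_ifs <;> simp) hsum
    simp only [coverage_cons, Nat.cast_add, Nat.cast_ite, Nat.cast_one, Nat.cast_zero]
    have : ∀ u, ((coverage R (insert u T) : ℝ) + (if (insert u T ∩ r).Nonempty then 1 else 0)) -
        (coverage R T + if (T ∩ r).Nonempty then 1 else 0) =
        ((coverage R (insert u T) : ℝ) - coverage R T) +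
        ((if (insert u T ∩ r).Nonempty then 1 else 0) - if (T ∩ r).Nonempty then 1 else 0) := by
      intro u; ring
    simp only [this, Finset.sum_add_distrib]
    linarith

theorem pick_greedy_mem {pick : List (Finset V) → Finset V → Finset V → V}
    (hpick : IsTieBreak pick) (R : List (Finset V)) (W S : Finset V) (h : (W \ S).Nonempty) :
    pick R S (greedyCandidates R W S) ∈ greedyCandidates R W S := by
  refine hpick _ _ _ ?_
  obtain ⟨v, hv, hmax⟩ := Finset.exists_max_image (W \ S) (fun v => coverage R (insert v S)) h
  exact ⟨v, Finset.mem_filter.2 ⟨hv, hmax⟩⟩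

theorem greedy_subset_and_card {pick : List (Finset V) → Finset V → Finset V → V}
    (hpick : IsTieBreak pick) (R : List (Finset V)) (W : Finset V) (k : ℕ) (hk : k ≤ W.card) :
    greedy pick R W k ⊆ W ∧ (greedy pick R W k).card = k := by
  induction k with
  | zero => simp [greedy]
  | succ k ih =>
    obtain ⟨h1, h2⟩ := ih (by omega)
    have hne : (W \ greedy pick R W k).Nonempty := by
      rw [← Finset.card_pos, Finset.card_sdiff_of_subset h1]
      omega
    have hm := Finset.mem_sdiff.1 (Finset.mem_filter.1 (pick_greedy_mem hpick R W _ hne)).1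
    refine ⟨Finset.insert_subset hm.1 h1, ?_⟩
    rw [greedy, Finset.card_insert_of_notMem hm.2, h2]

/-- By submodularity the marginal gains of the `b` nodes of `S` add up to at least the deficit, so
the best node closes at least a fraction `1/b` of it. -/
theorem coverage_greedy_step {pick : List (Finset V) → Finset V → Finset V → V}
    (hpick : IsTieBreak pick) (R : List (Finset V)) (W : Finset V) {k b : ℕ} (hk : k < W.card)
    (hb : 1 ≤ b) {S : Finset V} (hS : S ⊆ W) (hSb : S.card = b) :
    (coverage R S : ℝ) - coverage R (greedy pick R W (k + 1)) ≤
      (1 - 1 / (b : ℝ)) * (coverage R S - coverage R (greedy pick R W k)) := by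
  obtain ⟨h1, h2⟩ := greedy_subset_and_card hpick R W k hk.le
  set T := greedy pick R W k with hT
  have hne : (W \ T).Nonempty := by
    rw [← Finset.card_pos, Finset.card_sdiff_of_subset h1]
    omega
  have hm := pick_greedy_mem hpick R W T hne
  have hmax := (Finset.mem_filter.1 hm).2
  have hle : ∀ u ∈ S, (coverage R (insert u T) : ℝ) - coverage R T ≤
      (coverage R (greedy pick R W (k + 1)) : ℝ) - coverage R T := by
    intro u hu
    refine sub_le_sub_right ?_ _
    rw [greedy, ← hT]
    by_cases huT : u ∈ T
    · rw [Finset.insert_eq_of_mem huT]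
      exact_mod_cast coverage_mono R (Finset.subset_insert _ _)
    · exact_mod_cast hmax u (Finset.mem_sdiff.2 ⟨hS hu, huT⟩)
  have hsum := coverage_le_add_sum R S T
  have h3 := Finset.sum_le_sum hle
  rw [Finset.sum_const, hSb, nsmul_eq_mul] at h3
  have hb' : (0 : ℝ) < b := by exact_mod_cast hb
  have h4 : (1 / (b : ℝ)) * (coverage R S - coverage R T) ≤
      coverage R (greedy pick R W (k + 1)) - coverage R T := by
    rw [one_div, inv_mul_le_iff₀ hb']
    linarith
  linarith

/-- The greedy algorithm for maximum coverage is a `ρ_b`-approximation. -/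
theorem rho_mul_coverage_le_greedy {pick : List (Finset V) → Finset V → Finset V → V}
    (hpick : IsTieBreak pick) (R : List (Finset V)) (W : Finset V) {b : ℕ} (hb : 1 ≤ b)
    {S : Finset V} (hS : S ⊆ W) (hSb : S.card = b) :
    rho b * coverage R S ≤ coverage R (greedy pick R W b) := by
  have hbW : b ≤ W.card := hSb ▸ Finset.card_le_card hS
  have hb' : (1 : ℝ) ≤ b := by exact_mod_cast hb
  have hq : (0 : ℝ) ≤ 1 - 1 / (b : ℝ) := by
    rw [sub_nonneg, div_le_one (by linarith)]
    exact hb'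
  have key : ∀ k ≤ b, (coverage R S : ℝ) - coverage R (greedy pick R W k) ≤
      (1 - 1 / (b : ℝ)) ^ k * coverage R S := by
    intro k
    induction k with
    | zero => intro _; simp
    | succ k ih =>
      intro hk
      refine (coverage_greedy_step hpick R W (by omega) hb hS hSb).trans ?_
      rw [pow_succ', mul_assoc]
      exact mul_le_mul_of_nonneg_left (ih (by omega)) hq
  have := key b le_rfl
  unfold rho
  linarith

end Greedy

/-! ### The factor `ρ_b` and its monotonicity. -/

section Rho

theorem rho_pos {b : ℕ} (hb : 1 ≤ b) : 0 < rho b := by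
  unfold rho
  have hb' : (1 : ℝ) ≤ b := by exact_mod_cast hb
  have h1 : (0 : ℝ) ≤ 1 - 1 / (b : ℝ) := by
    rw [sub_nonneg, div_le_one (by linarith)]
    exact hb'
  have h2 : 1 - 1 / (b : ℝ) < 1 := by
    have : 0 < 1 / (b : ℝ) := by positivity
    linarith
  have := pow_lt_one₀ h1 h2 (by omega : b ≠ 0)
  linarith

theorem rho_le_one (b : ℕ) (hb : 1 ≤ b) : rho b ≤ 1 := by
  unfold rho
  have hb' : (1 : ℝ) ≤ b := by exact_mod_cast hb
  have h1 : (0 : ℝ) ≤ 1 - 1 / (b : ℝ) := by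
    rw [sub_nonneg, div_le_one (by linarith)]
    exact hb'
  have := pow_nonneg h1 b
  linarith

theorem rho_succ_le {b : ℕ} (hb : 1 ≤ b) : rho (b + 1) ≤ rho b := by
  unfold rho
  have hb' : (1 : ℝ) ≤ b := by exact_mod_cast hb
  have hb0 : (0 : ℝ) < b := by linarith
  push_cast
  set x : ℝ := (b : ℝ) with hx
  have hx1 : (0 : ℝ) ≤ 1 - 1 / x := by
    rw [sub_nonneg, div_le_one hb0]
    exact hb'
  -- For `b = 1` the base `1 - 1/b` vanishes and the quotient of the bases is undefined.
  rcases eq_or_lt_of_le hb' with h | h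
  · have hb1 : b = 1 := by
      have : (b : ℝ) = 1 := by linarith
      exact_mod_cast this
    subst hb1
    norm_num [hx]
  · -- Bernoulli's inequality for the quotient of the two bases
    have hpos : 0 < 1 - 1 / x := by
      rw [sub_pos, div_lt_one hb0]
      exact h
    have hquot : 1 - 1 / (x + 1) = (1 - 1 / x) * (1 + 1 / (x ^ 2 - 1)) := by
      have : x ^ 2 - 1 ≠ 0 := by nlinarith
      have : x + 1 ≠ 0 := by linarith
      field_simp
      ring
    have hd : 0 < 1 / (x ^ 2 - 1) := by
      apply one_div_pos.2
      nlinarith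
    have hbern := one_add_mul_le_pow (a := 1 / (x ^ 2 - 1)) (by linarith) (b + 1)
    have h1 : (1 - 1 / x) * (1 + ((b + 1 : ℕ) : ℝ) * (1 / (x ^ 2 - 1))) = 1 := by
      push_cast
      rw [← hx]
      have h2 : x ^ 2 - 1 = (x - 1) * (x + 1) := by ring
      have h3 : x - 1 ≠ 0 := by linarith
      have h4 : x + 1 ≠ 0 := by linarith
      rw [h2]
      field_simp
      ring
    have : (1 - 1 / x) ^ b ≤ (1 - 1 / (x + 1)) ^ (b + 1) := by
      rw [hquot, mul_pow, pow_succ (1 - 1 / x), mul_assoc]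
      refine le_mul_of_one_le_right (pow_nonneg hx1 _) ?_
      exact h1.symm.le.trans (mul_le_mul_of_nonneg_left hbern hx1)
    linarith

/-- A late round may work with a batch smaller than `b`; its guarantee is then no weaker. -/
theorem rho_antitone {a b : ℕ} (ha : 1 ≤ a) (hab : a ≤ b) : rho b ≤ rho a := by
  induction b, hab using Nat.le_induction with
  | base => exact le_rfl
  | succ b hb ih => exact (rho_succ_le (ha.trans hb)).trans ih

end Rho

/-! ### Binomial estimates for sampling without replacement. -/

section Choose

/-- Drawing without replacement misses `x` marked elements less often than drawing with replacement:
`(n - x - j)/(n - j) ≤ (n - x)/n` for each further draw. -/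
theorem choose_sub_mul_pow_le (n x k : ℕ) (hx : x ≤ n) :
    (n - x).choose k * n ^ k ≤ n.choose k * (n - x) ^ k := by
  induction k with
  | zero => simp
  | succ k ih =>
    rcases Nat.lt_or_ge (n - x) (k + 1) with h | h
    · simp [Nat.choose_eq_zero_of_lt h]
    · have h1 := Nat.choose_succ_right_eq (n - x) k
      have h2 := Nat.choose_succ_right_eq n k
      have h3 : (n - x - k) * n ≤ (n - k) * (n - x) := by
        obtain ⟨d, hd⟩ := Nat.exists_eq_add_of_le h
        have e1 : n - x - k = d + 1 := by omega
        have e2 : n - k = d + 1 + x := by omega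
        have e3 : n - x = k + 1 + d := by omega
        have e4 : n = k + 1 + d + x := by omega
        rw [e1, e2, e3]
        calc (d + 1) * n = (d + 1) * (k + 1 + d + x) := by rw [← e4]
          _ ≤ _ := by nlinarith [Nat.zero_le (x * k)]
      refine Nat.le_of_mul_le_mul_left ?_ (Nat.succ_pos k)
      calc (k + 1) * ((n - x).choose (k + 1) * n ^ (k + 1))
          = ((n - x).choose (k + 1) * (k + 1)) * n ^ (k + 1) := by ring
        _ = ((n - x).choose k * n ^ k) * ((n - x - k) * n) := by rw [h1]; ring
        _ ≤ (n.choose k * (n - x) ^ k) * ((n - k) * (n - x)) := Nat.mul_le_mul ih h3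
        _ = (n.choose (k + 1) * (k + 1)) * (n - x) ^ (k + 1) := by rw [h2]; ring
        _ = _ := by rw [Nat.succ_eq_add_one]; ring

/-- A union bound in counting form: by Pascal's rule, removing the marked elements one by one loses
at most `(n-1).choose (k-1)` of the `k`-subsets each time. -/
theorem mul_choose_le_add (n x k : ℕ) (hx : x ≤ n) :
    n * n.choose k ≤ n * (n - x).choose k + k * x * n.choose k := by
  rcases k with _ | k
  · simp
  rcases n with _ | n
  · simp
  have hid := Nat.add_one_mul_choose_eq n k
  have hstep : ∀ y, y ≤ n + 1 → (n + 1).choose (k + 1) ≤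
      (n + 1 - y).choose (k + 1) + y * n.choose k := by
    intro y
    induction y with
    | zero => intro _; simp
    | succ y ih =>
      intro hy
      have e : n + 1 - y = (n + 1 - (y + 1)) + 1 := by omega
      have h1 := ih (by omega)
      rw [e, Nat.choose_succ_succ' (n + 1 - (y + 1)) k] at h1
      have h2 : (n + 1 - (y + 1)).choose k ≤ n.choose k := Nat.choose_le_choose k (by omega)
      nlinarith
  calc (n + 1) * (n + 1).choose (k + 1)
      ≤ (n + 1) * ((n + 1 - x).choose (k + 1) + x * n.choose k) :=
        Nat.mul_le_mul_left _ (hstep x hx)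
    _ = (n + 1) * (n + 1 - x).choose (k + 1) + x * ((n + 1) * n.choose k) := by ring
    _ = _ := by rw [hid]; ring

end Choose

/-! ### How often the random root set misses a set of nodes. -/

section RootSet

variable {V : Type*} [DecidableEq V]

/-- The probability that a uniformly random `k`-subset of an `n`-set misses a given `x`-subset. -/
noncomputable def missRatio (n x k : ℕ) : ℝ := ((n - x).choose k : ℝ) / (n.choose k : ℝ)

theorem missRatio_le_pow {n x k : ℕ} (hn : 0 < n) (hx : x ≤ n) (hk : k ≤ n) :
    missRatio n x k ≤ (1 - (x : ℝ) / n) ^ k := by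
  unfold missRatio
  have hc : (0 : ℝ) < n.choose k := by exact_mod_cast Nat.choose_pos hk
  have hn' : (0 : ℝ) < n := by exact_mod_cast hn
  rw [div_le_iff₀ hc, show 1 - (x : ℝ) / n = ((n - x : ℕ) : ℝ) / n by
    rw [Nat.cast_sub hx]; field_simp, div_pow, div_mul_eq_mul_div, le_div_iff₀ (by positivity)]
  have := choose_sub_mul_pow_le n x k hx
  calc ((n - x).choose k : ℝ) * (n : ℝ) ^ k = (((n - x).choose k * n ^ k : ℕ) : ℝ) := by push_cast; ring
    _ ≤ ((n.choose k * (n - x) ^ k : ℕ) : ℝ) := by exact_mod_cast this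
    _ = _ := by push_cast; ring

theorem one_sub_le_missRatio {n x k : ℕ} (hn : 0 < n) (hx : x ≤ n) (hk : k ≤ n) :
    1 - (k : ℝ) * x / n ≤ missRatio n x k := by
  unfold missRatio
  have hc : (0 : ℝ) < n.choose k := by exact_mod_cast Nat.choose_pos hk
  have hn' : (0 : ℝ) < n := by exact_mod_cast hn
  rw [le_div_iff₀ hc]
  have h : (n : ℝ) * n.choose k ≤ n * (n - x).choose k + k * x * n.choose k := by
    exact_mod_cast mul_choose_le_add n x k hx
  have : (1 - (k : ℝ) * x / n) * n.choose k = (n * n.choose k - k * x * n.choose k) / n := by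
    field_simp
  rw [this, div_le_iff₀ hn']
  linarith

theorem prob_uniformSubset_disjoint {W A : Finset V} (hA : A ⊆ W) {k : ℕ} (hk : k ≤ W.card) :
    ((uniformSubset W k).prob fun K => ¬ (K ∩ A).Nonempty) =
      ENNReal.ofReal (missRatio W.card A.card k) := by
  classical
  have hne : (W.powersetCard k).Nonempty := Finset.powersetCard_nonempty.2 hk
  have hpos : (0 : ℝ) < W.card.choose k := by exact_mod_cast Nat.choose_pos hk
  have hset : (W.powersetCard k).filter (fun K => ¬ (K ∩ A).Nonempty) =
      (W \ A).powersetCard k := by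
    ext K
    simp only [Finset.mem_filter, Finset.mem_powersetCard, Finset.not_nonempty_iff_eq_empty,
      ← Finset.disjoint_iff_inter_eq_empty, Finset.subset_sdiff]
    tauto
  rw [uniformSubset, dif_pos hne, PMF.prob, PMF.expect,
    tsum_eq_sum (s := W.powersetCard k) (fun K hK => by
      rw [PMF.uniformOfFinset_apply_of_notMem hne hK, zero_mul])]
  rw [Finset.sum_congr rfl (g := fun K => ((W.powersetCard k).card : ℝ≥0∞)⁻¹ *
    (if ¬ (K ∩ A).Nonempty then 1 else 0)) (fun K hK => by
      rw [PMF.uniformOfFinset_apply_of_mem hne hK]; congr), ← Finset.mul_sum, Finset.sum_boole, hset,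
    Finset.card_powersetCard, Finset.card_powersetCard, Finset.card_sdiff_of_subset hA, missRatio,
    ENNReal.ofReal_div_of_pos hpos, ENNReal.ofReal_natCast, ENNReal.ofReal_natCast, mul_comm,
    ENNReal.div_eq_inv_mul, mul_comm]

theorem subset_of_mem_support_rootSet (G : SocialNetwork V) (η : ℕ) {K : Finset V}
    (hK : K ∈ (rootSet G η).support) : K ⊆ G.nodes := by
  rw [rootSet, PMF.mem_support_bind_iff] at hK
  obtain ⟨c, -, hK⟩ := hK
  unfold uniformSubset at hK
  split_ifs at hK with h1 h2
  all_goals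
    first
    | exact (Finset.mem_powersetCard.1 ((PMF.mem_support_uniformOfFinset_iff _ _).1 hK)).1
    | (rw [PMF.mem_support_pure_iff] at hK; rw [hK]; exact Finset.empty_subset _)

/-- The probability that the random root set misses a given set of nodes. -/
theorem prob_rootSet_disjoint (G : SocialNetwork V) {η : ℕ} (hη : 1 ≤ η) (hηn : η ≤ G.nodes.card)
    {A : Finset V} (hA : A ⊆ G.nodes) :
    ∃ m : ℝ, 0 ≤ m ∧ ((rootSet G η).prob fun K => ¬ (K ∩ A).Nonempty) = ENNReal.ofReal m ∧
      m ≤ Real.exp (-((A.card : ℝ) / η)) ∧ 1 - (A.card : ℝ) / η ≤ m ∧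
      m ≤ 1 - (A.card : ℝ) / G.nodes.card := by
  classical
  set n := G.nodes.card with hn
  set x := A.card with hx
  have hxn : x ≤ n := Finset.card_le_card hA
  have hn0 : 0 < n := by omega
  have hn' : (0 : ℝ) < n := by exact_mod_cast hn0
  have hη' : (1 : ℝ) ≤ η := by exact_mod_cast hη
  set κ : ℝ := (n : ℝ) / η with hκ
  set k := ⌊κ⌋₊ with hk
  set f := Int.fract κ with hf
  have hf0 : 0 ≤ f := Int.fract_nonneg _
  have hf1 : f < 1 := Int.fract_lt_one _
  have hκ0 : 0 ≤ κ := by positivity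
  have hκ1 : 1 ≤ κ := by
    rw [hκ, le_div_iff₀ (by linarith), one_mul]
    exact_mod_cast hηn
  have hkf : (k : ℝ) + f = κ := by
    rw [hk, natCast_floor_eq_intCast_floor hκ0]
    exact Int.floor_add_fract κ
  have hk1 : 1 ≤ k := Nat.le_floor (by simpa using hκ1)
  have hκn : κ ≤ n := div_le_self hn'.le hη'
  have hkn : k ≤ n := by
    have : (k : ℝ) ≤ n := by linarith
    exact_mod_cast this
  -- For `η = 1` one has `k = n` and there is no set of `k + 1` roots; then `f = 0`, so that case of
  -- the mixture has no weight.
  have hk' : f ≠ 0 → k + 1 ≤ n := by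
    intro h
    have : 0 < f := lt_of_le_of_ne hf0 (Ne.symm h)
    have : (k : ℝ) < n := by linarith
    exact_mod_cast this
  have hxn' : (x : ℝ) / n ≤ 1 := by
    rw [div_le_one hn']
    exact_mod_cast hxn
  have hx0 : 0 ≤ (x : ℝ) / n := by positivity
  -- the law of the root set is a mixture of two uniform laws
  have hprob : ((rootSet G η).prob fun K => ¬ (K ∩ A).Nonempty) =
      ENNReal.ofReal (f * missRatio n x (k + 1) + (1 - f) * missRatio n x k) := by
    have hm : ∀ j, 0 ≤ missRatio n x j := fun j => by unfold missRatio; positivity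
    rw [rootSet, PMF.prob_bind, PMF.expect, tsum_bool]
    simp only [coin, PMF.ofFintype_apply, if_true, Bool.false_eq_true, if_false, add_zero]
    rw [← hn, ← hκ, ← hf, ← hk, prob_uniformSubset_disjoint hA hkn, ← hn, ← hx,
      add_comm, ENNReal.ofReal_add (mul_nonneg hf0 (hm _)) (mul_nonneg (by linarith) (hm _)),
      ENNReal.ofReal_mul hf0, ENNReal.ofReal_mul (by linarith : 0 ≤ 1 - f)]
    congr 1
    by_cases hfz : f = 0
    · simp [hfz]
    · rw [prob_uniformSubset_disjoint hA (hk' hfz)]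
  have hlow : missRatio n x k ≤ (1 - (x : ℝ) / n) ^ k := missRatio_le_pow hn0 hxn hkn
  have hup : f * missRatio n x (k + 1) ≤ f * (1 - (x : ℝ) / n) ^ (k + 1) := by
    by_cases hfz : f = 0
    · simp [hfz]
    · exact mul_le_mul_of_nonneg_left (missRatio_le_pow hn0 hxn (hk' hfz)) hf0
  have hup2 : f * (1 - ((k : ℝ) + 1) * x / n) ≤ f * missRatio n x (k + 1) := by
    by_cases hfz : f = 0
    · simp [hfz]
    · have := one_sub_le_missRatio hn0 hxn (hk' hfz)
      push_cast at this
      exact mul_le_mul_of_nonneg_left this hf0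
  -- With `q = 1 - x/n`, the right side is `f q^(k+1) + (1 - f) q^k`.
  have hsum : f * missRatio n x (k + 1) + (1 - f) * missRatio n x k ≤
      (1 - (x : ℝ) / n) ^ k * (1 - f * ((x : ℝ) / n)) := by
    have := mul_le_mul_of_nonneg_left hlow (by linarith : 0 ≤ 1 - f)
    rw [pow_succ] at hup
    nlinarith
  have hbase : 0 ≤ 1 - (x : ℝ) / n := by linarith
  have hfx : f * ((x : ℝ) / n) ≤ 1 := mul_le_one₀ hf1.le hx0 hxn'
  refine ⟨_, ?_, hprob, ?_, ?_, ?_⟩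
  · have hm : ∀ j, 0 ≤ missRatio n x j := fun j => by unfold missRatio; positivity
    exact add_nonneg (mul_nonneg hf0 (hm _)) (mul_nonneg (by linarith) (hm _))
  · refine hsum.trans ?_
    have h1 : (1 - (x : ℝ) / n) ^ k ≤ Real.exp (-(k * ((x : ℝ) / n))) := by
      calc (1 - (x : ℝ) / n) ^ k ≤ Real.exp (-((x : ℝ) / n)) ^ k := by
            gcongr
            linarith [Real.add_one_le_exp (-((x : ℝ) / n))]
        _ = _ := by rw [← Real.exp_nat_mul]; congr 1; ring
    have h2 : 1 - f * ((x : ℝ) / n) ≤ Real.exp (-(f * ((x : ℝ) / n))) := by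
      linarith [Real.add_one_le_exp (-(f * ((x : ℝ) / n)))]
    -- The randomized rounding matters here: the mean number of roots `k + f` is exactly `n/η`,
    -- which turns `x/n` into `x/η`.
    calc _ ≤ Real.exp (-(k * ((x : ℝ) / n))) * Real.exp (-(f * ((x : ℝ) / n))) :=
          mul_le_mul h1 h2 (by linarith) (Real.exp_nonneg _)
      _ = Real.exp (-((k + f) * ((x : ℝ) / n))) := by rw [← Real.exp_add]; congr 1; ring
      _ = _ := by rw [hkf, hκ]; congr 2; field_simp
  · have h1 := mul_le_mul_of_nonneg_left (one_sub_le_missRatio hn0 hxn hkn)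
      (by linarith : 0 ≤ 1 - f)
    have h2 : (x : ℝ) / η = (k + f) * x / n := by rw [hkf, hκ]; field_simp
    rw [h2]
    have : f * (1 - ((k : ℝ) + 1) * x / n) + (1 - f) * (1 - (k : ℝ) * x / n) =
        1 - (k + f) * x / n := by ring
    linarith
  -- Only the presence of one root is used. This weak bound later gives hitting probability at least
  -- `b/n` for a batch, the value that `θ_max` relies on.
  · refine hsum.trans ?_
    calc (1 - (x : ℝ) / n) ^ k * (1 - f * ((x : ℝ) / n)) ≤ (1 - (x : ℝ) / n) ^ 1 * 1 := by
          refine mul_le_mul (pow_le_pow_of_le_one hbase (by linarith) hk1) ?_ (by linarith)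
            (pow_nonneg hbase _)
          have := mul_nonneg hf0 hx0
          linarith
      _ = _ := by ring

end RootSet

/-! ### Truncated influence against hitting probability. -/

section HitProb

variable {V : Type*} [DecidableEq V]

/-- The expected influence of `S`, truncated at `η`. -/
noncomputable def truncInfluence (G : SocialNetwork V) (η : ℕ) (S : Finset V) : ℝ≥0∞ :=
  G.realization.expect fun φ => ((min (G.spread φ S) η : ℕ) : ℝ≥0∞)

/-- The probability that a random mRR-set meets `S`. -/
noncomputable def hitProb (G : SocialNetwork V) (η : ℕ) (S : Finset V) : ℝ≥0∞ :=
  (mrrSet G η).prob fun r => (S ∩ r).Nonempty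

/-- Reverse reachability: `S` meets the set of nodes that reach `K` exactly when `K` meets the set
influenced by `S`. -/
theorem hitProb_eq (G : SocialNetwork V) (η : ℕ) {S : Finset V} (hS : S ⊆ G.nodes) :
    hitProb G η S = G.realization.expect fun φ =>
      (rootSet G η).prob fun K => (K ∩ G.influenced φ S).Nonempty := by
  classical
  rw [hitProb, mrrSet, PMF.prob_bind]
  congr 1
  funext φ
  rw [PMF.prob_map]
  have hiff : ∀ K ∈ (rootSet G η).support,
      ((S ∩ G.nodes.filter fun v => ∃ w ∈ K, G.Reaches φ v w).Nonempty ↔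
        (K ∩ G.influenced φ S).Nonempty) := by
    intro K hK
    have hKn := subset_of_mem_support_rootSet G η hK
    constructor
    · rintro ⟨v, hv⟩
      obtain ⟨hv1, hv2⟩ := Finset.mem_inter.1 hv
      obtain ⟨-, w, hw, hr⟩ := Finset.mem_filter.1 hv2
      exact ⟨w, Finset.mem_inter.2 ⟨hw, Finset.mem_filter.2 ⟨hKn hw, v, hv1, hr⟩⟩⟩
    · rintro ⟨w, hw⟩
      obtain ⟨hw1, hw2⟩ := Finset.mem_inter.1 hw
      obtain ⟨-, v, hv, hr⟩ := Finset.mem_filter.1 hw2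
      exact ⟨v, Finset.mem_inter.2 ⟨hv, Finset.mem_filter.2 ⟨hS hv, w, hw1, hr⟩⟩⟩
  exact le_antisymm (PMF.prob_mono_support _ fun K hK => (hiff K hK).1)
    (PMF.prob_mono_support _ fun K hK => (hiff K hK).2)

theorem influenced_subset_nodes (G : SocialNetwork V) (φ : Finset (V × V)) (S : Finset V) :
    G.influenced φ S ⊆ G.nodes := by
  classical
  exact Finset.filter_subset _ _

theorem subset_influenced (G : SocialNetwork V) (φ : Finset (V × V)) {S : Finset V}
    (hS : S ⊆ G.nodes) : S ⊆ G.influenced φ S := fun v hv => by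
  classical
  exact Finset.mem_filter.2 ⟨hS hv, v, hv, Relation.ReflTransGen.refl⟩

/-- The hitting probability lies between `1 - exp (-x/η)` and `min(x/η, 1)`, and `1 - exp (-y) ≥ (1
- 1/e) y` for `y ∈ [0, 1]` by concavity. -/
theorem prob_rootSet_hit (G : SocialNetwork V) {η : ℕ} (hη : 1 ≤ η) (hηn : η ≤ G.nodes.card)
    {A : Finset V} (hA : A ⊆ G.nodes) :
    ∃ p : ℝ, 0 ≤ p ∧ ((rootSet G η).prob fun K => (K ∩ A).Nonempty) = ENNReal.ofReal p ∧
      η * p ≤ (min A.card η : ℕ) ∧ (1 - 1 / Real.exp 1) * (min A.card η : ℕ) ≤ η * p ∧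
      (A.card : ℝ) / G.nodes.card ≤ p := by
  obtain ⟨m, hm0, hm, h1, h2, h3⟩ := prob_rootSet_disjoint G hη hηn hA
  have hη' : (0 : ℝ) < η := by exact_mod_cast hη
  have hm1 : m ≤ 1 := h3.trans (by
    have : (0 : ℝ) ≤ (A.card : ℝ) / G.nodes.card := by positivity
    linarith)
  refine ⟨1 - m, by linarith, ?_, ?_, ?_, by linarith⟩
  · have h := (rootSet G η).prob_add_prob_not fun K => (K ∩ A).Nonempty
    rw [hm] at h
    rw [ENNReal.ofReal_sub _ hm0, ENNReal.ofReal_one, ← h]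
    exact (ENNReal.add_sub_cancel_right ENNReal.ofReal_ne_top).symm
  · rw [Nat.cast_min, le_min_iff]
    constructor
    · have : (η : ℝ) * (1 - m) ≤ η * (A.card / η) := mul_le_mul_of_nonneg_left (by linarith) hη'.le
      rwa [mul_div_cancel₀ _ hη'.ne'] at this
    · nlinarith
  · -- convexity of the exponential function on `[-1, 0]`
    set y : ℝ := ((min A.card η : ℕ) : ℝ) / η with hy
    have hy0 : 0 ≤ y := by positivity
    have hy1 : y ≤ 1 := by
      rw [hy, div_le_one hη']
      exact_mod_cast min_le_right _ _
    have hyA : y ≤ (A.card : ℝ) / η := by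
      rw [hy]
      gcongr
      exact min_le_left _ _
    have hconv := convexOn_exp.2 (Set.mem_univ (0 : ℝ)) (Set.mem_univ (-1 : ℝ))
      (by linarith : 0 ≤ 1 - y) hy0 (by ring)
    simp only [smul_eq_mul, mul_zero, zero_add, Real.exp_zero, mul_one] at hconv
    have hexp : Real.exp (-((A.card : ℝ) / η)) ≤ Real.exp (y * -1) :=
      Real.exp_le_exp.2 (by linarith)
    have hinv : Real.exp (-1) = 1 / Real.exp 1 := by rw [Real.exp_neg, one_div]
    rw [hinv] at hconv
    have hmain : (1 - 1 / Real.exp 1) * y ≤ 1 - m := by linarith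
    have hmul : ((min A.card η : ℕ) : ℝ) = η * y := by rw [hy]; field_simp
    rw [hmul]
    calc (1 - 1 / Real.exp 1) * (η * y) = η * ((1 - 1 / Real.exp 1) * y) := by ring
      _ ≤ _ := mul_le_mul_of_nonneg_left hmain hη'.le

theorem mul_hitProb_le_truncInfluence (G : SocialNetwork V) {η : ℕ} (hη : 1 ≤ η)
    (hηn : η ≤ G.nodes.card) {S : Finset V} (hS : S ⊆ G.nodes) :
    (η : ℝ≥0∞) * hitProb G η S ≤ truncInfluence G η S := by
  rw [hitProb_eq G η hS, ← PMF.expect_const_mul]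
  refine PMF.expect_mono _ fun φ => ?_
  obtain ⟨p, hp0, hp, h1, -, -⟩ :=
    prob_rootSet_hit G hη hηn (influenced_subset_nodes G φ S)
  rw [hp, ← ENNReal.ofReal_natCast, ← ENNReal.ofReal_natCast,
    ← ENNReal.ofReal_mul (Nat.cast_nonneg _)]
  exact ENNReal.ofReal_le_ofReal h1

theorem truncInfluence_le_mul_hitProb (G : SocialNetwork V) {η : ℕ} (hη : 1 ≤ η)
    (hηn : η ≤ G.nodes.card) {S : Finset V} (hS : S ⊆ G.nodes) :
    ENNReal.ofReal (1 - 1 / Real.exp 1) * truncInfluence G η S ≤ η * hitProb G η S := by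
  rw [hitProb_eq G η hS, ← PMF.expect_const_mul, truncInfluence, ← PMF.expect_const_mul]
  refine PMF.expect_mono _ fun φ => ?_
  obtain ⟨p, hp0, hp, -, h1, -⟩ :=
    prob_rootSet_hit G hη hηn (influenced_subset_nodes G φ S)
  have he : 0 ≤ 1 - 1 / Real.exp 1 := by
    rw [sub_nonneg, div_le_one (Real.exp_pos 1)]
    exact Real.one_le_exp zero_le_one
  rw [hp, ← ENNReal.ofReal_natCast, ← ENNReal.ofReal_natCast,
    ← ENNReal.ofReal_mul (Nat.cast_nonneg _), ← ENNReal.ofReal_mul he]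
  exact ENNReal.ofReal_le_ofReal h1

theorem card_div_le_hitProb (G : SocialNetwork V) {η : ℕ} (hη : 1 ≤ η)
    (hηn : η ≤ G.nodes.card) {S : Finset V} (hS : S ⊆ G.nodes) :
    ENNReal.ofReal ((S.card : ℝ) / G.nodes.card) ≤ hitProb G η S := by
  rw [hitProb_eq G η hS,
    ← PMF.expect_const G.realization (ENNReal.ofReal ((S.card : ℝ) / G.nodes.card))]
  refine PMF.expect_mono _ fun φ => ?_
  obtain ⟨p, hp0, hp, -, -, h1⟩ :=
    prob_rootSet_hit G hη hηn (influenced_subset_nodes G φ S)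
  rw [hp]
  refine ENNReal.ofReal_le_ofReal (le_trans ?_ h1)
  gcongr
  exact subset_influenced G φ hS

theorem one_le_truncInfluence (G : SocialNetwork V) {η : ℕ} (hη : 1 ≤ η) {S : Finset V}
    (hS : S ⊆ G.nodes) (hne : S.Nonempty) : 1 ≤ truncInfluence G η S := by
  rw [truncInfluence, ← PMF.expect_const G.realization 1]
  refine PMF.expect_mono _ fun φ => ?_
  have h1 : 1 ≤ (G.influenced φ S).card :=
    Finset.card_pos.2 (hne.mono (subset_influenced G φ hS))
  have h2 : 1 ≤ min (G.spread φ S) η := le_min h1 hη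
  exact_mod_cast h2

theorem truncInfluence_le (G : SocialNetwork V) (η : ℕ) (S : Finset V) :
    truncInfluence G η S ≤ η := by
  rw [truncInfluence, ← PMF.expect_const G.realization (η : ℝ≥0∞)]
  exact PMF.expect_mono _ fun φ => by exact_mod_cast min_le_right _ _

end HitProb

/-! ### Confidence bounds for the mean, obtained by inverting the Chernoff bounds. -/

section Confidence

variable {α : Type*}

/-- The lower confidence bound for the mean fails with probability at most `exp (-a)`. -/
theorem prob_mean_lt_lower (μ : PMF α) (p : α → Bool) (k : ℕ) {a : ℝ} (ha : 0 < a) :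
    (iidSamples μ k).prob (fun l => k * (μ.prob fun x => p x = true).toReal <
      (√((l.countP p : ℝ) + 2 * a / 9) - √(a / 2)) ^ 2 - a / 18) ≤
      ENNReal.ofReal (Real.exp (-a)) := by
  set M : ℝ := k * (μ.prob fun x => p x = true).toReal with hM
  have hM0 : 0 ≤ M := by positivity
  -- The positive root of `lam² = a (2M + 2 lam/3)`, which makes the tail exponent equal to `a`.
  set lam : ℝ := a / 3 + √(a ^ 2 / 9 + 2 * a * M) with hlam
  have hsq := Real.sq_sqrt (show 0 ≤ a ^ 2 / 9 + 2 * a * M by positivity)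
  have hsq0 := Real.sqrt_nonneg (a ^ 2 / 9 + 2 * a * M)
  have hl0 : 0 < lam := by positivity
  have hval : lam ^ 2 / (2 * M + 2 * lam / 3) = a := by
    rw [div_eq_iff (by positivity), hlam]
    nlinarith
  refine le_trans (PMF.prob_mono _ fun l hl => ?_)
    ((prob_le_countP μ p k hM0 hl0.le hM.symm.le).trans_eq (by rw [hval]))
  set x : ℝ := (l.countP p : ℝ) with hx
  have hx0 : 0 ≤ x := by positivity
  set u := √(x + 2 * a / 9) with hu
  set v := √(a / 2) with hv
  have hu0 : 0 ≤ u := Real.sqrt_nonneg _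
  have hv0 : 0 ≤ v := Real.sqrt_nonneg _
  have hu2 : u ^ 2 = x + 2 * a / 9 := Real.sq_sqrt (by positivity)
  have hv2 : v ^ 2 = a / 2 := Real.sq_sqrt (by positivity)
  set y := √(M + a / 18) with hy
  have hy0 : 0 ≤ y := Real.sqrt_nonneg _
  have hy2 : y ^ 2 = M + a / 18 := Real.sq_sqrt (by positivity)
  have hlt : y ^ 2 < (u - v) ^ 2 := by linarith
  have hlt' := (sq_lt_sq₀ hy0 (abs_nonneg (u - v))).1 (by rwa [sq_abs])
  have huv : y + v < u := by
    rcases le_or_gt v u with h | h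
    · rw [abs_of_nonneg (by linarith)] at hlt'
      linarith
    -- On this branch squaring would reverse the inequality. The terms `2a/9` and `a/18` exclude it:
    -- they give `u ≥ 2v/3` and `y ≥ v/3`, against `y < v - u`.
    · exfalso
      rw [abs_of_neg (by linarith)] at hlt'
      have h1 : (2 / 3 * v) ^ 2 ≤ u ^ 2 := by nlinarith
      have h2 : 2 / 3 * v ≤ u := (sq_le_sq₀ (by positivity) hu0).1 h1
      have h3 : (v / 3) ^ 2 ≤ y ^ 2 := by nlinarith
      have h4 : v / 3 ≤ y := (sq_le_sq₀ (by positivity) hy0).1 h3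
      linarith
  have hroot : √(a ^ 2 / 9 + 2 * a * M) = 2 * y * v := by
    rw [show a ^ 2 / 9 + 2 * a * M = (2 * y * v) ^ 2 by
      rw [mul_pow, mul_pow, hy2, hv2]; ring]
    exact Real.sqrt_sq (by positivity)
  have : (y + v) ^ 2 < u ^ 2 := by
    have : 0 ≤ y + v := by positivity
    nlinarith
  rw [hlam, hroot]
  nlinarith

/-- The upper confidence bound for the mean fails with probability at most `exp (-a)`. -/
theorem prob_upper_lt_mean (μ : PMF α) (p : α → Bool) (k : ℕ) {a : ℝ} (ha : 0 < a) :
    (iidSamples μ k).prob (fun l =>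
      (√((l.countP p : ℝ) + a / 2) + √(a / 2)) ^ 2 < k * (μ.prob fun x => p x = true).toReal) ≤
      ENNReal.ofReal (Real.exp (-a)) := by
  set M : ℝ := k * (μ.prob fun x => p x = true).toReal with hM
  have hM0 : 0 ≤ M := by positivity
  rcases hM0.eq_or_lt with h0 | hM1
  · refine le_trans (PMF.prob_mono (t := fun _ => False) _ fun l hl => ?_) ?_
    · rw [← h0] at hl
      exact absurd hl (not_lt.2 (sq_nonneg _))
    · simp [PMF.prob, PMF.expect]
  -- The deviation whose lower-tail exponent is `a`.
  set lam : ℝ := √(2 * a * M) with hlam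
  have hval : lam ^ 2 / (2 * M) = a := by
    rw [hlam, Real.sq_sqrt (by positivity)]
    field_simp
  refine le_trans (PMF.prob_mono _ fun l hl => ?_)
    ((prob_countP_le μ p k hM1 (Real.sqrt_nonneg _) hM.symm).trans_eq (by rw [hval]))
  set x : ℝ := (l.countP p : ℝ) with hx
  have hx0 : 0 ≤ x := by positivity
  set u := √(x + a / 2) with hu
  set v := √(a / 2) with hv
  have hu0 : 0 ≤ u := Real.sqrt_nonneg _
  have hv0 : 0 ≤ v := Real.sqrt_nonneg _
  have hu2 : u ^ 2 = x + a / 2 := Real.sq_sqrt (by positivity)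
  have hv2 : v ^ 2 = a / 2 := Real.sq_sqrt (by positivity)
  set y := √M with hy
  have hy0 : 0 ≤ y := Real.sqrt_nonneg _
  have hy2 : y ^ 2 = M := Real.sq_sqrt hM0
  have huv : u + v < y := (sq_lt_sq₀ (by positivity) hy0).1 (by rwa [hy2])
  have hroot : √(2 * a * M) = 2 * y * v := by
    rw [show 2 * a * M = (2 * y * v) ^ 2 by rw [mul_pow, mul_pow, hy2, hv2]; ring]
    exact Real.sqrt_sq (by positivity)
  rw [hroot]
  nlinarith

end Confidence

/-! ### The parameters of TRIM-B. -/

section Parameters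

variable {ε : ℝ} {η : ℕ}

theorem one_sub_inv_exp_pos : 0 < 1 - 1 / Real.exp 1 := by
  rw [sub_pos, div_lt_one (Real.exp_pos 1)]
  exact Real.one_lt_exp_iff.2 zero_lt_one

theorem trimEps_pos (h0 : 0 < ε) (h1 : ε < 1) : 0 < trimEps ε := by
  unfold trimEps
  apply div_pos <;> linarith

theorem trimEps_lt_one (h1 : ε < 1) : trimEps ε < 1 := by
  unfold trimEps
  rw [div_lt_one] <;> linarith

theorem trimDelta_pos (h0 : 0 < ε) (h1 : ε < 1) (hη : 1 ≤ η) : 0 < trimDelta ε η := by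
  unfold trimDelta
  have := one_sub_inv_exp_pos
  have h2 : 0 < 1 - ε := by linarith
  have h3 : (0 : ℝ) < η := by exact_mod_cast hη
  positivity

theorem trimDelta_lt (h0 : 0 < ε) (hbig : 1 < (1 - 1 / Real.exp 1) * (1 - ε) * η) :
    trimDelta ε η < ε / 100 := by
  unfold trimDelta
  rw [show 100 * (1 - 1 / Real.exp 1) * (1 - ε) * (η : ℝ) =
    100 * ((1 - 1 / Real.exp 1) * (1 - ε) * η) by ring]
  apply div_lt_div_of_pos_left h0 (by norm_num)
  linarith

/-- `ε̂` is defined by `(1 - ε/100)(1 - ε̂) = 1 - ε`: one hundredth of `ε` pays for the failure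
probability. -/
theorem one_sub_le_mul_one_sub_trimEps (h1 : ε < 1) {δ : ℝ} (hδ : δ ≤ ε / 100) :
    1 - ε ≤ (1 - δ) * (1 - trimEps ε) := by
  have h2 : 1 - trimEps ε = (1 - ε) / (1 - ε / 100) := by
    unfold trimEps
    have : 100 - ε ≠ 0 := by linarith
    have : 1 - ε / 100 ≠ 0 := by linarith
    field_simp
    ring
  rw [h2, mul_div_assoc', le_div_iff₀ (by linarith), mul_comm]
  apply mul_le_mul_of_nonneg_right <;> linarith

variable {n b : ℕ}

theorem thetaMax_pos (h0 : 0 < ε) (h1 : ε < 1) (hb : 1 ≤ b) (hbn : b ≤ n) (hδ : 0 < trimDelta ε η)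
    (hδ1 : trimDelta ε η < 1) : 0 < thetaMax n η ε b := by
  unfold thetaMax
  have hn : (0 : ℝ) < n := by exact_mod_cast hb.trans hbn
  have hb' : (0 : ℝ) < b := by exact_mod_cast hb
  have hlog : 0 < Real.log (6 / trimDelta ε η) :=
    Real.log_pos (by rw [lt_div_iff₀ hδ]; linarith)
  have := trimEps_pos h0 h1
  have := Real.sqrt_pos.2 hlog
  positivity

theorem thetaInit_pos (h0 : 0 < ε) (h1 : ε < 1) (hb : 1 ≤ b) (hbn : b ≤ n)
    (hδ : 0 < trimDelta ε η) (hδ1 : trimDelta ε η < 1) : 0 < thetaInit n η ε b := by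
  unfold thetaInit
  have hn : (0 : ℝ) < n := by exact_mod_cast hb.trans hbn
  have hb' : (0 : ℝ) < b := by exact_mod_cast hb
  have := trimEps_pos h0 h1
  have := thetaMax_pos h0 h1 hb hbn hδ hδ1
  positivity

/-- The `T - 1` doublings suffice for the last iteration to have `θ_max` samples. -/
theorem thetaMax_le_two_pow_mul (h0 : 0 < ε) (h1 : ε < 1) (hb : 1 ≤ b) (hbn : b ≤ n)
    (hδ : 0 < trimDelta ε η) (hδ1 : trimDelta ε η < 1) :
    thetaMax n η ε b ≤
      ((2 ^ (maxIter n η ε b - 1) * ⌈thetaInit n η ε b⌉₊ : ℕ) : ℝ) := by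
  have hi := thetaInit_pos h0 h1 hb hbn hδ hδ1
  have hm := thetaMax_pos h0 h1 hb hbn hδ hδ1
  have hT : maxIter n η ε b - 1 = ⌈Real.logb 2 (thetaMax n η ε b / thetaInit n η ε b)⌉₊ := by
    simp [maxIter]
  rw [hT]
  push_cast
  have h2 : thetaMax n η ε b / thetaInit n η ε b ≤
      2 ^ ⌈Real.logb 2 (thetaMax n η ε b / thetaInit n η ε b)⌉₊ := by
    rw [← Real.rpow_natCast, ← Real.logb_le_iff_le_rpow (by norm_num) (by positivity)]
    exact Nat.le_ceil _
  calc thetaMax n η ε b = thetaMax n η ε b / thetaInit n η ε b * thetaInit n η ε b := by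
        field_simp
    _ ≤ _ := mul_le_mul h2 (Nat.le_ceil _) hi.le (by positivity)

end Parameters

/-! ### The approximation guarantee of TRIM-B. -/

section TrimAnalysis

variable {V : Type*} [DecidableEq V]

theorem prob_decide_eq_hitProb (G : SocialNetwork V) (η : ℕ) (S : Finset V) :
    ((mrrSet G η).prob fun r => decide (S ∩ r).Nonempty = true) = hitProb G η S := by
  simp only [decide_eq_true_eq]
  rfl

theorem mem_support_trimBLoop {pick : List (Finset V) → Finset V → Finset V → V}
    (hpick : IsTieBreak pick) (G : SocialNetwork V) (η : ℕ) (ε : ℝ) {b : ℕ}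
    (hb : b ≤ G.nodes.card) (k : ℕ) (R : List (Finset V)) {S : Finset V}
    (hS : S ∈ (trimBLoop pick G η ε b k R).support) : S ⊆ G.nodes ∧ S.card = b := by
  induction k generalizing R with
  | zero =>
    rw [trimBLoop, PMF.mem_support_pure_iff] at hS
    rw [hS]
    exact greedy_subset_and_card hpick R _ _ hb
  | succ k ih =>
    rw [trimBLoop] at hS
    split_ifs at hS
    · rw [PMF.mem_support_pure_iff] at hS
      rw [hS]
      exact greedy_subset_and_card hpick R _ _ hb
    · rw [PMF.mem_support_bind_iff] at hS
      obtain ⟨R', -, hS⟩ := hS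
      exact ih _ hS

theorem mem_support_trimB {pick : List (Finset V) → Finset V → Finset V → V}
    (hpick : IsTieBreak pick) (G : SocialNetwork V) (η : ℕ) (ε : ℝ) {b : ℕ}
    (hb : b ≤ G.nodes.card) {S : Finset V} (hS : S ∈ (trimB pick G η ε b).support) :
    S ⊆ G.nodes ∧ S.card = b := by
  rw [trimB, PMF.mem_support_bind_iff] at hS
  obtain ⟨R, -, hS⟩ := hS
  exact mem_support_trimBLoop hpick G η ε hb _ R hS

/-- `S` falls short of the approximation guarantee relative to `B`. -/
def IsPoor (G : SocialNetwork V) (η : ℕ) (ε : ℝ) (b : ℕ) (B S : Finset V) : Prop :=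
  (hitProb G η S).toReal < rho b * (1 - trimEps ε) * (hitProb G η B).toReal

/-- Some confidence bound fails for the collection `R` of mRR-sets. -/
def BoundFails (G : SocialNetwork V) (η : ℕ) (ε : ℝ) (b : ℕ) (B : Finset V)
    (R : List (Finset V)) : Prop :=
  (∃ S ∈ G.nodes.powersetCard b, R.length * (hitProb G η S).toReal <
    coverLower G.nodes.card η ε b (coverage R S)) ∨
  (√((coverage R B : ℝ) + aTwo G.nodes.card η ε b / 2) + √(aTwo G.nodes.card η ε b / 2)) ^ 2 <
    R.length * (hitProb G η B).toReal

variable {G : SocialNetwork V} {η : ℕ} {ε : ℝ} {b : ℕ}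

theorem exp_neg_aTwo (hδ : 0 < trimDelta ε η) (n : ℕ) :
    Real.exp (-aTwo n η ε b) = trimDelta ε η / (3 * maxIter n η ε b) := by
  have hT : (0 : ℝ) < maxIter n η ε b := by simp [maxIter]; positivity
  rw [aTwo, Real.exp_neg, Real.exp_log (by positivity), inv_div]

theorem exp_neg_aOne (hδ : 0 < trimDelta ε η) {n : ℕ} (hbn : b ≤ n) :
    Real.exp (-aOne n η ε b) = trimDelta ε η / (3 * maxIter n η ε b) / n.choose b := by
  have hC : (0 : ℝ) < n.choose b := by exact_mod_cast Nat.choose_pos hbn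
  rw [aOne, neg_add, Real.exp_add, exp_neg_aTwo hδ, Real.exp_neg, Real.exp_log hC,
    div_eq_mul_inv _ (n.choose b : ℝ)]

theorem aTwo_pos (hδ : 0 < trimDelta ε η) (hδ1 : trimDelta ε η < 1) (n : ℕ) :
    0 < aTwo n η ε b := by
  have hT : (1 : ℝ) ≤ maxIter n η ε b := by simp [maxIter]
  exact Real.log_pos (by rw [lt_div_iff₀ hδ]; linarith)

theorem aOne_pos (hδ : 0 < trimDelta ε η) (hδ1 : trimDelta ε η < 1) {n : ℕ} (hbn : b ≤ n) :
    0 < aOne n η ε b := by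
  have hC : (1 : ℝ) ≤ n.choose b := by exact_mod_cast Nat.choose_pos hbn
  exact add_pos_of_pos_of_nonneg (aTwo_pos hδ hδ1 n) (Real.log_nonneg hC)

theorem prob_boundFails_le (hδ : 0 < trimDelta ε η) (hδ1 : trimDelta ε η < 1)
    (hbn : b ≤ G.nodes.card) (B : Finset V) (k : ℕ) :
    (iidSamples (mrrSet G η) k).prob (BoundFails G η ε b B) ≤
      ENNReal.ofReal (2 * trimDelta ε η / (3 * maxIter G.nodes.card η ε b)) := by
  set n := G.nodes.card with hn
  have hT : (0 : ℝ) < maxIter n η ε b := by simp [maxIter]; positivity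
  have hC : (0 : ℝ) < n.choose b := by exact_mod_cast Nat.choose_pos hbn
  set c := trimDelta ε η / (3 * maxIter n η ε b) with hc
  have hc0 : 0 ≤ c := by positivity
  calc (iidSamples (mrrSet G η) k).prob (BoundFails G η ε b B)
      ≤ (iidSamples (mrrSet G η) k).prob (fun R =>
        (∃ S ∈ G.nodes.powersetCard b, k * (hitProb G η S).toReal <
          coverLower n η ε b (coverage R S)) ∨
        (√((coverage R B : ℝ) + aTwo n η ε b / 2) + √(aTwo n η ε b / 2)) ^ 2 <
          k * (hitProb G η B).toReal) := by
        refine PMF.prob_mono_support _ fun R hR h => ?_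
        rw [BoundFails, length_of_mem_support_iidSamples _ _ hR] at h
        exact h
    -- The lower bound must hold for all `b`-sets at once, as the greedy set depends on the sample;
    -- hence `ln (n choose b)` in `a₁`. The set `B` is fixed in advance, so `a₂` needs no such term.
    _ ≤ (∑ S ∈ G.nodes.powersetCard b, ENNReal.ofReal (c / n.choose b)) + ENNReal.ofReal c := by
        refine (PMF.prob_or_le _ _ _).trans (add_le_add ?_ ?_)
        · refine (PMF.prob_exists_le _ _ _).trans (Finset.sum_le_sum fun S _ => ?_)
          have := prob_mean_lt_lower (mrrSet G η) (fun r => decide (S ∩ r).Nonempty) k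
            (aOne_pos hδ hδ1 hbn)
          rw [prob_decide_eq_hitProb, exp_neg_aOne hδ hbn] at this
          exact this
        · have := prob_upper_lt_mean (mrrSet G η) (fun r => decide (B ∩ r).Nonempty) k
            (aTwo_pos (b := b) hδ hδ1 n)
          rw [prob_decide_eq_hitProb, exp_neg_aTwo hδ] at this
          exact this
    _ = _ := by
        rw [Finset.sum_const, Finset.card_powersetCard, ← hn, nsmul_eq_mul,
          ← ENNReal.ofReal_natCast, ← ENNReal.ofReal_mul hC.le,
          ← ENNReal.ofReal_add (by positivity) hc0]
        congr 1
        rw [mul_div_cancel₀ _ hC.ne', hc]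
        ring

/-- The stopping test certifies the approximation guarantee when the confidence bounds hold. -/
theorem not_isPoor_of_test {pick : List (Finset V) → Finset V → Finset V → V}
    (hpick : IsTieBreak pick) (h1 : ε < 1) (hδ : 0 < trimDelta ε η) (hδ1 : trimDelta ε η < 1)
    (hb : 1 ≤ b) {B : Finset V} (hB : B ⊆ G.nodes) (hBb : B.card = b) {R : List (Finset V)}
    (hR : R.length ≠ 0) (hbound : ¬ BoundFails G η ε b B R)
    (htest : rho b * (1 - trimEps ε) ≤
        coverLower G.nodes.card η ε b (coverage R (greedy pick R G.nodes b)) /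
          coverUpper G.nodes.card η ε b (coverage R (greedy pick R G.nodes b))) :
    ¬ IsPoor G η ε b B (greedy pick R G.nodes b) := by
  have hbn : b ≤ G.nodes.card := hBb ▸ Finset.card_le_card hB
  set S := greedy pick R G.nodes b with hS
  obtain ⟨hS1, hS2⟩ := greedy_subset_and_card hpick R G.nodes b hbn
  rw [BoundFails, not_or] at hbound
  push Not at hbound
  obtain ⟨hlow, hup⟩ := hbound
  have hlow' := hlow S (Finset.mem_powersetCard.2 ⟨hS1, hS2⟩)
  have ha2 := aTwo_pos (b := b) hδ hδ1 G.nodes.card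
  have hrho := rho_pos hb
  have hcov := rho_mul_coverage_le_greedy hpick R G.nodes hb hB hBb
  have hcov' : (coverage R B : ℝ) ≤ (coverage R S : ℝ) / rho b := by
    rw [le_div_iff₀ hrho, mul_comm]
    exact hcov
  have hupper : R.length * (hitProb G η B).toReal ≤
      coverUpper G.nodes.card η ε b (coverage R S) := by
    refine hup.trans ?_
    unfold coverUpper
    gcongr
  have hpos : 0 < coverUpper G.nodes.card η ε b (coverage R S) := by
    unfold coverUpper
    have : 0 < √(aTwo G.nodes.card η ε b / 2) := Real.sqrt_pos.2 (by positivity)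
    positivity
  rw [le_div_iff₀ hpos] at htest
  have hk : (0 : ℝ) < R.length := by exact_mod_cast Nat.pos_of_ne_zero hR
  have heps := trimEps_lt_one h1
  have hfac : 0 ≤ rho b * (1 - trimEps ε) := mul_nonneg hrho.le (by linarith)
  rw [IsPoor, not_lt]
  refine le_of_mul_le_mul_left ?_ hk
  calc R.length * (rho b * (1 - trimEps ε) * (hitProb G η B).toReal)
      = rho b * (1 - trimEps ε) * (R.length * (hitProb G η B).toReal) := by ring
    _ ≤ rho b * (1 - trimEps ε) * coverUpper G.nodes.card η ε b (coverage R S) :=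
        mul_le_mul_of_nonneg_left hupper hfac
    _ ≤ _ := htest.trans hlow'

/-- With at least `θ_max` mRR-sets the greedy solution is good with high probability. -/
theorem prob_isPoor_greedy_le {pick : List (Finset V) → Finset V → Finset V → V}
    (hpick : IsTieBreak pick) (h0 : 0 < ε) (h1 : ε < 1) (hη : 1 ≤ η) (hηn : η ≤ G.nodes.card)
    (hδ1 : trimDelta ε η < 1) (hb : 1 ≤ b) {B : Finset V} (hB : B ⊆ G.nodes) (hBb : B.card = b)
    {k : ℕ} (hk : thetaMax G.nodes.card η ε b ≤ k) :
    (iidSamples (mrrSet G η) k).prob (fun R => IsPoor G η ε b B (greedy pick R G.nodes b)) ≤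
      ENNReal.ofReal (trimDelta ε η / 3) := by
  have hδ := trimDelta_pos h0 h1 hη
  have hbn : b ≤ G.nodes.card := hBb ▸ Finset.card_le_card hB
  set n := G.nodes.card with hn
  have hn0 : (0 : ℝ) < n := by exact_mod_cast hb.trans hbn
  have hb0 : (0 : ℝ) < b := by exact_mod_cast hb
  have hC : (1 : ℝ) ≤ n.choose b := by exact_mod_cast Nat.choose_pos hbn
  have hC0 : (0 : ℝ) < n.choose b := by linarith
  have hrho := rho_pos hb
  have he0 := trimEps_pos h0 h1
  have he1 := trimEps_lt_one h1
  set e := trimEps ε with he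
  have hlog : 0 < Real.log (6 / trimDelta ε η) :=
    Real.log_pos (by rw [lt_div_iff₀ hδ]; linarith)
  have hlogC : 0 ≤ Real.log (n.choose b : ℝ) := Real.log_nonneg hC
  set s₁ := √(Real.log (6 / trimDelta ε η)) with hs₁
  set s₂ := √((Real.log (n.choose b : ℝ) + Real.log (6 / trimDelta ε η)) / rho b) with hs₂
  have hs₁0 : 0 < s₁ := Real.sqrt_pos.2 hlog
  have hs₂0 : 0 ≤ s₂ := Real.sqrt_nonneg _
  have hs₁2 : s₁ ^ 2 = Real.log (6 / trimDelta ε η) := Real.sq_sqrt hlog.le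
  have hs₂2 : s₂ ^ 2 = (Real.log (n.choose b : ℝ) + Real.log (6 / trimDelta ε η)) / rho b :=
    Real.sq_sqrt (by positivity)
  -- the mean coverage of `B` is large
  set M : ℝ := k * (hitProb G η B).toReal with hM
  have hpB : (b : ℝ) / n ≤ (hitProb G η B).toReal := by
    have h := card_div_le_hitProb G hη hηn hB
    rw [hBb, ← hn] at h
    exact (ENNReal.ofReal_le_iff_le_toReal (PMF.prob_ne_top _ _)).1 h
  -- `θ_max` is `n/b` times `2 (s₁ + s₂)² / ε̂²`, and `B` is hit with probability at least `b/n`.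
  have hMlow : 2 * (s₁ + s₂) ^ 2 ≤ e ^ 2 * M := by
    have h2 : thetaMax n η ε b * (b / n) ≤ M :=
      mul_le_mul hk hpB (by positivity) (Nat.cast_nonneg _)
    have h3 : thetaMax n η ε b * (b / n) = 2 * (s₁ + s₂) ^ 2 / e ^ 2 := by
      unfold thetaMax
      rw [← he, ← hs₁, ← hs₂]
      field_simp
    rw [h3, div_le_iff₀ (by positivity)] at h2
    linarith
  have hM0 : 0 < M := by
    have : 0 < 2 * (s₁ + s₂) ^ 2 := by positivity
    by_contra h
    have : e ^ 2 * M ≤ 0 := mul_nonpos_of_nonneg_of_nonpos (by positivity) (not_lt.1 h)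
    linarith
  set w := √(2 * M) with hw
  have hw0 : 0 < w := Real.sqrt_pos.2 (by positivity)
  have hw2 : w ^ 2 = 2 * M := Real.sq_sqrt (by positivity)
  have hew : 2 * (s₁ + s₂) ≤ e * w := by
    refine (sq_le_sq₀ (by positivity) (by positivity)).1 ?_
    rw [mul_pow, mul_pow, hw2]
    linarith
  -- `lam₁` makes the lower-tail exponent for `B` equal to `ln (6/δ)`. `lam₂` is what remains: `M' +
  -- lam₂ = ρ_b (M - lam₁)`, the coverage that greedy reaches if `B` does not fall short, while a
  -- poor set has mean below `M'`.
  set lam₁ := s₁ * w with hlam₁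
  set lam₂ := rho b * (e * M - lam₁) with hlam₂
  have hgap : w * s₂ ≤ e * M - lam₁ := by
    have : e * M = e * w * w / 2 := by
      have : M = w ^ 2 / 2 := by rw [hw2]; ring
      rw [this]; ring
    rw [this, hlam₁]
    nlinarith
  have hlam₁0 : 0 ≤ lam₁ := by positivity
  have hlam₂low : rho b * (w * s₂) ≤ lam₂ := mul_le_mul_of_nonneg_left hgap hrho.le
  have hlam₂0 : 0 ≤ lam₂ := le_trans (by positivity) hlam₂low
  set M' := rho b * (1 - e) * M with hM'
  have hM'0 : 0 < M' := by
    have : 0 < 1 - e := by linarith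
    positivity
  -- the two failure events
  have hevent : ∀ R, IsPoor G η ε b B (greedy pick R G.nodes b) →
      (coverage R B : ℝ) ≤ M - lam₁ ∨ ∃ S ∈ (G.nodes.powersetCard b).filter
        (fun S => k * (hitProb G η S).toReal ≤ M'), M' + lam₂ ≤ (coverage R S : ℝ) := by
    intro R hpoor
    rcases le_or_gt (coverage R B : ℝ) (M - lam₁) with h | h
    · exact Or.inl h
    · refine Or.inr ⟨greedy pick R G.nodes b, Finset.mem_filter.2
        ⟨Finset.mem_powersetCard.2 (greedy_subset_and_card hpick R G.nodes b hbn), ?_⟩, ?_⟩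
      · have := mul_le_mul_of_nonneg_left hpoor.le (Nat.cast_nonneg k : (0 : ℝ) ≤ k)
        rw [hM', hM]
        linarith
      · have h3 := rho_mul_coverage_le_greedy hpick R G.nodes hb hB hBb
        have h4 := mul_le_mul_of_nonneg_left h.le hrho.le
        rw [hlam₂, hM']
        linarith
  have hfirst : (iidSamples (mrrSet G η) k).prob (fun R => (coverage R B : ℝ) ≤ M - lam₁) ≤
      ENNReal.ofReal (trimDelta ε η / 6) := by
    have := prob_countP_le (mrrSet G η) (fun r => decide (B ∩ r).Nonempty) k hM0 hlam₁0
      (by rw [prob_decide_eq_hitProb])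
    refine this.trans_eq ?_
    congr 1
    rw [hlam₁, mul_pow, hw2, mul_div_assoc, div_self (by positivity), mul_one, hs₁2,
      Real.exp_neg, Real.exp_log (by positivity), inv_div]
  have hsecond : ∀ S ∈ (G.nodes.powersetCard b).filter
        (fun S => k * (hitProb G η S).toReal ≤ M'),
      (iidSamples (mrrSet G η) k).prob (fun R => M' + lam₂ ≤ (coverage R S : ℝ)) ≤
        ENNReal.ofReal (trimDelta ε η / 6 / n.choose b) := by
    intro S hS
    have := prob_le_countP (mrrSet G η) (fun r => decide (S ∩ r).Nonempty) k hM'0.le hlam₂0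
      (by rw [prob_decide_eq_hitProb]; exact (Finset.mem_filter.1 hS).2)
    refine this.trans (ENNReal.ofReal_le_ofReal ?_)
    have hexp : trimDelta ε η / 6 / n.choose b =
        Real.exp (-(Real.log (n.choose b : ℝ) + Real.log (6 / trimDelta ε η))) := by
      rw [← Real.log_mul hC0.ne' (by positivity), Real.exp_neg, Real.exp_log (by positivity)]
      field_simp
    rw [hexp]
    refine Real.exp_le_exp.2 (neg_le_neg ?_)
    have h5 : Real.log (n.choose b : ℝ) + Real.log (6 / trimDelta ε η) = rho b * s₂ ^ 2 := by
      rw [hs₂2]; field_simp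
    rw [h5, le_div_iff₀ (by positivity)]
    -- The slack `2 ρ_b e M` between `2 ρ_b M` and `2 M'` absorbs the term in `lam₂`, since `lam₂ ≤
    -- ρ_b e M`.
    have h6 : 2 * M' + 2 * lam₂ / 3 ≤ 2 * rho b * M := by
      rw [hM', hlam₂]
      have h7 : 0 ≤ rho b * (e * M) := by positivity
      have h8 : 0 ≤ rho b * lam₁ := by positivity
      nlinarith
    calc rho b * s₂ ^ 2 * (2 * M' + 2 * lam₂ / 3) ≤ rho b * s₂ ^ 2 * (2 * rho b * M) :=
          mul_le_mul_of_nonneg_left h6 (by positivity)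
      _ = (rho b * (w * s₂)) ^ 2 := by rw [mul_pow, mul_pow, hw2]; ring
      _ ≤ lam₂ ^ 2 := pow_le_pow_left₀ (by positivity) hlam₂low 2
  calc _ ≤ _ := PMF.prob_mono _ hevent
    _ ≤ ENNReal.ofReal (trimDelta ε η / 6) + ∑ S ∈ (G.nodes.powersetCard b).filter
        (fun S => k * (hitProb G η S).toReal ≤ M'),
          ENNReal.ofReal (trimDelta ε η / 6 / n.choose b) :=
        (PMF.prob_or_le _ _ _).trans (add_le_add hfirst
          ((PMF.prob_exists_le _ _ _).trans (Finset.sum_le_sum hsecond)))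
    _ ≤ ENNReal.ofReal (trimDelta ε η / 6) + ∑ S ∈ G.nodes.powersetCard b,
          ENNReal.ofReal (trimDelta ε η / 6 / n.choose b) :=
        add_le_add le_rfl (Finset.sum_le_sum_of_subset (Finset.filter_subset _ _))
    _ = _ := by
        rw [Finset.sum_const, Finset.card_powersetCard, ← hn, nsmul_eq_mul,
          ← ENNReal.ofReal_natCast, ← ENNReal.ofReal_mul hC0.le,
          ← ENNReal.ofReal_add (by positivity) (by positivity)]
        congr 1
        field_simp
        ring

/-- A union bound over the `j` tests and the final greedy solution. To avoid conditioning on earlier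
tests, the continuation is bounded as if the collection were always doubled, which keeps it
independent and identically distributed. -/
theorem expect_prob_isPoor_trimBLoop_le {pick : List (Finset V) → Finset V → Finset V → V}
    (hpick : IsTieBreak pick) (h0 : 0 < ε) (h1 : ε < 1) (hη : 1 ≤ η) (hηn : η ≤ G.nodes.card)
    (hδ1 : trimDelta ε η < 1) (hb : 1 ≤ b) {B : Finset V} (hB : B ⊆ G.nodes) (hBb : B.card = b)
    (j : ℕ) {k : ℕ} (hk0 : k ≠ 0)
    (hk : thetaMax G.nodes.card η ε b ≤ ((2 ^ j * k : ℕ) : ℝ)) :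
    ((iidSamples (mrrSet G η) k).expect fun R =>
      (trimBLoop pick G η ε b j R).prob (IsPoor G η ε b B)) ≤
      j * ENNReal.ofReal (2 * trimDelta ε η / (3 * maxIter G.nodes.card η ε b)) +
        ENNReal.ofReal (trimDelta ε η / 3) := by
  classical
  have hδ := trimDelta_pos h0 h1 hη
  have hbn : b ≤ G.nodes.card := hBb ▸ Finset.card_le_card hB
  induction j generalizing k with
  | zero =>
    simp only [trimBLoop, Nat.cast_zero, zero_mul, zero_add]
    rw [pow_zero, one_mul] at hk
    refine le_trans (le_of_eq ?_)
      (prob_isPoor_greedy_le hpick h0 h1 hη hηn hδ1 hb hB hBb hk)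
    rw [PMF.prob]
    congr 1
    funext R
    rw [PMF.prob_pure]
  | succ j ih =>
    have hstep : ∀ R ∈ (iidSamples (mrrSet G η) k).support,
        (trimBLoop pick G η ε b (j + 1) R).prob (IsPoor G η ε b B) ≤
          (if BoundFails G η ε b B R then 1 else 0) +
          (iidSamples (mrrSet G η) k).expect fun R' =>
            (trimBLoop pick G η ε b j (R ++ R')).prob (IsPoor G η ε b B) := by
      intro R hR
      have hlen := length_of_mem_support_iidSamples _ _ hR
      by_cases hf : BoundFails G η ε b B R
      · rw [if_pos hf]
        exact (PMF.prob_le_one _ _).trans le_self_add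
      · rw [if_neg hf, zero_add, trimBLoop]
        split_ifs with htest
        · rw [PMF.prob_pure, if_neg (not_isPoor_of_test hpick h1 hδ hδ1 hb hB hBb
            (by rw [hlen]; exact hk0) hf htest)]
          exact zero_le
        · rw [PMF.prob_bind, hlen]
    refine (PMF.expect_mono_support _ hstep).trans ?_
    rw [PMF.expect_add]
    have hjoin : ((iidSamples (mrrSet G η) k).expect fun R =>
        (iidSamples (mrrSet G η) k).expect fun R' =>
            (trimBLoop pick G η ε b j (R ++ R')).prob (IsPoor G η ε b B)) =
        (iidSamples (mrrSet G η) (k + k)).expect fun R =>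
          (trimBLoop pick G η ε b j R).prob (IsPoor G η ε b B) := by
      rw [iidSamples_add, PMF.expect_bind]
      simp only [PMF.expect_map]
    rw [hjoin]
    have hih := ih (k := k + k) (by omega) (by
      refine hk.trans_eq ?_
      push_cast
      ring)
    refine (add_le_add (prob_boundFails_le hδ hδ1 hbn B k) hih).trans_eq ?_
    push_cast
    ring

/-- The approximation guarantee of TRIM-B in expectation. -/
theorem mul_truncInfluence_le_expect_trimB {pick : List (Finset V) → Finset V → Finset V → V}
    (hpick : IsTieBreak pick) (h0 : 0 < ε) (h1 : ε < 1) (hη : 1 ≤ η) (hηn : η ≤ G.nodes.card)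
    (hb : 1 ≤ b) {B : Finset V} (hB : B ⊆ G.nodes) (hBb : B.card = b) :
    ENNReal.ofReal (rho b * (1 - 1 / Real.exp 1) * (1 - ε)) * truncInfluence G η B ≤
      (trimB pick G η ε b).expect (truncInfluence G η) := by
  have hbn : b ≤ G.nodes.card := hBb ▸ Finset.card_le_card hB
  have hrho := rho_pos hb
  have hexp := one_sub_inv_exp_pos
  have hε : 0 < 1 - ε := by linarith
  have hη0 : (0 : ℝ) < η := by exact_mod_cast hη
  -- In the first case `δ` need not be small and the sampling analysis does not apply. But then `α *
  -- η ≤ 1`, and every nonempty batch has truncated influence at least `1`.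
  rcases le_or_gt ((1 - 1 / Real.exp 1) * (1 - ε) * η) 1 with hsmall | hbig
  · calc ENNReal.ofReal (rho b * (1 - 1 / Real.exp 1) * (1 - ε)) * truncInfluence G η B
        ≤ ENNReal.ofReal (rho b * (1 - 1 / Real.exp 1) * (1 - ε)) * η :=
          mul_le_mul_right (truncInfluence_le G η B) _
      _ = ENNReal.ofReal (rho b * ((1 - 1 / Real.exp 1) * (1 - ε) * η)) := by
          rw [← ENNReal.ofReal_natCast, ← ENNReal.ofReal_mul (by positivity)]
          congr 1
          ring
      _ ≤ 1 := by
          rw [← ENNReal.ofReal_one]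
          exact ENNReal.ofReal_le_ofReal (mul_le_one₀ (rho_le_one b hb) (by positivity) hsmall)
      _ = (trimB pick G η ε b).expect fun _ => 1 := (PMF.expect_const _ _).symm
      _ ≤ _ := PMF.expect_mono_support _ fun S hS => by
          obtain ⟨hS1, hS2⟩ := mem_support_trimB hpick G η ε hbn hS
          exact one_le_truncInfluence G hη hS1 (Finset.card_pos.1 (by omega))
  · have hδ := trimDelta_pos h0 h1 hη
    have hδ2 := trimDelta_lt h0 hbig
    have hδ1 : trimDelta ε η < 1 := by linarith
    have he1 := trimEps_lt_one h1
    have hpoor : (trimB pick G η ε b).prob (IsPoor G η ε b B) ≤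
        ENNReal.ofReal (trimDelta ε η) := by
      rw [trimB, PMF.prob_bind]
      refine (expect_prob_isPoor_trimBLoop_le hpick h0 h1 hη hηn hδ1 hb hB hBb _
        (Nat.ceil_pos.2 (thetaInit_pos h0 h1 hb hbn hδ hδ1)).ne'
        (thetaMax_le_two_pow_mul h0 h1 hb hbn hδ hδ1)).trans ?_
      set T := maxIter G.nodes.card η ε b with hT
      have hT1 : 1 ≤ T := by simp [hT, maxIter]
      have hT0 : (0 : ℝ) < T := by exact_mod_cast hT1
      rw [← ENNReal.ofReal_natCast, ← ENNReal.ofReal_mul (Nat.cast_nonneg _),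
        ← ENNReal.ofReal_add (by positivity) (by positivity), Nat.cast_sub hT1]
      refine ENNReal.ofReal_le_ofReal ?_
      push_cast
      -- `T - 1` tests at `2δ/(3T)` each, plus `δ/3` for the last iteration, stay below `δ`.
      have : ((T : ℝ) - 1) * (2 * trimDelta ε η / (3 * T)) =
          2 * trimDelta ε η / 3 - 2 * trimDelta ε η / (3 * T) := by field_simp
      rw [this]
      have : 0 < 2 * trimDelta ε η / (3 * T) := by positivity
      linarith
    have hgood : ENNReal.ofReal (1 - trimDelta ε η) ≤
        (trimB pick G η ε b).prob fun S => ¬ IsPoor G η ε b B S := by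
      rw [ENNReal.ofReal_sub _ hδ.le, ENNReal.ofReal_one, tsub_le_iff_left,
        ← (trimB pick G η ε b).prob_add_prob_not (IsPoor G η ε b B)]
      exact add_le_add hpoor le_rfl
    -- For a set that is not poor, the two sides of the estimate by `η * hitProb` are used once
    -- each, the lossless one for `S` and the other for `B`, so `1 - 1/e` is paid once.
    have hmark := PMF.prob_mul_le_expect_support (trimB pick G η ε b)
      (s := fun S => ¬ IsPoor G η ε b B S) (f := truncInfluence G η)
      (c := ENNReal.ofReal (rho b * (1 - trimEps ε)) *
        (ENNReal.ofReal (1 - 1 / Real.exp 1) * truncInfluence G η B)) (fun S hS hSg => by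
          obtain ⟨hS1, hS2⟩ := mem_support_trimB hpick G η ε hbn hS
          have hle : ENNReal.ofReal (rho b * (1 - trimEps ε)) * hitProb G η B ≤
              hitProb G η S := by
            rw [IsPoor, not_lt] at hSg
            have hne : hitProb G η B ≠ ∞ := PMF.prob_ne_top _ _
            rw [← ENNReal.ofReal_toReal hne,
              ← ENNReal.ofReal_mul (mul_nonneg hrho.le (by linarith))]
            exact ENNReal.ofReal_le_of_le_toReal hSg
          calc _ ≤ ENNReal.ofReal (rho b * (1 - trimEps ε)) * (η * hitProb G η B) :=
                mul_le_mul_right (truncInfluence_le_mul_hitProb G hη hηn hB) _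
            _ = η * (ENNReal.ofReal (rho b * (1 - trimEps ε)) * hitProb G η B) := by ring
            _ ≤ η * hitProb G η S := mul_le_mul_right hle _
            _ ≤ _ := mul_hitProb_le_truncInfluence G hη hηn hS1)
    refine le_trans ?_ hmark
    refine le_trans ?_ (mul_le_mul_left hgood _)
    rw [← mul_assoc, ← mul_assoc, ← ENNReal.ofReal_mul (by linarith),
      ← ENNReal.ofReal_mul (mul_nonneg (by linarith) (mul_nonneg hrho.le (by linarith)))]
    refine mul_le_mul_left (ENNReal.ofReal_le_ofReal ?_) _
    have := mul_le_mul_of_nonneg_left (one_sub_le_mul_one_sub_trimEps h1 hδ2.le)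
      (by positivity : 0 ≤ rho b * (1 - 1 / Real.exp 1))
    linarith

end TrimAnalysis

namespace SocialNetwork

variable {V : Type*} [DecidableEq V] (G : SocialNetwork V)

/-! ### Independence of complementary sets of edges. -/

section Independence

/-- The network with only the edges that satisfy `P`. -/
def filterEdges (P : V × V → Prop) [DecidablePred P] : SocialNetwork V where
  nodes := G.nodes
  edges := G.edges.filter P
  prob := G.prob
  edges_subset := (Finset.filter_subset _ _).trans G.edges_subset
  prob_pos := fun e he => G.prob_pos e (Finset.mem_filter.1 he).1
  prob_le_one := fun e he => G.prob_le_one e (Finset.mem_filter.1 he).1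

theorem expect_realization (f : Finset (V × V) → ℝ≥0∞) :
    G.realization.expect f = ∑ φ ∈ G.edges.powerset, ENNReal.ofReal (G.weight φ) * f φ := by
  rw [PMF.expect, tsum_eq_sum (s := G.edges.powerset)]
  · refine Finset.sum_congr rfl fun φ hφ => ?_
    rw [realization, PMF.ofFinset_apply, if_pos (Finset.mem_powerset.1 hφ)]
  · intro φ hφ
    rw [realization, PMF.ofFinset_apply, if_neg fun h => hφ (Finset.mem_powerset.2 h), zero_mul]

theorem subset_edges_of_mem_support {φ : Finset (V × V)} (hφ : φ ∈ G.realization.support) :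
    φ ⊆ G.edges := by
  rw [PMF.mem_support_iff, realization, PMF.ofFinset_apply] at hφ
  by_contra h
  exact hφ (if_neg h)

theorem weight_union (P : V × V → Prop) [DecidablePred P] {φ₁ φ₂ : Finset (V × V)}
    (h₁ : φ₁ ⊆ G.edges.filter P) (h₂ : φ₂ ⊆ G.edges.filter fun e => ¬ P e) :
    G.weight (φ₁ ∪ φ₂) =
      (G.filterEdges P).weight φ₁ * (G.filterEdges fun e => ¬ P e).weight φ₂ := by
  have hd : Disjoint φ₁ φ₂ := Finset.disjoint_of_subset_left h₁
    (Finset.disjoint_of_subset_right h₂ (Finset.disjoint_filter_filter_not _ _ P))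
  have hs : G.edges \ (φ₁ ∪ φ₂) =
      (G.edges.filter P \ φ₁) ∪ ((G.edges.filter fun e => ¬ P e) \ φ₂) := by
    ext e
    have h1 := @h₁ e
    have h2 := @h₂ e
    simp only [Finset.mem_sdiff, Finset.mem_union, Finset.mem_filter] at h1 h2 ⊢
    tauto
  have hd' : Disjoint (G.edges.filter P \ φ₁) ((G.edges.filter fun e => ¬ P e) \ φ₂) :=
    Finset.disjoint_of_subset_left Finset.sdiff_subset
      (Finset.disjoint_of_subset_right Finset.sdiff_subset
        (Finset.disjoint_filter_filter_not _ _ P))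
  simp only [weight, filterEdges]
  rw [Finset.prod_union hd, hs, Finset.prod_union hd']
  ring

/-- A random realization splits into independent realizations of two complementary sets of
edges. -/
theorem expect_realization_split (P : V × V → Prop) [DecidablePred P]
    (f : Finset (V × V) → ℝ≥0∞) :
    G.realization.expect f = (G.filterEdges P).realization.expect fun φ₁ =>
      (G.filterEdges fun e => ¬ P e).realization.expect fun φ₂ => f (φ₁ ∪ φ₂) := by
  simp only [expect_realization, Finset.mul_sum]
  rw [← Finset.sum_product']
  refine Finset.sum_nbij' (fun φ => (φ.filter P, φ.filter fun e => ¬ P e))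
    (fun x => x.1 ∪ x.2) ?_ ?_ ?_ ?_ ?_
  · intro φ hφ
    rw [Finset.mem_powerset] at hφ
    exact Finset.mem_product.2 ⟨Finset.mem_powerset.2 (Finset.filter_subset_filter _ hφ),
      Finset.mem_powerset.2 (Finset.filter_subset_filter _ hφ)⟩
  · intro x hx
    obtain ⟨h1, h2⟩ := Finset.mem_product.1 hx
    exact Finset.mem_powerset.2 (Finset.union_subset
      ((Finset.mem_powerset.1 h1).trans (Finset.filter_subset _ _))
      ((Finset.mem_powerset.1 h2).trans (Finset.filter_subset _ _)))
  · intro φ _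
    exact Finset.filter_union_filter_not_eq _ _
  · intro x hx
    obtain ⟨h1, h2⟩ := Finset.mem_product.1 hx
    rw [Finset.mem_powerset] at h1 h2
    simp only [filterEdges] at h1 h2
    ext e
    · have h1 := @h1 e
      have h2 := @h2 e
      simp only [Finset.mem_union, Finset.mem_filter] at h1 h2 ⊢
      tauto
    · have h1 := @h1 e
      have h2 := @h2 e
      simp only [Finset.mem_union, Finset.mem_filter] at h1 h2 ⊢
      tauto
  · intro φ hφ
    rw [Finset.mem_powerset] at hφ
    have hu : φ.filter P ∪ φ.filter (fun e => ¬ P e) = φ := Finset.filter_union_filter_not_eq _ _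
    have h1 : φ.filter P ⊆ G.edges.filter P := Finset.filter_subset_filter _ hφ
    have h2 : φ.filter (fun e => ¬ P e) ⊆ G.edges.filter fun e => ¬ P e :=
      Finset.filter_subset_filter _ hφ
    have hw := G.weight_union P h1 h2
    rw [hu] at hw
    simp only [hu]
    rw [hw, ENNReal.ofReal_mul ((G.filterEdges P).weight_nonneg h1), mul_assoc]

/-- Marginals of the product law: a realization of a subnetwork may be replaced by one of `G`. -/
theorem expect_realization_filterEdges (P : V × V → Prop) [DecidablePred P]
    {f : Finset (V × V) → ℝ≥0∞} (hf : ∀ φ, f φ = f (φ.filter P)) :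
    (G.filterEdges P).realization.expect f = G.realization.expect f := by
  rw [G.expect_realization_split P]
  refine PMF.expect_congr_support _ fun φ₁ h₁ => ?_
  rw [← PMF.expect_const ((G.filterEdges fun e => ¬ P e).realization) (f φ₁)]
  refine PMF.expect_congr_support _ fun φ₂ h₂ => ?_
  have h₁' := subset_edges_of_mem_support _ h₁
  have h₂' := subset_edges_of_mem_support _ h₂
  rw [hf φ₁, hf (φ₁ ∪ φ₂)]
  congr 1
  ext e
  have h1 := @h₁' e
  have h2 := @h₂' e
  simp only [filterEdges, Finset.mem_union, Finset.mem_filter] at h1 h2 ⊢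
  tauto

/-- Functions of complementary sets of edges are independent. -/
theorem expect_mul_of_filter (P : V × V → Prop) [DecidablePred P]
    {f g : Finset (V × V) → ℝ≥0∞} (hf : ∀ φ, f φ = f (φ.filter P))
    (hg : ∀ φ, g φ = g (φ.filter fun e => ¬ P e)) :
    (G.realization.expect fun φ => f φ * g φ) = G.realization.expect f * G.realization.expect g := by
  rw [← G.expect_realization_filterEdges P hf,
    ← G.expect_realization_filterEdges (fun e => ¬ P e) hg, G.expect_realization_split P,
    ← PMF.expect_mul_const]
  refine PMF.expect_congr_support _ fun φ₁ h₁ => ?_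
  rw [← PMF.expect_const_mul]
  refine PMF.expect_congr_support _ fun φ₂ h₂ => ?_
  have h₁' := subset_edges_of_mem_support _ h₁
  have h₂' := subset_edges_of_mem_support _ h₂
  rw [hf φ₁, hg φ₂, hf (φ₁ ∪ φ₂), hg (φ₁ ∪ φ₂)]
  congr 2
  · ext e
    have h1 := @h₁' e
    have h2 := @h₂' e
    simp only [filterEdges, Finset.mem_union, Finset.mem_filter] at h1 h2 ⊢
    tauto
  · ext e
    have h1 := @h₁' e
    have h2 := @h₂' e
    simp only [filterEdges, Finset.mem_union, Finset.mem_filter] at h1 h2 ⊢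
    tauto

end Independence

/-! ### Reachability and influence in residual networks. -/

section Reachability

variable {G}

theorem mem_influenced {φ : Finset (V × V)} {S : Finset V} {v : V} :
    v ∈ G.influenced φ S ↔ v ∈ G.nodes ∧ ∃ u ∈ S, G.Reaches φ u v := by
  classical
  simp only [influenced, Finset.mem_filter]

/-- Live edges do not leave `A`. -/
def Closed (G : SocialNetwork V) (φ : Finset (V × V)) (A : Finset V) : Prop :=
  ∀ e ∈ G.edges, e ∈ φ → e.1 ∈ A → e.2 ∈ A

theorem Closed.union {φ : Finset (V × V)} {A C : Finset V} (hA : G.Closed φ A)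
    (hC : G.Closed φ C) : G.Closed φ (A ∪ C) := by
  intro e he hφ h
  rcases Finset.mem_union.1 h with h | h
  · exact Finset.mem_union_left _ (hA e he hφ h)
  · exact Finset.mem_union_right _ (hC e he hφ h)

theorem Closed.mem_of_reaches {φ : Finset (V × V)} {A : Finset V} (hA : G.Closed φ A) {u v : V}
    (h : G.Reaches φ u v) (hu : u ∈ A) : v ∈ A := by
  induction h with
  | refl => exact hu
  | tail _ hstep ih => exact hA _ hstep.1 hstep.2 ih

variable (G) in
/-- The network without the nodes in `A`. -/
def deleteNodes (A : Finset V) : SocialNetwork V := G.induce (G.nodes \ A)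

theorem mem_nodes_deleteNodes {A : Finset V} {v : V} :
    v ∈ (G.deleteNodes A).nodes ↔ v ∈ G.nodes ∧ v ∉ A := by
  simp only [deleteNodes, induce, Finset.mem_inter, Finset.mem_sdiff]
  tauto

theorem nodes_deleteNodes (A : Finset V) : (G.deleteNodes A).nodes = G.nodes \ A := by
  ext v
  rw [mem_nodes_deleteNodes, Finset.mem_sdiff]

theorem mem_edges_deleteNodes {A : Finset V} {e : V × V} :
    e ∈ (G.deleteNodes A).edges ↔ e ∈ G.edges ∧ e.1 ∉ A ∧ e.2 ∉ A := by
  have h := @G.edges_subset e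
  simp only [deleteNodes, induce, Finset.mem_filter, Finset.mem_sdiff, Finset.mem_product] at h ⊢
  tauto

theorem Reaches.mono {H : SocialNetwork V} {φ φ' : Finset (V × V)}
    (h : ∀ e, e ∈ G.edges → e ∈ φ → e ∈ H.edges ∧ e ∈ φ') {u v : V} (hr : G.Reaches φ u v) :
    H.Reaches φ' u v := by
  induction hr with
  | refl => exact Relation.ReflTransGen.refl
  | tail _ hstep ih => exact Relation.ReflTransGen.tail ih (h _ hstep.1 hstep.2)

theorem Reaches.of_deleteNodes {φ : Finset (V × V)} {A C : Finset V} (hAC : A ⊆ C) {u v : V}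
    (h : (G.deleteNodes C).Reaches φ u v) : (G.deleteNodes A).Reaches φ u v := by
  refine Reaches.mono (fun e he hφ => ⟨?_, hφ⟩) h
  have := mem_edges_deleteNodes.1 he
  exact mem_edges_deleteNodes.2 ⟨this.1, fun h => this.2.1 (hAC h), fun h => this.2.2 (hAC h)⟩

theorem Reaches.of_deleteNodes' {φ : Finset (V × V)} {A : Finset V} {u v : V}
    (h : (G.deleteNodes A).Reaches φ u v) : G.Reaches φ u v :=
  Reaches.mono (fun _ he hφ => ⟨(mem_edges_deleteNodes.1 he).1, hφ⟩) h

/-- A live path that enters a closed set cannot leave it, so a path ending outside never visits it.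
-/
theorem Closed.reaches_deleteNodes {φ : Finset (V × V)} {A : Finset V} (hA : G.Closed φ A)
    {u v : V} (h : G.Reaches φ u v) (hv : v ∉ A) : (G.deleteNodes A).Reaches φ u v := by
  induction h using Relation.ReflTransGen.head_induction_on with
  | refl => exact Relation.ReflTransGen.refl
  | head hstep htail ih =>
    refine Relation.ReflTransGen.head ⟨mem_edges_deleteNodes.2 ⟨hstep.1, ?_, ?_⟩, hstep.2⟩ ih
    · exact fun h => hv (hA.mem_of_reaches htail (hA _ hstep.1 hstep.2 h))
    · exact fun h => hv (hA.mem_of_reaches htail h)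

theorem influenced_deleteNodes_mono {φ : Finset (V × V)} {A C : Finset V} (hAC : A ⊆ C)
    (S : Finset V) :
    (G.deleteNodes C).influenced φ S ⊆ (G.deleteNodes A).influenced φ S := by
  intro v hv
  obtain ⟨h1, u, hu, hr⟩ := mem_influenced.1 hv
  have h2 := mem_nodes_deleteNodes.1 h1
  exact mem_influenced.2 ⟨mem_nodes_deleteNodes.2 ⟨h2.1, fun h => h2.2 (hAC h)⟩, u, hu,
    hr.of_deleteNodes hAC⟩

theorem influenced_mono {φ : Finset (V × V)} {S T : Finset V} (h : S ∩ G.nodes ⊆ T) :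
    G.influenced φ S ⊆ G.influenced φ T := by
  intro v hv
  obtain ⟨h1, u, hu, hr⟩ := mem_influenced.1 hv
  refine mem_influenced.2 ⟨h1, u, h (Finset.mem_inter.2 ⟨hu, ?_⟩), hr⟩
  rcases Relation.ReflTransGen.cases_head hr with rfl | ⟨w, hw, -⟩
  · exact h1
  · exact (Finset.mem_product.1 (G.edges_subset hw.1)).1

/-- The influence of `S` depends only on the edges that leave it. -/
theorem influenced_congr {φ φ' : Finset (V × V)} {S : Finset V}
    (h : ∀ e : V × V, e.1 ∈ G.influenced φ S → (e ∈ φ ↔ e ∈ φ')) :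
    G.influenced φ' S = G.influenced φ S := by
  ext v
  constructor
  · intro hv
    obtain ⟨h1, u, hu, hr⟩ := mem_influenced.1 hv
    have hun : u ∈ G.nodes := by
      rcases Relation.ReflTransGen.cases_head hr with rfl | ⟨w, hw, -⟩
      · exact h1
      · exact (Finset.mem_product.1 (G.edges_subset hw.1)).1
    clear h1 hv
    induction hr with
    | refl => exact mem_influenced.2 ⟨hun, u, hu, Relation.ReflTransGen.refl⟩
    | tail _ hstep ih =>
      obtain ⟨-, w, hw, hr⟩ := mem_influenced.1 ih
      exact mem_influenced.2 ⟨(Finset.mem_product.1 (G.edges_subset hstep.1)).2, w, hw,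
        hr.tail ⟨hstep.1, (h _ ih).2 hstep.2⟩⟩
  · intro hv
    obtain ⟨h1, u, hu, hr⟩ := mem_influenced.1 hv
    have hun : u ∈ G.nodes := by
      rcases Relation.ReflTransGen.cases_head hr with rfl | ⟨w, hw, -⟩
      · exact h1
      · exact (Finset.mem_product.1 (G.edges_subset hw.1)).1
    refine mem_influenced.2 ⟨h1, u, hu, ?_⟩
    clear h1 hv
    induction hr with
    | refl => exact Relation.ReflTransGen.refl
    | @tail x y hux hstep ih =>
      have hx : x ∈ G.influenced φ S := by
        refine mem_influenced.2 ⟨(Finset.mem_product.1 (G.edges_subset hstep.1)).1, u, hu, hux⟩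
      exact ih.tail ⟨hstep.1, (h _ hx).1 hstep.2⟩

/-- The spread in a network depends only on the status of its own edges. -/
theorem influenced_filter (P : V × V → Prop) [DecidablePred P] (hP : ∀ e ∈ G.edges, P e)
    (φ : Finset (V × V)) (S : Finset V) :
    G.influenced φ S = G.influenced (φ.filter P) S := by
  ext v
  have : ∀ u, G.Reaches φ u v ↔ G.Reaches (φ.filter P) u v := by
    intro u
    constructor
    · exact Reaches.mono fun e he hφ => ⟨he, Finset.mem_filter.2 ⟨hφ, hP _ he⟩⟩
    · exact Reaches.mono fun e he hφ => ⟨he, (Finset.mem_filter.1 hφ).1⟩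
  simp only [mem_influenced, this]

theorem card_union_influenced (φ : Finset (V × V)) (A S : Finset V) :
    ((G.deleteNodes A).influenced φ S ∪ A).card = A.card + (G.deleteNodes A).spread φ S := by
  rw [Finset.card_union_of_disjoint, spread, add_comm]
  refine Finset.disjoint_left.2 fun v hv => ?_
  exact (mem_nodes_deleteNodes.1 (influenced_subset_nodes _ _ _ hv)).2

/-- Further nodes activated by a second process that has activated `C`, besides those in `A`. -/
theorem card_union_union_influenced_le {φ : Finset (V × V)} {A C : Finset V}
    (hA : G.Closed φ A) (hC : G.Closed φ C) (S : Finset V) :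
    (A ∪ ((G.deleteNodes C).influenced φ S ∪ C)).card ≤
      (A ∪ C).card + (G.deleteNodes (A ∪ C)).spread φ S := by
  rw [← card_union_influenced]
  refine Finset.card_le_card fun v hv => ?_
  by_cases hAC : v ∈ A ∪ C
  · exact Finset.mem_union_right _ hAC
  · refine Finset.mem_union_left _ ?_
    have hvC : v ∈ (G.deleteNodes C).influenced φ S := by
      simp only [Finset.mem_union] at hv hAC
      tauto
    obtain ⟨hn, u, hu, hr⟩ := mem_influenced.1 hvC
    exact mem_influenced.2 ⟨mem_nodes_deleteNodes.2 ⟨(mem_nodes_deleteNodes.1 hn).1, hAC⟩, u, hu,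
      (hA.union hC).reaches_deleteNodes hr.of_deleteNodes' hAC⟩

/-- Seeding in two stages influences the same nodes as seeding at once. -/
theorem influenced_union_of_closed {φ : Finset (V × V)} {S : Finset V}
    (hC : G.Closed φ (G.influenced φ S)) (B : Finset V) :
    (G.deleteNodes (G.influenced φ S)).influenced φ B ∪ G.influenced φ S =
      G.influenced φ (B ∪ S) := by
  ext v
  constructor
  · intro hv
    rcases Finset.mem_union.1 hv with hv | hv
    · obtain ⟨hn, u, hu, hr⟩ := mem_influenced.1 hv
      exact mem_influenced.2 ⟨(mem_nodes_deleteNodes.1 hn).1, u, Finset.mem_union_left _ hu,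
        hr.of_deleteNodes'⟩
    · exact influenced_mono (fun x hx => Finset.mem_union_right _ (Finset.mem_inter.1 hx).1) hv
  · intro hv
    by_cases hvS : v ∈ G.influenced φ S
    · exact Finset.mem_union_right _ hvS
    · obtain ⟨hn, u, hu, hr⟩ := mem_influenced.1 hv
      rcases Finset.mem_union.1 hu with hu | hu
      · exact Finset.mem_union_left _ (mem_influenced.2 ⟨mem_nodes_deleteNodes.2 ⟨hn, hvS⟩, u, hu,
          hC.reaches_deleteNodes hr hvS⟩)
      · exact absurd (mem_influenced.2 ⟨hn, u, hu, hr⟩) hvS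

/-- Puts all residual networks on the common probability space of realizations of `G`. -/
theorem truncInfluence_deleteNodes (A : Finset V) (η : ℕ) (S : Finset V) :
    truncInfluence (G.deleteNodes A) η S =
      G.realization.expect fun φ => ((min ((G.deleteNodes A).spread φ S) η : ℕ) : ℝ≥0∞) := by
  rw [← G.expect_realization_filterEdges
    (fun e => e.1 ∈ G.nodes \ A ∧ e.2 ∈ G.nodes \ A)]
  · rfl
  · intro φ
    rw [spread, spread, influenced_filter _ fun e he => (Finset.mem_filter.1 he).2]

/-- The influence in the residual network is independent of the edges that leave the removed
nodes. -/
theorem expect_mul_spread_deleteNodes (A : Finset V) (η : ℕ) (S : Finset V)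
    {f : Finset (V × V) → ℝ≥0∞} (hf : ∀ φ, f φ = f (φ.filter fun e => e.1 ∈ A)) :
    (G.realization.expect fun φ =>
      f φ * ((min ((G.deleteNodes A).spread φ S) η : ℕ) : ℝ≥0∞)) =
      G.realization.expect f * truncInfluence (G.deleteNodes A) η S := by
  rw [truncInfluence_deleteNodes]
  refine G.expect_mul_of_filter (fun e => e.1 ∈ A) hf fun φ => ?_
  rw [spread, spread, influenced_filter _ fun e he => (mem_edges_deleteNodes.1 he).2.1]

theorem truncInfluence_deleteNodes_anti {A C : Finset V} (hAC : A ⊆ C) (η : ℕ) (S : Finset V) :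
    truncInfluence (G.deleteNodes C) η S ≤ truncInfluence (G.deleteNodes A) η S := by
  rw [truncInfluence_deleteNodes, truncInfluence_deleteNodes]
  refine PMF.expect_mono _ fun φ => ?_
  have : (G.deleteNodes C).spread φ S ≤ (G.deleteNodes A).spread φ S :=
    Finset.card_le_card (influenced_deleteNodes_mono hAC S)
  exact_mod_cast min_le_min_right _ this

theorem truncInfluence_mono {S T : Finset V} (h : S ∩ G.nodes ⊆ T) (η : ℕ) :
    truncInfluence G η S ≤ truncInfluence G η T := by
  refine PMF.expect_mono _ fun φ => ?_
  have : G.spread φ S ≤ G.spread φ T := Finset.card_le_card (influenced_mono h)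
  exact_mod_cast min_le_min_right _ this

end Reachability

end SocialNetwork

/-! ### Laws of observation histories. -/

section Histories

variable {V : Type*} [DecidableEq V]

/-- One round of a policy, unless the target has been reached. -/
noncomputable def historyStep (G : SocialNetwork V) (η : ℕ) (π : Policy V) (φ : Finset (V × V))
    (h : List (Observation V)) : PMF (List (Observation V)) :=
  if η ≤ (activeOf h).card then PMF.pure h else (π h).map fun B => observe G φ h B :: h

/-- The law of the observations made in the first `k` rounds. -/
noncomputable def historyLaw (G : SocialNetwork V) (η : ℕ) (π : Policy V) (φ : Finset (V × V)) :
    ℕ → PMF (List (Observation V))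
  | 0 => PMF.pure []
  | k + 1 => (historyLaw G η π φ k).bind (historyStep G η π φ)

variable {G : SocialNetwork V} {η b : ℕ} {π : Policy V} {φ : Finset (V × V)}

theorem runFrom_succ (k : ℕ) (h : List (Observation V)) :
    runFrom G η π φ (k + 1) h = (historyStep G η π φ h).bind (runFrom G η π φ k) := by
  rw [runFrom, historyStep]
  split_ifs with hd
  · rw [PMF.pure_bind]
    cases k with
    | zero => rfl
    | succ k => rw [runFrom, if_pos hd]
  · rw [PMF.bind_map]
    rfl

/-- `runFrom` recurses on the remaining rounds, `historyLaw` appends a last round; the latter suits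
induction on the number of rounds. -/
theorem seedSet_eq_map_historyLaw :
    seedSet G η π φ = (historyLaw G η π φ G.nodes.card).map seedsOf := by
  have key : ∀ k j, (historyLaw G η π φ j).bind (runFrom G η π φ k) =
      (historyLaw G η π φ (j + k)).map seedsOf := by
    intro k
    induction k with
    | zero => intro j; rfl
    | succ k ih =>
      intro j
      have : runFrom G η π φ (k + 1) =
          fun h => (historyStep G η π φ h).bind (runFrom G η π φ k) :=
        funext fun h => runFrom_succ k h
      rw [this, ← PMF.bind_bind]
      have h2 := ih (j + 1)
      rw [historyLaw] at h2
      rw [h2]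
      congr 2
      omega
  have := key G.nodes.card 0
  rw [historyLaw, PMF.pure_bind, Nat.zero_add] at this
  exact this

theorem residualGraph_eq (h : List (Observation V)) :
    residualGraph G h = G.deleteNodes (activeOf h) := rfl

theorem mem_support_historyStep {h g : List (Observation V)}
    (hg : g ∈ (historyStep G η π φ h).support) :
    (η ≤ (activeOf h).card ∧ g = h) ∨
      ((activeOf h).card < η ∧ ∃ B ∈ (π h).support, g = observe G φ h B :: h) := by
  rw [historyStep] at hg
  split_ifs at hg with hd
  · exact Or.inl ⟨hd, (PMF.mem_support_pure_iff _ _).1 hg⟩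
  · obtain ⟨B, hB, rfl⟩ := (PMF.mem_support_map_iff _ _ _).1 hg
    exact Or.inr ⟨not_le.1 hd, B, hB, rfl⟩

/-- Induction along the rounds of a policy. -/
theorem historyLaw_induction {P : ℕ → List (Observation V) → Prop} (h0 : P 0 [])
    (hdone : ∀ k h, P k h → η ≤ (activeOf h).card → P (k + 1) h)
    (hstep : ∀ k h, P k h → (activeOf h).card < η → ∀ B ∈ (π h).support,
      P (k + 1) (observe G φ h B :: h))
    {k : ℕ} {h : List (Observation V)} (hh : h ∈ (historyLaw G η π φ k).support) : P k h := by
  induction k generalizing h with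
  | zero =>
    rw [historyLaw, PMF.mem_support_pure_iff] at hh
    rw [hh]
    exact h0
  | succ k ih =>
    rw [historyLaw, PMF.mem_support_bind_iff] at hh
    obtain ⟨g, hg, hh⟩ := hh
    rcases mem_support_historyStep hh with ⟨hd, rfl⟩ | ⟨hd, B, hB, rfl⟩
    · exact hdone k _ (ih hg) hd
    · exact hstep k _ (ih hg) hd B hB

theorem activeOf_observe (h : List (Observation V)) (B : Finset V) :
    activeOf (observe G φ h B :: h) =
      (G.deleteNodes (activeOf h)).influenced φ B ∪ activeOf h := rfl

theorem card_activeOf_observe (h : List (Observation V)) (B : Finset V) :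
    (activeOf (observe G φ h B :: h)).card =
      (activeOf h).card + (G.deleteNodes (activeOf h)).spread φ B := by
  rw [activeOf_observe, SocialNetwork.card_union_influenced]

theorem closed_influenced (S : Finset V) : G.Closed φ (G.influenced φ S) := by
  intro e he hφ h
  obtain ⟨-, u, hu, hr⟩ := SocialNetwork.mem_influenced.1 h
  exact SocialNetwork.mem_influenced.2
    ⟨(Finset.mem_product.1 (G.edges_subset he)).2, u, hu, hr.tail ⟨he, hφ⟩⟩

/-- Seeding round by round in residual networks influences the same nodes as seeding all at once; in
particular the active set is closed under live edges. -/
theorem activeOf_eq_influenced {k : ℕ} {h : List (Observation V)}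
    (hh : h ∈ (historyLaw G η π φ k).support) : activeOf h = G.influenced φ (seedsOf h) := by
  refine historyLaw_induction (P := fun _ h => activeOf h = G.influenced φ (seedsOf h))
    ?_ (fun _ _ h _ => h) ?_ hh
  · ext v
    simp [SocialNetwork.mem_influenced, activeOf, seedsOf]
  · intro k h ih _ B _
    rw [activeOf_observe, ih, SocialNetwork.influenced_union_of_closed (closed_influenced _)]
    rfl

theorem closed_activeOf {k : ℕ} {h : List (Observation V)}
    (hh : h ∈ (historyLaw G η π φ k).support) : G.Closed φ (activeOf h) := by
  rw [activeOf_eq_influenced hh]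
  exact closed_influenced _

theorem activeOf_subset_nodes {k : ℕ} {h : List (Observation V)}
    (hh : h ∈ (historyLaw G η π φ k).support) : activeOf h ⊆ G.nodes := by
  rw [activeOf_eq_influenced hh]
  exact influenced_subset_nodes _ _ _

theorem seedsOf_subset_nodes (hπ : IsBatched G b π) {k : ℕ} {h : List (Observation V)}
    (hh : h ∈ (historyLaw G η π φ k).support) : seedsOf h ⊆ G.nodes := by
  refine historyLaw_induction (P := fun _ h => seedsOf h ⊆ G.nodes)
    (Finset.empty_subset _) (fun _ _ h _ => h) ?_ hh
  intro k h ih _ B hB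
  refine Finset.union_subset (fun v hv => ?_) ih
  have := (hπ h B hB).1 hv
  rw [residualGraph_eq, SocialNetwork.mem_nodes_deleteNodes] at this
  exact this.1

theorem card_nodes_residualGraph {h : List (Observation V)} (hh : activeOf h ⊆ G.nodes) :
    (residualGraph G h).nodes.card = G.nodes.card - (activeOf h).card := by
  rw [residualGraph_eq, SocialNetwork.nodes_deleteNodes, Finset.card_sdiff_of_subset hh]

theorem card_batch_le_spread (hπ : IsBatched G b π) {h : List (Observation V)} {B : Finset V}
    (hB : B ∈ (π h).support) : B.card ≤ (G.deleteNodes (activeOf h)).spread φ B :=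
  Finset.card_le_card (subset_influenced _ _ (hπ h B hB).1)

/-- An unfinished round activates at least its own batch. A batch with fewer than `b` nodes uses up
all nodes, and `η ≤ n`. -/
theorem min_le_card_activeOf (hπ : IsBatched G b π) (hηn : η ≤ G.nodes.card) {k : ℕ}
    {h : List (Observation V)} (hh : h ∈ (historyLaw G η π φ k).support) :
    min η (k * b) ≤ (activeOf h).card := by
  refine (historyLaw_induction (P := fun k h => activeOf h ⊆ G.nodes ∧
    min η (k * b) ≤ (activeOf h).card) (by simp [activeOf])
    (fun k h ih hd => ⟨ih.1, (min_le_left _ _).trans hd⟩) ?_ hh).2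
  intro k h ih _ B hB
  have hsub : activeOf (observe G φ h B :: h) ⊆ G.nodes := by
    rw [activeOf_observe]
    refine Finset.union_subset (fun v hv => ?_) ih.1
    exact (SocialNetwork.mem_nodes_deleteNodes.1 (influenced_subset_nodes _ _ _ hv)).1
  refine ⟨hsub, ?_⟩
  rw [card_activeOf_observe]
  have h1 := card_batch_le_spread (φ := φ) hπ hB
  have h2 := (hπ h B hB).2
  rw [card_nodes_residualGraph ih.1] at h2
  have h3 := ih.2
  rw [Nat.succ_mul]
  omega

theorem isFeasible_of_isBatched (hb : 1 ≤ b) (hπ : IsBatched G b π) (hηn : η ≤ G.nodes.card) :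
    IsFeasible G η π := by
  intro φ _ S hS
  rw [seedSet_eq_map_historyLaw] at hS
  obtain ⟨h, hh, rfl⟩ := (PMF.mem_support_map_iff _ _ _).1 hS
  have h1 := min_le_card_activeOf hπ hηn hh
  rw [activeOf_eq_influenced hh] at h1
  have h2 : G.nodes.card ≤ G.nodes.card * b := Nat.le_mul_of_pos_right _ hb
  rw [min_eq_left (hηn.trans h2)] at h1
  exact h1

/-- An observation reveals exactly the status of the edges leaving newly active nodes, so
realizations that agree on edges out of `activeOf h` lead from `g` to `h` equally often. -/
theorem historyStep_congr {φ' : Finset (V × V)} {g h : List (Observation V)}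
    (hagree : ∀ e : V × V, e.1 ∈ activeOf h → (e ∈ φ ↔ e ∈ φ'))
    (hne : historyStep G η π φ g h ≠ 0) :
    activeOf g ⊆ activeOf h ∧ historyStep G η π φ' g h = historyStep G η π φ g h := by
  classical
  have haux : ∀ (ψ ψ' : Finset (V × V)) (B : Finset V),
      (∀ e : V × V, e.1 ∈ activeOf h → (e ∈ ψ ↔ e ∈ ψ')) →
      h = observe G ψ g B :: g → h = observe G ψ' g B :: g := by
    intro ψ ψ' B hψ hB
    have hag : ∀ e : V × V, e.1 ∈ (residualGraph G g).influenced ψ B → (e ∈ ψ ↔ e ∈ ψ') := by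
      intro e he
      refine hψ e ?_
      rw [hB]
      exact Finset.mem_union_left _ he
    have hinf : (residualGraph G g).influenced ψ' B = (residualGraph G g).influenced ψ B :=
      SocialNetwork.influenced_congr hag
    rw [hB]
    congr 1
    simp only [observe, hinf, Observation.mk.injEq, true_and]
    ext e
    simp only [Finset.mem_filter]
    constructor
    · exact fun he => ⟨(hag e he.2).1 he.1, he.2⟩
    · exact fun he => ⟨(hag e he.2).2 he.1, he.2⟩
  have hsub : activeOf g ⊆ activeOf h := by
    rcases mem_support_historyStep ((PMF.mem_support_iff _ _).2 hne) with
      ⟨-, rfl⟩ | ⟨-, B, -, rfl⟩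
    · exact Finset.Subset.refl _
    · exact Finset.subset_union_right
  refine ⟨hsub, ?_⟩
  rw [historyStep, historyStep]
  split_ifs
  · rfl
  · rw [PMF.map_apply, PMF.map_apply]
    refine tsum_congr fun B => ?_
    have : h = observe G φ' g B :: g ↔ h = observe G φ g B :: g :=
      ⟨haux φ' φ B fun e he => (hagree e he).symm, haux φ φ' B hagree⟩
    by_cases hc : h = observe G φ g B :: g
    · rw [if_pos (this.2 hc), if_pos hc]
    · rw [if_neg fun hc' => hc (this.1 hc'), if_neg hc]

/-- The probability of a history depends only on the edges that leave its active nodes. -/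
theorem historyLaw_congr {φ' : Finset (V × V)} (k : ℕ) {h : List (Observation V)}
    (hagree : ∀ e : V × V, e.1 ∈ activeOf h → (e ∈ φ ↔ e ∈ φ')) :
    historyLaw G η π φ k h = historyLaw G η π φ' k h := by
  induction k generalizing h with
  | zero => rfl
  | succ k ih =>
    rw [historyLaw, historyLaw, PMF.bind_apply, PMF.bind_apply]
    refine tsum_congr fun g => ?_
    by_cases h1 : historyStep G η π φ g h = 0
    · by_cases h2 : historyStep G η π φ' g h = 0
      · rw [h1, h2, mul_zero, mul_zero]
      · have := (historyStep_congr (fun e he => (hagree e he).symm) h2).2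
        exact absurd (this.symm.trans h1) h2
    · obtain ⟨hsub, heq⟩ := historyStep_congr hagree h1
      rw [heq, ih fun e he => hagree e (hsub he)]

theorem historyLaw_filter {A : Finset V} (k : ℕ) {h : List (Observation V)}
    (hA : activeOf h ⊆ A) :
    historyLaw G η π φ k h = historyLaw G η π (φ.filter fun e => e.1 ∈ A) k h := by
  refine historyLaw_congr k fun e he => ?_
  rw [Finset.mem_filter]
  exact ⟨fun h => ⟨h, hA he⟩, fun h => h.1⟩

theorem expect_historyLaw_succ (k : ℕ) (f : List (Observation V) → ℝ≥0∞) :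
    (historyLaw G η π φ (k + 1)).expect f =
      (historyLaw G η π φ k).expect fun h => (historyStep G η π φ h).expect f := by
  rw [historyLaw, PMF.expect_bind]

theorem expect_historyStep_of_done {h : List (Observation V)} (hd : η ≤ (activeOf h).card)
    (f : List (Observation V) → ℝ≥0∞) : (historyStep G η π φ h).expect f = f h := by
  rw [historyStep, if_pos hd, PMF.expect_pure]

theorem expect_historyStep_of_lt {h : List (Observation V)} (hd : (activeOf h).card < η)
    (f : List (Observation V) → ℝ≥0∞) : (historyStep G η π φ h).expect f =
      (π h).expect fun B => f (observe G φ h B :: h) := by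
  rw [historyStep, if_neg (not_le.2 hd), PMF.expect_map]

end Histories

/-! ### An approximately greedy policy against an arbitrary one. -/

section Comparison

variable {V : Type*} [DecidableEq V] {G : SocialNetwork V} {η b : ℕ}

theorem min_add_le_min_add {u a k η : ℕ} (hau : a ≤ u) :
    min (u + k) η ≤ min u η + min k (η - a) := by omega

/-- A policy gains at most `t * D` in `t` rounds beyond the nodes activated in a given history of
another policy, if no batch has a larger truncated influence than `D` after that history. -/
theorem expect_mul_card_union_le {γ π : Policy V} {r : ℕ} {h : List (Observation V)}
    {D : ℝ≥0∞} (hD : ∀ g, ∀ B ∈ (π g).support,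
      truncInfluence (G.deleteNodes (activeOf h)) (η - (activeOf h).card) B ≤ D) (t : ℕ) :
    (G.realization.expect fun φ => historyLaw G η γ φ r h *
      (historyLaw G η π φ t).expect fun g => ((min (activeOf h ∪ activeOf g).card η : ℕ) : ℝ≥0∞)) ≤
    ((activeOf h).card + t * D) * G.realization.expect fun φ => historyLaw G η γ φ r h := by
  set A := activeOf h with hA
  set X := η - A.card with hX
  set w : Finset (V × V) → ℝ≥0∞ := fun φ => historyLaw G η γ φ r h with hw
  induction t with
  | zero =>
    simp only [historyLaw, PMF.expect_pure, activeOf, Finset.union_empty, Nat.cast_zero, zero_mul,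
      add_zero]
    rw [PMF.expect_mul_const, mul_comm]
    exact mul_le_mul_left (by exact_mod_cast min_le_left _ _) _
  | succ t ih =>
    -- the gain in the next round, which is independent of the past
    have hgain : (G.realization.expect fun φ => w φ * (historyLaw G η π φ t).expect fun g =>
        (π g).expect fun B =>
          ((min ((G.deleteNodes (A ∪ activeOf g)).spread φ B) X : ℕ) : ℝ≥0∞)) ≤
        D * G.realization.expect w := by
      calc _ = ∑' g, (π g).expect fun B => G.realization.expect fun φ =>
            w φ * historyLaw G η π φ t g *
              ((min ((G.deleteNodes (A ∪ activeOf g)).spread φ B) X : ℕ) : ℝ≥0∞) := by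
            have : ∀ g, ((π g).expect fun B => G.realization.expect fun φ =>
                w φ * historyLaw G η π φ t g *
                ((min ((G.deleteNodes (A ∪ activeOf g)).spread φ B) X : ℕ) : ℝ≥0∞)) =
                G.realization.expect fun φ => w φ * (historyLaw G η π φ t g * (π g).expect fun B =>
                  ((min ((G.deleteNodes (A ∪ activeOf g)).spread φ B) X : ℕ) : ℝ≥0∞)) := by
              intro g
              rw [PMF.expect_comm]
              congr 1
              funext φ
              rw [PMF.expect_const_mul, mul_assoc]
            simp only [this]
            rw [← PMF.expect_tsum]
            congr 1
            funext φ
            rw [ENNReal.tsum_mul_left]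
            rfl
        -- Deferred decisions: both histories are determined by edges leaving `A ∪ activeOf g`, and
        -- the next spread only involves other edges, so the factors are independent.
        _ = ∑' g, (π g).expect fun B =>
            (G.realization.expect fun φ => w φ * historyLaw G η π φ t g) *
              truncInfluence (G.deleteNodes (A ∪ activeOf g)) X B := by
            refine tsum_congr fun g => ?_
            congr 1
            funext B
            refine SocialNetwork.expect_mul_spread_deleteNodes _ _ _ fun φ => ?_
            simp only [hw]
            rw [historyLaw_filter r (Finset.subset_union_left (s₂ := activeOf g)),
              historyLaw_filter t (Finset.subset_union_right (s₁ := A))]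
        _ ≤ ∑' g, D * (G.realization.expect fun φ => w φ * historyLaw G η π φ t g) := by
            refine ENNReal.tsum_le_tsum fun g => ?_
            rw [PMF.expect_const_mul, mul_comm]
            refine mul_le_mul_left ?_ _
            rw [← PMF.expect_const (π g) D]
            refine PMF.expect_mono_support _ fun B hB => ?_
            exact (SocialNetwork.truncInfluence_deleteNodes_anti Finset.subset_union_left _ _).trans
              (hD g B hB)
        _ = D * G.realization.expect w := by
            rw [ENNReal.tsum_mul_left, ← PMF.expect_tsum]
            congr 2
            funext φ
            rw [ENNReal.tsum_mul_left, PMF.tsum_coe, mul_one]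
    calc _ ≤ G.realization.expect (fun φ => w φ * (historyLaw G η π φ t).expect fun g =>
          (((min (A ∪ activeOf g).card η : ℕ) : ℝ≥0∞) + (π g).expect fun B =>
            ((min ((G.deleteNodes (A ∪ activeOf g)).spread φ B) X : ℕ) : ℝ≥0∞))) := by
          refine PMF.expect_mono _ fun φ => ?_
          -- If the history has positive probability under `φ`, then `A` is closed under live edges;
          -- without this the gain of `π` beyond `A` could exceed its spread in the network without
          -- `A ∪ activeOf g`.
          by_cases hw0 : w φ = 0
          · rw [show historyLaw G η γ φ r h = 0 from hw0, hw0, zero_mul, zero_mul]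
          refine mul_le_mul_right ?_ _
          rw [expect_historyLaw_succ]
          refine PMF.expect_mono_support _ fun g hg => ?_
          rcases le_or_gt η (activeOf g).card with hd | hd
          · rw [expect_historyStep_of_done hd]
            exact le_self_add
          · rw [expect_historyStep_of_lt hd, ← PMF.expect_const (π g)
              ((min (A ∪ activeOf g).card η : ℕ) : ℝ≥0∞), ← PMF.expect_add]
            refine PMF.expect_mono _ fun B => ?_
            have hAc : G.Closed φ A := closed_activeOf ((PMF.mem_support_iff _ _).2 hw0)
            have h1 := SocialNetwork.card_union_union_influenced_le hAc (closed_activeOf hg) B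
            have h2 : A.card ≤ (A ∪ activeOf g).card := Finset.card_le_card Finset.subset_union_left
            have h3 := min_add_le_min_add (k := (G.deleteNodes (A ∪ activeOf g)).spread φ B)
              (η := η) h2
            rw [activeOf_observe]
            exact_mod_cast (min_le_min_right η h1).trans h3
      _ = (G.realization.expect fun φ => w φ *
            (historyLaw G η π φ t).expect fun g => ((min (A ∪ activeOf g).card η : ℕ) : ℝ≥0∞)) +
          (G.realization.expect fun φ => w φ * (historyLaw G η π φ t).expect fun g =>
            (π g).expect fun B =>
              ((min ((G.deleteNodes (A ∪ activeOf g)).spread φ B) X : ℕ) : ℝ≥0∞)) := by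
          rw [← PMF.expect_add]
          congr 1
          funext φ
          rw [PMF.expect_add, mul_add]
      _ ≤ (A.card + t * D) * G.realization.expect w + D * G.realization.expect w :=
          add_le_add ih hgain
      _ = _ := by push_cast; ring

/-- The probability that the target is reached within `t` rounds. -/
noncomputable def doneProb (G : SocialNetwork V) (η : ℕ) (π : Policy V) (t : ℕ)
    (φ : Finset (V × V)) : ℝ≥0∞ :=
  (historyLaw G η π φ t).prob fun g => η ≤ (activeOf g).card

/-- The shortfall that remains after a history bounds the gain that a policy needs. -/
theorem shortfall_mul_expect_doneProb_le {γ π : Policy V} {r : ℕ} {h : List (Observation V)}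
    (hlt : (activeOf h).card < η) {D : ℝ≥0∞} (hD : ∀ g, ∀ B ∈ (π g).support,
      truncInfluence (G.deleteNodes (activeOf h)) (η - (activeOf h).card) B ≤ D) (t : ℕ) :
    ((η - (activeOf h).card : ℕ) : ℝ≥0∞) *
      (G.realization.expect fun φ => historyLaw G η γ φ r h * doneProb G η π t φ) ≤
    t * D * G.realization.expect fun φ => historyLaw G η γ φ r h := by
  classical
  set A := activeOf h with hA
  have hmain := expect_mul_card_union_le (γ := γ) (r := r) hD t
  have hlow : (A.card : ℝ≥0∞) * (G.realization.expect fun φ => historyLaw G η γ φ r h) +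
      ((η - A.card : ℕ) : ℝ≥0∞) *
        (G.realization.expect fun φ => historyLaw G η γ φ r h * doneProb G η π t φ) ≤
      (G.realization.expect fun φ => historyLaw G η γ φ r h *
        (historyLaw G η π φ t).expect fun g =>
          ((min (A ∪ activeOf g).card η : ℕ) : ℝ≥0∞)) := by
    rw [← PMF.expect_const_mul, ← PMF.expect_const_mul, ← PMF.expect_add]
    refine PMF.expect_mono _ fun φ => ?_
    have : (A.card : ℝ≥0∞) + ((η - A.card : ℕ) : ℝ≥0∞) * doneProb G η π t φ ≤
        (historyLaw G η π φ t).expect fun g => ((min (A ∪ activeOf g).card η : ℕ) : ℝ≥0∞) := by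
      rw [doneProb, PMF.prob, ← PMF.expect_const_mul,
        ← PMF.expect_const (historyLaw G η π φ t) (A.card : ℝ≥0∞), ← PMF.expect_add]
      refine PMF.expect_mono _ fun g => ?_
      have h1 : A.card ≤ (A ∪ activeOf g).card := Finset.card_le_card Finset.subset_union_left
      have h2 : (activeOf g).card ≤ (A ∪ activeOf g).card :=
        Finset.card_le_card Finset.subset_union_right
      split_ifs with hd
      · rw [mul_one]
        have : A.card + (η - A.card) ≤ min (A ∪ activeOf g).card η := by omega
        exact_mod_cast this
      · rw [mul_zero, add_zero]
        have : A.card ≤ min (A ∪ activeOf g).card η := by omega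
        exact_mod_cast this
    calc _ = historyLaw G η γ φ r h *
          ((A.card : ℝ≥0∞) + ((η - A.card : ℕ) : ℝ≥0∞) * doneProb G η π t φ) := by ring
      _ ≤ _ := mul_le_mul_right this _
  have htop : (G.realization.expect fun φ => historyLaw G η γ φ r h) ≠ ∞ := by
    refine ne_top_of_le_ne_top ENNReal.one_ne_top ?_
    rw [← PMF.expect_const G.realization 1]
    exact PMF.expect_mono _ fun φ => PMF.coe_le_one _ _
  refine (ENNReal.add_le_add_iff_left (ENNReal.mul_ne_top (ENNReal.natCast_ne_top A.card) htop)).1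
    (hlow.trans (hmain.trans_eq ?_))
  ring

/-- The potential of a shortfall: `1 + ln x`, and `0` if there is none. -/
noncomputable def shortfallPotential (x : ℕ) : ℝ := if x = 0 then 0 else 1 + Real.log x

theorem shortfallPotential_nonneg (x : ℕ) : 0 ≤ shortfallPotential x := by
  unfold shortfallPotential
  split_ifs
  · exact le_rfl
  · have := Real.log_natCast_nonneg x
    linarith

/-- `ln (x/(x-k)) ≥ k/x` while a shortfall remains; the constant `1` in the potential pays for the
final drop to `0`. -/
theorem shortfallPotential_sub_add_le {x k : ℕ} (hx : 0 < x) :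
    shortfallPotential (x - k) + (min k x : ℕ) / x ≤ shortfallPotential x := by
  have hx' : (0 : ℝ) < x := by exact_mod_cast hx
  unfold shortfallPotential
  rw [if_neg hx.ne']
  split_ifs with h
  · have : min k x = x := by omega
    rw [this, div_self hx'.ne']
    have := Real.log_natCast_nonneg x
    linarith
  · have hk : min k x = k := by omega
    have hy : (0 : ℝ) < (x - k : ℕ) := by exact_mod_cast Nat.pos_of_ne_zero h
    have hcast : ((x - k : ℕ) : ℝ) = x - k := by rw [Nat.cast_sub (by omega)]
    rw [hk]
    have hlog := Real.one_sub_inv_le_log_of_pos (div_pos hx' hy)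
    rw [Real.log_div hx'.ne' hy.ne', inv_div, hcast] at hlog
    rw [hcast]
    have : 1 - ((x : ℝ) - k) / x = k / x := by field_simp; ring
    linarith

/-- The expected potential after `r` rounds. -/
noncomputable def expectedPotential (G : SocialNetwork V) (η : ℕ) (γ : Policy V) (r : ℕ) : ℝ≥0∞ :=
  G.realization.expect fun φ => (historyLaw G η γ φ r).expect fun h =>
    ENNReal.ofReal (shortfallPotential (η - (activeOf h).card))

/-- The probability that the target has not been reached after `r` rounds. -/
noncomputable def pendingProb (G : SocialNetwork V) (η : ℕ) (γ : Policy V) (r : ℕ) : ℝ≥0∞ :=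
  G.realization.expect fun φ => (historyLaw G η γ φ r).prob fun h => (activeOf h).card < η

/-- In every state the policy chooses batches whose expected truncated influence is at least `α`
times that of any set of at most `b` nodes. -/
def IsApproxGreedy (G : SocialNetwork V) (η b : ℕ) (α : ℝ≥0∞) (γ : Policy V) : Prop :=
  ∀ h : List (Observation V), activeOf h ⊆ G.nodes → (activeOf h).card < η → ∃ D : ℝ≥0∞,
    (∀ B : Finset V, B.card ≤ b →
      truncInfluence (G.deleteNodes (activeOf h)) (η - (activeOf h).card) B ≤ D) ∧
    α * D ≤ (γ h).expect
      (truncInfluence (G.deleteNodes (activeOf h)) (η - (activeOf h).card))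

/-- Per history: `X` times the drop is at least `α D P(h)`, and `t D P(h)` is at least `X P(h, π
done)`. Multiply by `t` and cancel `X`. -/
theorem expect_history_potential_drop {γ π : Policy V} {α : ℝ≥0∞}
    (hγ : IsApproxGreedy G η b α γ) (hπ : IsBatched G b π) (t r : ℕ) {h : List (Observation V)}
    (hlt : (activeOf h).card < η) :
    (t : ℝ≥0∞) * (G.realization.expect fun φ => historyLaw G η γ φ r h *
        (historyStep G η γ φ h).expect fun g =>
          ENNReal.ofReal (shortfallPotential (η - (activeOf g).card))) +
      α * (G.realization.expect fun φ => historyLaw G η γ φ r h * doneProb G η π t φ) ≤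
    t * (G.realization.expect fun φ => historyLaw G η γ φ r h *
      ENNReal.ofReal (shortfallPotential (η - (activeOf h).card))) := by
  by_cases hsub : activeOf h ⊆ G.nodes
  swap
  · have hz : ∀ φ, historyLaw G η γ φ r h = 0 := by
      intro φ
      by_contra hne
      exact hsub (activeOf_subset_nodes ((PMF.mem_support_iff _ _).2 hne))
    simp only [hz, zero_mul, PMF.expect_const, mul_zero, add_zero, le_refl]
  obtain ⟨D, hD, hDγ⟩ := hγ h hsub hlt
  set A := activeOf h with hA
  set X := η - A.card with hX
  set w : Finset (V × V) → ℝ≥0∞ := fun φ => historyLaw G η γ φ r h with hw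
  have hX0 : 0 < X := by omega
  have hX0' : (X : ℝ≥0∞) ≠ 0 := by exact_mod_cast hX0.ne'
  have hXt : (X : ℝ≥0∞) ≠ ∞ := ENNReal.natCast_ne_top X
  have hdone : (X : ℝ≥0∞) * (G.realization.expect fun φ => w φ * doneProb G η π t φ) ≤
      t * D * G.realization.expect w := by
    refine shortfall_mul_expect_doneProb_le hlt (fun g B hB => hD B ?_) t
    rw [(hπ g B hB).2]
    exact min_le_left _ _
  have hgain : (G.realization.expect fun φ => w φ * (γ h).expect fun B =>
      ((min ((G.deleteNodes A).spread φ B) X : ℕ) : ℝ≥0∞)) =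
      G.realization.expect w * (γ h).expect (truncInfluence (G.deleteNodes A) X) := by
    simp only [← PMF.expect_const_mul]
    rw [PMF.expect_comm]
    congr 1
    funext B
    refine SocialNetwork.expect_mul_spread_deleteNodes _ _ _ fun φ => ?_
    simp only [hw]
    exact historyLaw_filter r (Finset.Subset.refl _)
  have hdrop : (X : ℝ≥0∞) * (G.realization.expect fun φ => w φ *
        (historyStep G η γ φ h).expect fun g =>
          ENNReal.ofReal (shortfallPotential (η - (activeOf g).card))) +
      (G.realization.expect fun φ => w φ * (γ h).expect fun B =>
        ((min ((G.deleteNodes A).spread φ B) X : ℕ) : ℝ≥0∞)) ≤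
      X * (G.realization.expect fun φ => w φ * ENNReal.ofReal (shortfallPotential X)) := by
    rw [← PMF.expect_const_mul, ← PMF.expect_const_mul, ← PMF.expect_add]
    refine PMF.expect_mono _ fun φ => ?_
    rw [expect_historyStep_of_lt hlt]
    have : (X : ℝ≥0∞) * ((γ h).expect fun B => ENNReal.ofReal
        (shortfallPotential (η - (activeOf (observe G φ h B :: h)).card))) +
        ((γ h).expect fun B => ((min ((G.deleteNodes A).spread φ B) X : ℕ) : ℝ≥0∞)) ≤
        X * ENNReal.ofReal (shortfallPotential X) := by
      rw [← PMF.expect_const_mul, ← PMF.expect_add,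
        ← PMF.expect_const (γ h) ((X : ℝ≥0∞) * ENNReal.ofReal (shortfallPotential X))]
      refine PMF.expect_mono _ fun B => ?_
      rw [card_activeOf_observe, ← hA, ← Nat.sub_sub, ← hX, ← ENNReal.ofReal_natCast,
        ← ENNReal.ofReal_natCast, ← ENNReal.ofReal_mul (Nat.cast_nonneg _),
        ← ENNReal.ofReal_mul (Nat.cast_nonneg _),
        ← ENNReal.ofReal_add (mul_nonneg (Nat.cast_nonneg _) (shortfallPotential_nonneg _))
          (Nat.cast_nonneg _)]
      refine ENNReal.ofReal_le_ofReal ?_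
      have hXr : (0 : ℝ) < X := by exact_mod_cast hX0
      have h1 := mul_le_mul_of_nonneg_left
        (shortfallPotential_sub_add_le (k := (G.deleteNodes A).spread φ B) hX0) hXr.le
      rw [mul_add, mul_div_cancel₀ _ hXr.ne'] at h1
      exact h1
    calc _ = w φ * ((X : ℝ≥0∞) * ((γ h).expect fun B => ENNReal.ofReal
        (shortfallPotential (η - (activeOf (observe G φ h B :: h)).card))) +
        ((γ h).expect fun B => ((min ((G.deleteNodes A).spread φ B) X : ℕ) : ℝ≥0∞))) := by ring
      _ ≤ w φ * (X * ENNReal.ofReal (shortfallPotential X)) := mul_le_mul_right this _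
      _ = _ := by ring
  refine (ENNReal.mul_le_mul_iff_right hX0' hXt).1 ?_
  rw [hgain] at hdrop
  calc _ = t * ((X : ℝ≥0∞) * (G.realization.expect fun φ => w φ *
        (historyStep G η γ φ h).expect fun g =>
          ENNReal.ofReal (shortfallPotential (η - (activeOf g).card)))) +
        α * ((X : ℝ≥0∞) * (G.realization.expect fun φ => w φ * doneProb G η π t φ)) := by ring
    _ ≤ t * ((X : ℝ≥0∞) * (G.realization.expect fun φ => w φ *
        (historyStep G η γ φ h).expect fun g =>
          ENNReal.ofReal (shortfallPotential (η - (activeOf g).card)))) +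
        α * (t * D * G.realization.expect w) := add_le_add le_rfl (mul_le_mul_right hdone _)
    _ = t * ((X : ℝ≥0∞) * (G.realization.expect fun φ => w φ *
        (historyStep G η γ φ h).expect fun g =>
          ENNReal.ofReal (shortfallPotential (η - (activeOf g).card))) +
        G.realization.expect w * (α * D)) := by ring
    _ ≤ t * ((X : ℝ≥0∞) * (G.realization.expect fun φ => w φ *
        (historyStep G η γ φ h).expect fun g =>
          ENNReal.ofReal (shortfallPotential (η - (activeOf g).card))) +
        G.realization.expect w * (γ h).expect (truncInfluence (G.deleteNodes A) X)) :=
        mul_le_mul_right (add_le_add le_rfl (mul_le_mul_right hDγ _)) _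
    _ ≤ t * (X * (G.realization.expect fun φ => w φ * ENNReal.ofReal (shortfallPotential X))) :=
        mul_le_mul_right hdrop _
    _ = _ := by ring

/-- The potential of an approximately greedy policy drops, compared with the progress of any other
batched policy. -/
theorem mul_expectedPotential_succ_add_le {γ π : Policy V} {α : ℝ≥0∞}
    (hγ : IsApproxGreedy G η b α γ) (hπ : IsBatched G b π) (t r : ℕ) :
    (t : ℝ≥0∞) * expectedPotential G η γ (r + 1) + α * pendingProb G η γ r ≤
      t * expectedPotential G η γ r + α * pendingProb G η π t := by
  classical
  -- Either `π` is done after `t` rounds or it is pending. Given `φ` the coins of the two policies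
  -- are independent, hence the product.
  have hjoint : pendingProb G η γ r ≤ (G.realization.expect fun φ =>
      ((historyLaw G η γ φ r).prob fun h => (activeOf h).card < η) * doneProb G η π t φ) +
      pendingProb G η π t := by
    rw [pendingProb, pendingProb, ← PMF.expect_add]
    refine PMF.expect_mono _ fun φ => ?_
    have h1 : doneProb G η π t φ + ((historyLaw G η π φ t).prob fun h => (activeOf h).card < η) =
        1 := by
      have := (historyLaw G η π φ t).prob_add_prob_not fun g => η ≤ (activeOf g).card
      simp only [not_le] at this
      exact this
    calc _ = ((historyLaw G η γ φ r).prob fun h => (activeOf h).card < η) *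
          (doneProb G η π t φ + ((historyLaw G η π φ t).prob fun h => (activeOf h).card < η)) := by
          rw [h1, mul_one]
      _ ≤ _ := by
          rw [mul_add]
          refine add_le_add le_rfl ?_
          calc _ ≤ 1 * ((historyLaw G η π φ t).prob fun h => (activeOf h).card < η) :=
                mul_le_mul_left (PMF.prob_le_one _ _) _
            _ = _ := one_mul _
  have hdrop : (t : ℝ≥0∞) * expectedPotential G η γ (r + 1) + α * (G.realization.expect fun φ =>
      ((historyLaw G η γ φ r).prob fun h => (activeOf h).card < η) * doneProb G η π t φ) ≤
      t * expectedPotential G η γ r := by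
    have e1 : expectedPotential G η γ (r + 1) = ∑' h, G.realization.expect fun φ =>
        historyLaw G η γ φ r h * (historyStep G η γ φ h).expect fun g =>
          ENNReal.ofReal (shortfallPotential (η - (activeOf g).card)) := by
      rw [← PMF.expect_tsum, expectedPotential]
      simp only [expect_historyLaw_succ]
      rfl
    have e2 : (G.realization.expect fun φ =>
        ((historyLaw G η γ φ r).prob fun h => (activeOf h).card < η) * doneProb G η π t φ) =
        ∑' h, G.realization.expect fun φ => historyLaw G η γ φ r h *
          (if (activeOf h).card < η then 1 else 0) * doneProb G η π t φ := by
      rw [← PMF.expect_tsum]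
      simp only [ENNReal.tsum_mul_right]
      refine congrArg _ (funext fun φ => ?_)
      congr 1
      rw [PMF.prob, PMF.expect]
      refine tsum_congr fun h => ?_
      by_cases hc : (activeOf h).card < η <;> simp [hc]
    have e3 : expectedPotential G η γ r = ∑' h, G.realization.expect fun φ =>
        historyLaw G η γ φ r h *
          ENNReal.ofReal (shortfallPotential (η - (activeOf h).card)) := by
      rw [← PMF.expect_tsum, expectedPotential]
      rfl
    rw [e1, e2, e3, ← ENNReal.tsum_mul_left, ← ENNReal.tsum_mul_left, ← ENNReal.tsum_mul_left,
      ← ENNReal.tsum_add]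
    refine ENNReal.tsum_le_tsum fun h => ?_
    rcases lt_or_ge (activeOf h).card η with hlt | hge
    · simp only [if_pos hlt, mul_one]
      exact expect_history_potential_drop hγ hπ t r hlt
    · simp only [if_neg (not_lt.2 hge), mul_zero, zero_mul, PMF.expect_const, add_zero,
        expect_historyStep_of_done hge, le_refl]
  calc _ ≤ (t : ℝ≥0∞) * expectedPotential G η γ (r + 1) +
        α * ((G.realization.expect fun φ =>
          ((historyLaw G η γ φ r).prob fun h => (activeOf h).card < η) * doneProb G η π t φ) +
          pendingProb G η π t) := add_le_add le_rfl (mul_le_mul_right hjoint _)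
    _ = _ := by rw [mul_add, ← add_assoc]
    _ ≤ _ := add_le_add hdrop le_rfl

theorem expectedPotential_le (γ : Policy V) (r : ℕ) :
    expectedPotential G η γ r ≤ ENNReal.ofReal (Real.log η + 1) * pendingProb G η γ r := by
  classical
  rw [expectedPotential, pendingProb, ← PMF.expect_const_mul]
  refine PMF.expect_mono _ fun φ => ?_
  rw [PMF.prob, ← PMF.expect_const_mul]
  refine PMF.expect_mono _ fun h => ?_
  split_ifs with hlt
  · rw [mul_one]
    refine ENNReal.ofReal_le_ofReal ?_
    rw [shortfallPotential, if_neg (by omega)]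
    have h1 : (0 : ℝ) < (η - (activeOf h).card : ℕ) := by exact_mod_cast Nat.sub_pos_of_lt hlt
    have h2 : ((η - (activeOf h).card : ℕ) : ℝ) ≤ η := by exact_mod_cast Nat.sub_le _ _
    have := Real.log_le_log h1 h2
    linarith
  · rw [shortfallPotential, if_pos (by omega), ENNReal.ofReal_zero]
    exact zero_le

end Comparison

/-! ### Counting seeds through pending rounds. -/

section SeedCount

variable {V : Type*} [DecidableEq V] {G : SocialNetwork V} {η b : ℕ}

/-- The expected number of seeds selected in the first `k` rounds. -/
noncomputable def seedCount (G : SocialNetwork V) (η : ℕ) (π : Policy V) (k : ℕ) : ℝ≥0∞ :=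
  G.realization.expect fun φ => (historyLaw G η π φ k).expect fun h => ((seedsOf h).card : ℝ≥0∞)

theorem expectedSeeds_eq [Fintype V] (G : SocialNetwork V) (η : ℕ) (π : Policy V) :
    expectedSeeds G η π = (seedCount G η π G.nodes.card).toReal := by
  have hS : ∀ φ, ((historyLaw G η π φ G.nodes.card).expect fun h => ((seedsOf h).card : ℝ≥0∞)) =
      ∑ S : Finset V, seedSet G η π φ S * (S.card : ℝ≥0∞) := by
    intro φ
    rw [← tsum_fintype (L := .unconditional _), seedSet_eq_map_historyLaw]
    exact (PMF.expect_map _ seedsOf fun S => (S.card : ℝ≥0∞)).symm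
  have hfin : ∀ φ, ∀ S : Finset V, seedSet G η π φ S * (S.card : ℝ≥0∞) ≠ ∞ := fun φ S =>
    ENNReal.mul_ne_top (PMF.apply_ne_top _ _) (ENNReal.natCast_ne_top _)
  rw [seedCount, G.expect_realization, ENNReal.toReal_sum, expectedSeeds]
  · refine Finset.sum_congr rfl fun φ hφ => ?_
    rw [ENNReal.toReal_mul, ENNReal.toReal_ofReal (G.weight_nonneg (Finset.mem_powerset.1 hφ)), hS,
      ENNReal.toReal_sum fun S _ => hfin φ S]
    simp only [ENNReal.toReal_mul, ENNReal.toReal_natCast]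
  · intro φ _
    rw [hS]
    exact ENNReal.mul_ne_top ENNReal.ofReal_ne_top
      (ENNReal.sum_ne_top.2 fun S _ => hfin φ S)

variable {π : Policy V}

theorem seedCount_zero : seedCount G η π 0 = 0 := by
  simp [seedCount, historyLaw, PMF.expect_pure, seedsOf, PMF.expect_const]

theorem seedCount_le_card (hπ : IsBatched G b π) (k : ℕ) :
    seedCount G η π k ≤ G.nodes.card := by
  rw [seedCount, ← PMF.expect_const G.realization (G.nodes.card : ℝ≥0∞)]
  refine PMF.expect_mono _ fun φ => ?_
  rw [← PMF.expect_const (historyLaw G η π φ k) (G.nodes.card : ℝ≥0∞)]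
  refine PMF.expect_mono_support _ fun h hh => ?_
  exact_mod_cast Finset.card_le_card (seedsOf_subset_nodes hπ hh)

theorem seedCount_succ_le (hπ : IsBatched G b π) (k : ℕ) :
    seedCount G η π (k + 1) ≤ seedCount G η π k + b * pendingProb G η π k := by
  classical
  rw [seedCount, seedCount, pendingProb, ← PMF.expect_const_mul, ← PMF.expect_add]
  refine PMF.expect_mono _ fun φ => ?_
  rw [expect_historyLaw_succ, PMF.prob, ← PMF.expect_const_mul, ← PMF.expect_add]
  refine PMF.expect_mono _ fun h => ?_
  rcases le_or_gt η (activeOf h).card with hd | hd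
  · rw [expect_historyStep_of_done hd]
    exact le_self_add
  · rw [expect_historyStep_of_lt hd, if_pos hd, mul_one,
      ← PMF.expect_const (π h) (((seedsOf h).card : ℝ≥0∞) + b)]
    refine PMF.expect_mono_support _ fun B hB => ?_
    have h1 : (seedsOf (observe G φ h B :: h)).card ≤ B.card + (seedsOf h).card :=
      Finset.card_union_le _ _
    have h2 : B.card ≤ b := (hπ h B hB).2.trans_le (min_le_left _ _)
    have : (seedsOf (observe G φ h B :: h)).card ≤ (seedsOf h).card + b := by omega
    exact_mod_cast this

theorem seedCount_le (hπ : IsBatched G b π) (k : ℕ) :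
    seedCount G η π k ≤ b * ∑ r ∈ Finset.range k, pendingProb G η π r := by
  induction k with
  | zero => rw [seedCount_zero]; exact zero_le
  | succ k ih =>
    rw [Finset.sum_range_succ, mul_add]
    exact (seedCount_succ_le hπ k).trans (add_le_add ih le_rfl)

theorem card_seedsOf_observe (hπ : IsBatched G b π) {φ : Finset (V × V)} {k : ℕ}
    {h : List (Observation V)} (hh : h ∈ (historyLaw G η π φ k).support) {B : Finset V}
    (hB : B ∈ (π h).support) :
    (seedsOf (observe G φ h B :: h)).card = B.card + (seedsOf h).card := by
  refine Finset.card_union_of_disjoint (Finset.disjoint_left.2 fun v hv hvs => ?_)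
  have h1 := (hπ h B hB).1 hv
  rw [residualGraph_eq, SocialNetwork.mem_nodes_deleteNodes] at h1
  refine h1.2 ?_
  rw [activeOf_eq_influenced hh]
  exact subset_influenced _ _ (seedsOf_subset_nodes hπ hh) hvs

/-- While the target is missed some node is inactive, so every such round adds at least one new
seed. -/
theorem seedCount_add_pendingProb_le (hb : 1 ≤ b) (hηn : η ≤ G.nodes.card)
    (hπ : IsBatched G b π) (k : ℕ) :
    seedCount G η π k + pendingProb G η π k ≤ seedCount G η π (k + 1) := by
  classical
  rw [seedCount, seedCount, pendingProb, ← PMF.expect_add]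
  refine PMF.expect_mono _ fun φ => ?_
  rw [expect_historyLaw_succ, PMF.prob, ← PMF.expect_add]
  refine PMF.expect_mono_support _ fun h hh => ?_
  rcases le_or_gt η (activeOf h).card with hd | hd
  · rw [expect_historyStep_of_done hd, if_neg (not_lt.2 hd), add_zero]
  · rw [expect_historyStep_of_lt hd, if_pos hd,
      ← PMF.expect_const (π h) (((seedsOf h).card : ℝ≥0∞) + 1)]
    refine PMF.expect_mono_support _ fun B hB => ?_
    have h1 := card_seedsOf_observe hπ hh hB
    have h2 := (hπ h B hB).2
    rw [card_nodes_residualGraph (activeOf_subset_nodes hh)] at h2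
    have : (seedsOf h).card + 1 ≤ (seedsOf (observe G φ h B :: h)).card := by omega
    exact_mod_cast this

/-- A batch that does not finish the process has full size. -/
theorem seedCount_add_mul_pendingProb_succ_le (hηn : η ≤ G.nodes.card)
    (hπ : IsBatched G b π) (k : ℕ) :
    seedCount G η π k + b * pendingProb G η π (k + 1) ≤ seedCount G η π (k + 1) := by
  classical
  rw [seedCount, seedCount, pendingProb, ← PMF.expect_const_mul, ← PMF.expect_add]
  refine PMF.expect_mono _ fun φ => ?_
  rw [expect_historyLaw_succ, PMF.prob, expect_historyLaw_succ, ← PMF.expect_const_mul,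
    ← PMF.expect_add]
  refine PMF.expect_mono_support _ fun h hh => ?_
  rcases le_or_gt η (activeOf h).card with hd | hd
  · rw [expect_historyStep_of_done hd, expect_historyStep_of_done hd, if_neg (not_lt.2 hd),
      mul_zero, add_zero]
  · rw [expect_historyStep_of_lt hd, expect_historyStep_of_lt hd, ← PMF.expect_const_mul,
      ← PMF.expect_const (π h) ((seedsOf h).card : ℝ≥0∞), ← PMF.expect_add]
    refine PMF.expect_mono_support _ fun B hB => ?_
    have h1 := card_seedsOf_observe hπ hh hB
    have h2 := (hπ h B hB).2
    have h3 := card_batch_le_spread (φ := φ) hπ hB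
    have h4 := card_activeOf_observe (G := G) (φ := φ) h B
    rw [card_nodes_residualGraph (activeOf_subset_nodes hh)] at h2
    -- A batch smaller than `b` would activate all remaining nodes and end the process.
    split_ifs with hlt
    · have : (seedsOf h).card + b * 1 ≤ (seedsOf (observe G φ h B :: h)).card := by omega
      exact_mod_cast this
    · have : (seedsOf h).card + b * 0 ≤ (seedsOf (observe G φ h B :: h)).card := by omega
      exact_mod_cast this

theorem min_le_seedCount_one (hη : 1 ≤ η) (hπ : IsBatched G b π) :
    ((min b G.nodes.card : ℕ) : ℝ≥0∞) ≤ seedCount G η π 1 := by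
  rw [seedCount, ← PMF.expect_const G.realization ((min b G.nodes.card : ℕ) : ℝ≥0∞)]
  refine PMF.expect_mono _ fun φ => ?_
  have h0 : (activeOf ([] : List (Observation V))).card < η := by
    simp only [activeOf, Finset.card_empty]
    omega
  have hh : [] ∈ (historyLaw G η π φ 0).support := by simp [historyLaw]
  rw [expect_historyLaw_succ, historyLaw, PMF.expect_pure, expect_historyStep_of_lt h0,
    ← PMF.expect_const (π []) ((min b G.nodes.card : ℕ) : ℝ≥0∞)]
  refine PMF.expect_mono_support _ fun B hB => ?_
  have h1 := card_seedsOf_observe hπ hh hB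
  have h2 := (hπ [] B hB).2
  rw [card_nodes_residualGraph (activeOf_subset_nodes hh)] at h2
  have : min b G.nodes.card ≤ (seedsOf (observe G φ [] B :: [])).card := by
    simp only [activeOf, Finset.card_empty, Nat.sub_zero] at h2
    omega
  exact_mod_cast this

theorem seedCount_mono (hηn : η ≤ G.nodes.card) (hπ : IsBatched G b π) :
    Monotone (seedCount G η π) :=
  monotone_nat_of_le_succ fun k =>
    le_self_add.trans (seedCount_add_mul_pendingProb_succ_le hηn hπ k)

theorem pendingProb_antitone : Antitone (pendingProb G η π) := by
  classical
  refine antitone_nat_of_succ_le fun k => ?_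
  refine PMF.expect_mono _ fun φ => ?_
  rw [PMF.prob, expect_historyLaw_succ, PMF.prob]
  refine PMF.expect_mono _ fun h => ?_
  split_ifs with hd
  · refine (PMF.expect_mono _ (g := fun _ => 1) fun g => ?_).trans_eq (PMF.expect_const _ _)
    split_ifs <;> simp
  · rw [expect_historyStep_of_done (not_lt.1 hd), if_neg hd]

theorem pendingProb_le_one (k : ℕ) : pendingProb G η π k ≤ 1 := by
  rw [pendingProb, ← PMF.expect_const G.realization 1]
  exact PMF.expect_mono _ fun φ => PMF.prob_le_one _ _

theorem pendingProb_eq_zero (hπ : IsBatched G b π) (hηn : η ≤ G.nodes.card) {k : ℕ}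
    (hk : η ≤ k * b) : pendingProb G η π k = 0 := by
  classical
  rw [pendingProb, ← PMF.expect_const G.realization 0]
  congr 1
  funext φ
  refine (PMF.expect_congr_support _ (g := fun _ => 0) fun h hh => ?_).trans (PMF.expect_const _ _)
  have := min_le_card_activeOf hπ hηn hh
  rw [min_eq_left hk] at this
  rw [if_neg (not_lt.2 this)]

end SeedCount

/-! ### ASTI with TRIM-B is approximately greedy. -/

section Asti

variable {V : Type*} [DecidableEq V] {G : SocialNetwork V} {η b : ℕ} {ε : ℝ}
  {pick : List (Finset V) → Finset V → Finset V → V}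

theorem isBatched_astiTrimB (hpick : IsTieBreak pick) (η b : ℕ) (ε : ℝ) :
    IsBatched G b (astiTrimB pick G η ε b) := fun _ _ hB =>
  mem_support_trimB hpick _ _ ε (min_le_right _ _) hB

/-- The guarantee of TRIM-B holds against batches of exactly `b' = min b |H|` inactive nodes. A
competing set may contain active nodes, which have no effect in `H`; its inactive part extends to
such a batch. Finally `ρ_b ≤ ρ_b'`. -/
theorem isApproxGreedy_astiTrimB (hpick : IsTieBreak pick) (hηn : η ≤ G.nodes.card) (hb : 1 ≤ b)
    (h0 : 0 < ε) (h1 : ε < 1) :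
    IsApproxGreedy G η b (ENNReal.ofReal (rho b * (1 - 1 / Real.exp 1) * (1 - ε)))
      (astiTrimB pick G η ε b) := by
  intro h hsub hlt
  set H := G.deleteNodes (activeOf h) with hH
  set X := η - (activeOf h).card with hX
  set b' := min b H.nodes.card with hb'
  have hcard : H.nodes.card = G.nodes.card - (activeOf h).card := card_nodes_residualGraph hsub
  have hb1 : 1 ≤ b' := by omega
  obtain ⟨B, hB, hmax⟩ := Finset.exists_max_image (H.nodes.powersetCard b')
    (truncInfluence H X) (Finset.powersetCard_nonempty.2 (min_le_right _ _))
  obtain ⟨hB1, hB2⟩ := Finset.mem_powersetCard.1 hB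
  refine ⟨truncInfluence H X B, fun C hC => ?_, ?_⟩
  · have hc : (C ∩ H.nodes).card ≤ b' :=
      le_min ((Finset.card_le_card Finset.inter_subset_left).trans hC)
        (Finset.card_le_card Finset.inter_subset_right)
    obtain ⟨C', h2, h3, h4⟩ := Finset.exists_subsuperset_card_eq
      (Finset.inter_subset_right (s₁ := C) (s₂ := H.nodes)) hc (min_le_right _ _)
    exact (SocialNetwork.truncInfluence_mono h2 X).trans
      (hmax C' (Finset.mem_powersetCard.2 ⟨h3, h4⟩))
  · refine le_trans (mul_le_mul_left (ENNReal.ofReal_le_ofReal ?_) _)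
      (mul_truncInfluence_le_expect_trimB hpick h0 h1 (by omega : 1 ≤ X) (by omega) hb1 hB1 hB2)
    have h2 := rho_antitone hb1 (min_le_left b H.nodes.card)
    have h3 := one_sub_inv_exp_pos
    have h4 : 0 < 1 - ε := by linarith
    gcongr

end Asti

/-! ### Summation by parts over blocks of rounds. -/

section Sequences

/-- Summation of the potential drops with weights that grow every `c` rounds. -/
theorem mul_sum_sub_le_of_drop {a o p : ℕ → ℝ} {κ α L : ℝ} {c : ℕ} (hc : 1 ≤ c)
    (ha : Antitone a) (ha1 : a 0 ≤ 1) (hp0 : ∀ r, 0 ≤ p r) (hL : 0 ≤ L)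
    (hpL : ∀ r, p r ≤ L * a r) (hκ : 0 ≤ κ)
    (hdrop : ∀ t r, α * a r ≤ (t + κ) * (p r - p (r + 1)) + α * o t) (N : ℕ) :
    α * ∑ r ∈ Finset.range (c * N), a r ≤ α * (c * ∑ t ∈ Finset.range N, o t) +
      L * κ + L / c * ∑ r ∈ Finset.range (c * N), a r := by
  have hc0 : (0 : ℝ) < c := by exact_mod_cast hc
  -- The rounds `c t, …, c t + c - 1` of one policy are compared with `t` rounds of the other, so
  -- the potential drops telescope within a block.
  have hblock : ∀ t d : ℕ, α * ∑ i ∈ Finset.range d, a (c * t + i) ≤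
      (t + κ) * (p (c * t) - p (c * t + d)) + d * (α * o t) := by
    intro t d
    induction d with
    | zero => simp
    | succ d ih =>
      rw [Finset.sum_range_succ, mul_add]
      have := hdrop t (c * t + d)
      push_cast
      rw [← add_assoc]
      linarith
  -- As `a` decreases, its value at the end of a block is at most its mean over the block.
  have hpot : ∀ t : ℕ, p (c * t + c) ≤ L / c * ∑ i ∈ Finset.range c, a (c * t + i) := by
    intro t
    have h1 : (c : ℝ) * a (c * t + c) ≤ ∑ i ∈ Finset.range c, a (c * t + i) := by
      calc (c : ℝ) * a (c * t + c) = ∑ i ∈ Finset.range c, a (c * t + c) := by simp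
        _ ≤ _ := Finset.sum_le_sum fun i hi => ha (by
          have := Finset.mem_range.1 hi
          omega)
    calc p (c * t + c) ≤ L * a (c * t + c) := hpL _
      _ = L / c * (c * a (c * t + c)) := by field_simp
      _ ≤ _ := mul_le_mul_of_nonneg_left h1 (by positivity)
  -- The boundary term `(N + κ) p (c N)` of the summation by parts is kept for the induction and
  -- dropped afterwards.
  have key : ∀ N : ℕ, α * ∑ r ∈ Finset.range (c * N), a r + (N + κ) * p (c * N) ≤
      α * (c * ∑ t ∈ Finset.range N, o t) + κ * p 0 +
        L / c * ∑ r ∈ Finset.range (c * N), a r := by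
    intro N
    induction N with
    | zero => simp
    | succ N ih =>
      rw [Nat.mul_succ, Finset.sum_range_add, Finset.sum_range_succ]
      have h1 := hblock N c
      have h2 := hpot N
      push_cast
      linarith
  have hN := key N
  have h3 : 0 ≤ ((N : ℝ) + κ) * p (c * N) := mul_nonneg (by positivity) (hp0 _)
  have h4 : κ * p 0 ≤ L * κ := by
    have h5 : L * a 0 ≤ L * 1 := mul_le_mul_of_nonneg_left ha1 hL
    have h6 := mul_le_mul_of_nonneg_left ((hpL 0).trans h5) hκ
    linarith
  linarith

theorem sum_range_le_of_eventually_zero {a : ℕ → ℝ} (ha1 : ∀ r, a r ≤ 1)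
    {M : ℕ} (hM : ∀ r, M ≤ r → a r = 0) (n : ℕ) : ∑ r ∈ Finset.range n, a r ≤ M := by
  calc ∑ r ∈ Finset.range n, a r ≤ ∑ r ∈ Finset.range n, if r < M then (1 : ℝ) else 0 :=
        Finset.sum_le_sum fun r _ => by
          split_ifs with h
          · exact ha1 r
          · exact (hM r (not_lt.1 h)).le
    _ = (((Finset.range n).filter (· < M)).card : ℝ) := by rw [Finset.sum_boole]
    _ ≤ ((Finset.range M).card : ℝ) := by
        refine Nat.cast_le.2 (Finset.card_le_card fun r hr => ?_)
        exact Finset.mem_range.2 (Finset.mem_filter.1 hr).2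
    _ = M := by rw [Finset.card_range]

end Sequences

/-! ### Numerical estimates for small `η`. -/

section Numerics

/-- From `2 ^ 19 < 3 ^ 12`. -/
theorem log_three_ge : 1.0974 ≤ Real.log 3 := by
  have h : Real.log ((2 : ℝ) ^ 19) ≤ Real.log ((3 : ℝ) ^ 12) :=
    Real.log_le_log (by norm_num) (by norm_num)
  rw [Real.log_pow, Real.log_pow] at h
  push_cast at h
  linarith [Real.log_two_gt_d9]

theorem log_two_pow_mul_three_pow (i j : ℕ) :
    i * 0.69314 + j * 1.0974 ≤ Real.log ((2 : ℝ) ^ i * 3 ^ j) := by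
  rw [Real.log_mul (by positivity) (by positivity), Real.log_pow, Real.log_pow]
  have h1 : (i : ℝ) * 0.69314 ≤ i * Real.log 2 :=
    mul_le_mul_of_nonneg_left (by linarith [Real.log_two_gt_d9]) (Nat.cast_nonneg i)
  have h2 := mul_le_mul_of_nonneg_left log_three_ge (Nat.cast_nonneg j : (0 : ℝ) ≤ j)
  linarith

/-- Serves to cover a range of `η` by intervals: the logarithm is bounded at a left endpoint `2 ^ i
* 3 ^ j`, the linear side at the right endpoint. -/
theorem le_log_add_one_sq {η : ℕ} {x : ℝ} (i j : ℕ) (hk : 2 ^ i * 3 ^ j ≤ η)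
    (hx : x ≤ (i * 0.69314 + j * 1.0974 + 1) ^ 2) : x ≤ (Real.log η + 1) ^ 2 := by
  refine hx.trans (pow_le_pow_left₀ (by positivity) ?_ 2)
  have h1 := log_two_pow_mul_three_pow i j
  have h2 : Real.log ((2 : ℝ) ^ i * 3 ^ j) ≤ Real.log η :=
    Real.log_le_log (by positivity) (by exact_mod_cast hk)
  linarith

/-- The trivial range for `b = 1`: at most `η` rounds, and `α ≤ 0.6322`. -/
theorem mul_le_log_add_one_sq {η : ℕ} (hη : 1 ≤ η) (hη2 : η ≤ 23) :
    0.6322 * (η : ℝ) ≤ (Real.log η + 1) ^ 2 := by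
  have hle : ∀ m : ℕ, η ≤ m → 0.6322 * (η : ℝ) ≤ 0.6322 * m := fun m hm => by
    have : (η : ℝ) ≤ m := by exact_mod_cast hm
    linarith
  rcases le_or_gt η 1 with h | h
  · exact le_log_add_one_sq 0 0 (by omega) ((hle 1 h).trans (by norm_num))
  rcases le_or_gt η 3 with h' | h'
  · exact le_log_add_one_sq 1 0 (by omega) ((hle 3 h').trans (by norm_num))
  rcases le_or_gt η 7 with h' | h'
  · exact le_log_add_one_sq 2 0 (by omega) ((hle 7 h').trans (by norm_num))
  rcases le_or_gt η 12 with h' | h'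
  · exact le_log_add_one_sq 3 0 (by omega) ((hle 12 h').trans (by norm_num))
  rcases le_or_gt η 17 with h' | h'
  · exact le_log_add_one_sq 2 1 (by omega) ((hle 17 h').trans (by norm_num))
  · exact le_log_add_one_sq 1 2 (by omega) ((hle 23 hη2).trans (by norm_num))

/-- The trivial range for `b ≥ 2`: at most `(η + 1)/2` rounds, and `α ≤ 0.4742`, whose half is
`0.2371`. -/
theorem mul_add_one_le_log_add_one_sq {η : ℕ} (hη : 1 ≤ η) (hη2 : η ≤ 143) :
    0.2371 * ((η : ℝ) + 1) ≤ (Real.log η + 1) ^ 2 := by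
  have hle : ∀ m : ℕ, η ≤ m → 0.2371 * ((η : ℝ) + 1) ≤ 0.2371 * ((m : ℝ) + 1) := fun m hm => by
    have : (η : ℝ) ≤ m := by exact_mod_cast hm
    linarith
  rcases le_or_gt η 3 with h | h
  · exact le_log_add_one_sq 0 0 (by omega) ((hle 3 h).trans (by norm_num))
  rcases le_or_gt η 15 with h' | h'
  · exact le_log_add_one_sq 2 0 (by omega) ((hle 15 h').trans (by norm_num))
  rcases le_or_gt η 55 with h' | h'
  · exact le_log_add_one_sq 4 0 (by omega) ((hle 55 h').trans (by norm_num))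
  rcases le_or_gt η 80 with h' | h'
  · exact le_log_add_one_sq 5 0 (by omega) ((hle 80 h').trans (by norm_num))
  rcases le_or_gt η 110 with h' | h'
  · exact le_log_add_one_sq 6 0 (by omega) ((hle 110 h').trans (by norm_num))
  rcases le_or_gt η 127 with h' | h'
  · exact le_log_add_one_sq 5 1 (by omega) ((hle 127 h').trans (by norm_num))
  · exact le_log_add_one_sq 7 0 (by omega) ((hle 143 hη2).trans (by norm_num))

theorem one_sub_inv_exp_le : 1 - 1 / Real.exp 1 ≤ 0.63213 := by
  have h : 0.36787 ≤ 1 / Real.exp 1 := by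
    rw [le_div_iff₀ (Real.exp_pos 1)]
    linarith [Real.exp_one_lt_d9]
  linarith

theorem rho_two : rho 2 = 3 / 4 := by
  norm_num [rho]

end Numerics

/-! ### From rounds to seeds, and the final comparison. -/

section Rounds

variable {V : Type*} [DecidableEq V] {G : SocialNetwork V} {η b : ℕ}

theorem expectedPotential_ne_top (γ : Policy V) (r : ℕ) : expectedPotential G η γ r ≠ ∞ :=
  ne_top_of_le_ne_top (ENNReal.mul_ne_top ENNReal.ofReal_ne_top
    (ne_top_of_le_ne_top ENNReal.one_ne_top (pendingProb_le_one r))) (expectedPotential_le γ r)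

theorem pendingProb_ne_top (π : Policy V) (r : ℕ) : pendingProb G η π r ≠ ∞ :=
  ne_top_of_le_ne_top ENNReal.one_ne_top (pendingProb_le_one r)

theorem pendingProb_toReal_le_one (π : Policy V) (r : ℕ) : (pendingProb G η π r).toReal ≤ 1 := by
  rw [← ENNReal.toReal_one]
  exact ENNReal.toReal_mono ENNReal.one_ne_top (pendingProb_le_one r)

theorem mul_pendingProb_toReal_le {γ π : Policy V} {α : ℝ} (hα : 0 ≤ α)
    (hγ : IsApproxGreedy G η b (ENNReal.ofReal α) γ) (hπ : IsBatched G b π) (t r : ℕ) :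
    α * (pendingProb G η γ r).toReal ≤
      t * ((expectedPotential G η γ r).toReal - (expectedPotential G η γ (r + 1)).toReal) +
        α * (pendingProb G η π t).toReal := by
  have hfin : ∀ (π' : Policy V) (s : ℕ),
      ENNReal.ofReal α * pendingProb G η π' s ≠ ∞ := fun π' s =>
    ENNReal.mul_ne_top ENNReal.ofReal_ne_top (pendingProb_ne_top π' s)
  have hfin2 : ∀ s : ℕ, (t : ℝ≥0∞) * expectedPotential G η γ s ≠ ∞ := fun s =>
    ENNReal.mul_ne_top (ENNReal.natCast_ne_top t) (expectedPotential_ne_top γ s)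
  have h := ENNReal.toReal_mono (ENNReal.add_ne_top.2 ⟨hfin2 r, hfin π t⟩)
    (mul_expectedPotential_succ_add_le hγ hπ t r)
  rw [ENNReal.toReal_add (hfin2 _) (hfin _ _), ENNReal.toReal_add (hfin2 _) (hfin _ _)] at h
  simp only [ENNReal.toReal_mul, ENNReal.toReal_natCast, ENNReal.toReal_ofReal hα] at h
  linarith

theorem expectedPotential_toReal_le (γ : Policy V) (r : ℕ) :
    (expectedPotential G η γ r).toReal ≤ (Real.log η + 1) * (pendingProb G η γ r).toReal := by
  have h := ENNReal.toReal_mono (ENNReal.mul_ne_top ENNReal.ofReal_ne_top (pendingProb_ne_top γ r))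
    (expectedPotential_le (G := G) (η := η) γ r)
  rw [ENNReal.toReal_mul, ENNReal.toReal_ofReal] at h
  · exact h
  · have := Real.log_natCast_nonneg η
    linarith

theorem pendingProb_toReal_antitone (π : Policy V) :
    Antitone fun r => (pendingProb G η π r).toReal := fun r _ hrs =>
  ENNReal.toReal_mono (pendingProb_ne_top π r) (pendingProb_antitone hrs)

theorem seedCount_ne_top {π : Policy V} (hπ : IsBatched G b π) (k : ℕ) :
    seedCount G η π k ≠ ∞ :=
  ne_top_of_le_ne_top (ENNReal.natCast_ne_top _) (seedCount_le_card hπ k)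

theorem seedCount_toReal_le {π : Policy V} (hπ : IsBatched G b π) (k : ℕ) :
    (seedCount G η π k).toReal ≤ b * ∑ r ∈ Finset.range k, (pendingProb G η π r).toReal := by
  have h := ENNReal.toReal_mono (ENNReal.mul_ne_top (ENNReal.natCast_ne_top b)
    (ENNReal.sum_ne_top.2 fun r _ => pendingProb_ne_top π r)) (seedCount_le (η := η) hπ k)
  rwa [ENNReal.toReal_mul, ENNReal.toReal_natCast,
    ENNReal.toReal_sum fun r _ => pendingProb_ne_top π r] at h

theorem sum_pendingProb_le_seedCount {π : Policy V} (hb : 1 ≤ b) (hηn : η ≤ G.nodes.card)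
    (hπ : IsBatched G b π) (k : ℕ) :
    ∑ t ∈ Finset.range k, (pendingProb G η π t).toReal ≤ (seedCount G η π k).toReal := by
  induction k with
  | zero => simp
  | succ k ih =>
    rw [Finset.sum_range_succ]
    have h := ENNReal.toReal_mono (seedCount_ne_top hπ (k + 1))
      (seedCount_add_pendingProb_le hb hηn hπ k)
    rw [ENNReal.toReal_add (seedCount_ne_top hπ k) (pendingProb_ne_top π k)] at h
    linarith

/-- The probability that more than `t` full batches are needed (and at least one batch is). -/
noncomputable def fullBatchProb (G : SocialNetwork V) (η : ℕ) (π : Policy V) (t : ℕ) : ℝ :=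
  if t = 0 then 1 else (pendingProb G η π (t + 1)).toReal

theorem mul_sum_fullBatchProb_le_seedCount {π : Policy V} (hη : 1 ≤ η) (hηn : η ≤ G.nodes.card)
    (hbn : b ≤ G.nodes.card) (hπ : IsBatched G b π) (k : ℕ) :
    b * ∑ t ∈ Finset.range (k + 1), fullBatchProb G η π t ≤
      (seedCount G η π (k + 1)).toReal := by
  induction k with
  | zero =>
    have h := ENNReal.toReal_mono (seedCount_ne_top hπ 1) (min_le_seedCount_one hη hπ)
    rw [min_eq_left hbn, ENNReal.toReal_natCast] at h
    simpa [fullBatchProb] using h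
  | succ k ih =>
    rw [Finset.sum_range_succ, fullBatchProb, if_neg (Nat.succ_ne_zero k)]
    have h := ENNReal.toReal_mono (seedCount_ne_top hπ (k + 2))
      (seedCount_add_mul_pendingProb_succ_le hηn hπ (k + 1))
    rw [ENNReal.toReal_add (seedCount_ne_top hπ _)
      (ENNReal.mul_ne_top (ENNReal.natCast_ne_top b) (pendingProb_ne_top π _)),
      ENNReal.toReal_mul, ENNReal.toReal_natCast] at h
    linarith

theorem le_seedCount_toReal {π : Policy V} (hη : 1 ≤ η) (hηn : η ≤ G.nodes.card)
    (hπ : IsBatched G b π) :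
    ((min b G.nodes.card : ℕ) : ℝ) ≤ (seedCount G η π G.nodes.card).toReal := by
  rw [← ENNReal.toReal_natCast]
  exact ENNReal.toReal_mono (seedCount_ne_top hπ _)
    ((min_le_seedCount_one hη hπ).trans (seedCount_mono hηn hπ (hη.trans hηn)))

variable {γ π : Policy V} {α : ℝ}

/-- Comparison of the expected numbers of rounds when every batch is a single node. -/
theorem mul_sum_pendingProb_le_of_large (hα : 0 < α) (hα1 : α ≤ 0.6322) (hη : 24 ≤ η)
    (hγ : IsApproxGreedy G η b (ENNReal.ofReal α) γ) (hπ : IsBatched G b π) (n : ℕ) :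
    α * ∑ r ∈ Finset.range n, (pendingProb G η γ r).toReal ≤
      (Real.log η + 1) ^ 2 * ∑ t ∈ Finset.range n, (pendingProb G η π t).toReal := by
  set L := Real.log η + 1 with hLdef
  have hL : 4.1 ≤ L := by
    have h1 := log_two_pow_mul_three_pow 3 1
    have h2 : Real.log ((2 : ℝ) ^ 3 * 3 ^ 1) ≤ Real.log η :=
      Real.log_le_log (by positivity) (by norm_num; exact_mod_cast hη)
    norm_num at h1 h2
    linarith
  set u := L / α with hu
  have hLu : L = α * u := by rw [hu]; field_simp
  have hu1 : 6.4 ≤ u := by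
    rw [hu, le_div_iff₀ hα]
    linarith
  -- `c = 2u` minimizes `c²/(c - u)`, with value `4u`; `L ≥ 4.1` leaves room for rounding up.
  set c := ⌈2 * u⌉₊ with hc
  have hc1 : 2 * u ≤ c := Nat.le_ceil _
  have hc2 : (c : ℝ) < 2 * u + 1 := Nat.ceil_lt_add_one (by linarith)
  have hc3 : 1 ≤ c := by
    have : (0 : ℝ) < c := by linarith
    exact_mod_cast this
  have hc0 : (0 : ℝ) < c := by linarith
  have hsum := mul_sum_sub_le_of_drop (κ := 0) (L := L) hc3
    (pendingProb_toReal_antitone (G := G) (η := η) γ) (pendingProb_toReal_le_one γ 0)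
    (fun r => ENNReal.toReal_nonneg (a := expectedPotential G η γ r)) (by linarith)
    (fun r => expectedPotential_toReal_le γ r) le_rfl
    (fun t r => by
      rw [add_zero]
      exact mul_pendingProb_toReal_le hα.le hγ hπ t r) n
  set A := ∑ r ∈ Finset.range (c * n), (pendingProb G η γ r).toReal with hA
  set O := ∑ t ∈ Finset.range n, (pendingProb G η π t).toReal with hO
  have hO0 : 0 ≤ O := Finset.sum_nonneg fun _ _ => ENNReal.toReal_nonneg
  have hA0 : 0 ≤ A := Finset.sum_nonneg fun _ _ => ENNReal.toReal_nonneg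
  have hle : ∑ r ∈ Finset.range n, (pendingProb G η γ r).toReal ≤ A :=
    Finset.sum_le_sum_of_subset_of_nonneg
      (Finset.range_mono (Nat.le_mul_of_pos_left n hc3)) fun _ _ _ => ENNReal.toReal_nonneg
  have hmain : A * (c - u) ≤ c ^ 2 * O := by
    have h1 : α * A ≤ α * (c * O + u / c * A) := by
      rw [hLu] at hsum
      calc α * A ≤ _ := hsum
        _ = _ := by field_simp; ring
    have h2 : A ≤ c * O + u / c * A := le_of_mul_le_mul_left h1 hα
    have h3 : u / c * A * c = u * A := by field_simp
    nlinarith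
  have hcu : 0 < (c : ℝ) - u := by linarith
  have hnum : (c : ℝ) ^ 2 ≤ L * u * (c - u) := by
    have h1 : 4.1 * (u * (c - u)) ≤ L * (u * (c - u)) :=
      mul_le_mul_of_nonneg_right hL (by positivity)
    nlinarith
  have hfin : A ≤ L * u * O := by
    refine le_of_mul_le_mul_right ?_ hcu
    calc A * (c - u) ≤ c ^ 2 * O := hmain
      _ ≤ (L * u * (c - u)) * O := mul_le_mul_of_nonneg_right hnum hO0
      _ = _ := by ring
  calc α * ∑ r ∈ Finset.range n, (pendingProb G η γ r).toReal ≤ α * (L * u * O) :=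
        mul_le_mul_of_nonneg_left (hle.trans hfin) hα.le
    _ = L * (α * u) * O := by ring
    _ = L ^ 2 * O := by rw [← hLu]; ring

/-- Comparison of the expected number of rounds with the expected number of full batches. -/
theorem mul_sum_pendingProb_le_fullBatch_of_large (hα : 0 < α) (hα1 : α ≤ 0.4742) (hη : 144 ≤ η)
    (hb : 1 ≤ b) (hηn : η ≤ G.nodes.card)
    (hγ : IsApproxGreedy G η b (ENNReal.ofReal α) γ) (hπ : IsBatched G b π) {n : ℕ} (hn : 1 ≤ n) :
    α * ∑ r ∈ Finset.range n, (pendingProb G η γ r).toReal ≤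
      (Real.log η + 1) ^ 2 * ∑ t ∈ Finset.range n, fullBatchProb G η π t := by
  set L := Real.log η + 1 with hLdef
  have hL : 5.9 ≤ L := by
    have h1 := log_two_pow_mul_three_pow 4 2
    have h2 : Real.log ((2 : ℝ) ^ 4 * 3 ^ 2) ≤ Real.log η :=
      Real.log_le_log (by positivity) (by norm_num; exact_mod_cast hη)
    norm_num at h1 h2
    linarith
  set u := L / α with hu
  have hLu : L = α * u := by rw [hu]; field_simp
  have hu1 : 12 ≤ u := by
    rw [hu, le_div_iff₀ hα]
    linarith
  -- `c (c + u)/(c - u)` is minimal at `c = (1 + √2) u`, with value `(3 + 2√2) u < 5.9 u`. Any `c`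
  -- in `[2.4 u, 2.5 u]` is good enough, and `u ≥ 12` keeps the rounded value there.
  set c := ⌈2.4 * u⌉₊ with hc
  have hc1 : 2.4 * u ≤ c := Nat.le_ceil _
  have hc2 : (c : ℝ) < 2.4 * u + 1 := Nat.ceil_lt_add_one (by linarith)
  have hc3 : 1 ≤ c := by
    have : (0 : ℝ) < c := by linarith
    exact_mod_cast this
  have hc0 : (0 : ℝ) < c := by linarith
  -- The expected potential never increases: compare with `π` after `η` rounds, when it has surely
  -- finished.
  have hdrop0 : ∀ r, 0 ≤ (expectedPotential G η γ r).toReal -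
      (expectedPotential G η γ (r + 1)).toReal := by
    intro r
    have h := mul_pendingProb_toReal_le hα.le hγ hπ η r
    rw [pendingProb_eq_zero hπ hηn (Nat.le_mul_of_pos_right η hb), ENNReal.toReal_zero, mul_zero,
      add_zero] at h
    have h2 : 0 ≤ α * (pendingProb G η γ r).toReal := mul_nonneg hα.le ENNReal.toReal_nonneg
    have h3 : (0 : ℝ) < η := by exact_mod_cast (by omega : 0 < η)
    exact nonneg_of_mul_nonneg_right (h2.trans h) h3
  have hsum := mul_sum_sub_le_of_drop (κ := 1) (α := α) (L := L) (o := fullBatchProb G η π) hc3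
    (pendingProb_toReal_antitone (G := G) (η := η) γ) (pendingProb_toReal_le_one γ 0)
    (fun r => ENNReal.toReal_nonneg (a := expectedPotential G η γ r)) (by linarith)
    (fun r => expectedPotential_toReal_le γ r) zero_le_one
    -- For `t ≥ 1` the comparison is with `t + 1` rounds of `π`, whence `κ = 1`; for `t = 0` it is
    -- trivial because the first term of `fullBatchProb` is `1`.
    (fun t r => by
      rcases Nat.eq_zero_or_pos t with rfl | ht
      · have h1 := mul_le_mul_of_nonneg_left (pendingProb_toReal_le_one (G := G) (η := η) γ r) hα.le
        have h2 := hdrop0 r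
        simp only [fullBatchProb, if_true, Nat.cast_zero]
        linarith
      · have h := mul_pendingProb_toReal_le hα.le hγ hπ (t + 1) r
        rw [fullBatchProb, if_neg ht.ne']
        push_cast at h
        exact h) n
  set A := ∑ r ∈ Finset.range (c * n), (pendingProb G η γ r).toReal with hA
  set O := ∑ t ∈ Finset.range n, fullBatchProb G η π t with hO
  have hO1 : 1 ≤ O := by
    have h : fullBatchProb G η π 0 ≤ O := Finset.single_le_sum (f := fullBatchProb G η π) (s := Finset.range n)
      (fun t _ => by
        unfold fullBatchProb
        split_ifs
        · exact zero_le_one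
        · exact ENNReal.toReal_nonneg) (Finset.mem_range.2 hn)
    rwa [fullBatchProb, if_pos rfl] at h
  have hA0 : 0 ≤ A := Finset.sum_nonneg fun _ _ => ENNReal.toReal_nonneg
  have hle : ∑ r ∈ Finset.range n, (pendingProb G η γ r).toReal ≤ A :=
    Finset.sum_le_sum_of_subset_of_nonneg
      (Finset.range_mono (Nat.le_mul_of_pos_left n hc3)) fun _ _ _ => ENNReal.toReal_nonneg
  have hmain : A * (c - u) ≤ c * (c + u) * O := by
    have h1 : α * A ≤ α * (c * O + u + u / c * A) := by
      rw [hLu] at hsum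
      calc α * A ≤ _ := hsum
        _ = _ := by field_simp
    have h2 : A ≤ c * O + u + u / c * A := le_of_mul_le_mul_left h1 hα
    have h3 : u / c * A * c = u * A := by field_simp
    -- The additive term due to `κ = 1` is absorbed using `O ≥ 1`, since the first batch is always
    -- counted.
    have h4 : u * c * 1 ≤ u * c * O := mul_le_mul_of_nonneg_left hO1 (by positivity)
    nlinarith
  have hcu : 0 < (c : ℝ) - u := by linarith
  have hnum : (c : ℝ) * (c + u) ≤ L * u * (c - u) := by
    have h1 : 5.9 * (u * (c - u)) ≤ L * (u * (c - u)) :=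
      mul_le_mul_of_nonneg_right hL (by positivity)
    have h2 : ((c : ℝ) - 2.4 * u) * (c - 2.5 * u) ≤ 0 :=
      mul_nonpos_of_nonneg_of_nonpos (by linarith) (by linarith)
    nlinarith
  have hfin : A ≤ L * u * O := by
    refine le_of_mul_le_mul_right ?_ hcu
    calc A * (c - u) ≤ c * (c + u) * O := hmain
      _ ≤ (L * u * (c - u)) * O := mul_le_mul_of_nonneg_right hnum (by linarith)
      _ = _ := by ring
  calc α * ∑ r ∈ Finset.range n, (pendingProb G η γ r).toReal ≤ α * (L * u * O) :=
        mul_le_mul_of_nonneg_left (hle.trans hfin) hα.le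
    _ = L * (α * u) * O := by ring
    _ = L ^ 2 * O := by rw [← hLu]; ring

theorem mul_seedCount_le (hη : 1 ≤ η) (hηn : η ≤ G.nodes.card) (hb : 1 ≤ b) (hα : 0 < α)
    (hα1 : α ≤ rho b * 0.63213) (hγb : IsBatched G b γ)
    (hγ : IsApproxGreedy G η b (ENNReal.ofReal α) γ) (hπ : IsBatched G b π) :
    α * (seedCount G η γ G.nodes.card).toReal ≤
      (Real.log η + 1) ^ 2 * (seedCount G η π G.nodes.card).toReal := by
  set n := G.nodes.card with hn
  have hlog : 1 ≤ (Real.log η + 1) ^ 2 := by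
    have := Real.log_natCast_nonneg η
    nlinarith
  have hSπ := le_seedCount_toReal hη hηn hπ
  have hSγ0 : 0 ≤ (seedCount G η γ n).toReal := ENNReal.toReal_nonneg
  have hρ := rho_le_one b hb
  rcases lt_or_ge n b with hnb | hbn
  · -- all nodes are seeded at once
    rw [← hn, min_eq_right hnb.le] at hSπ
    have h1 : (seedCount G η γ n).toReal ≤ n := by
      have := ENNReal.toReal_mono (ENNReal.natCast_ne_top _) (seedCount_le_card (η := η) hγb n)
      rwa [ENNReal.toReal_natCast, ← hn] at this
    have h2 : α ≤ 1 := by linarith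
    calc α * (seedCount G η γ n).toReal ≤ 1 * (seedCount G η π n).toReal :=
          mul_le_mul h2 (h1.trans hSπ) hSγ0 zero_le_one
      _ ≤ _ := mul_le_mul_of_nonneg_right hlog ENNReal.toReal_nonneg
  rw [← hn, min_eq_left hbn] at hSπ
  have hb0 : (0 : ℝ) < b := by exact_mod_cast hb
  have hupper := seedCount_toReal_le (η := η) hγb n
  have hpend : ∀ r, (pendingProb G η γ r).toReal ≤ 1 := pendingProb_toReal_le_one γ
  -- it suffices to bound the expected number of rounds
  have hreduce : ∀ x : ℝ, α * ∑ r ∈ Finset.range n, (pendingProb G η γ r).toReal ≤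
      (Real.log η + 1) ^ 2 * x → b * x ≤ (seedCount G η π n).toReal →
      α * (seedCount G η γ n).toReal ≤ (Real.log η + 1) ^ 2 * (seedCount G η π n).toReal := by
    intro x h1 h2
    calc α * (seedCount G η γ n).toReal
        ≤ α * (b * ∑ r ∈ Finset.range n, (pendingProb G η γ r).toReal) :=
          mul_le_mul_of_nonneg_left hupper hα.le
      _ = b * (α * ∑ r ∈ Finset.range n, (pendingProb G η γ r).toReal) := by ring
      _ ≤ b * ((Real.log η + 1) ^ 2 * x) := mul_le_mul_of_nonneg_left h1 hb0.le
      _ = (Real.log η + 1) ^ 2 * (b * x) := by ring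
      _ ≤ _ := mul_le_mul_of_nonneg_left h2 (by linarith)
  -- For `b = 1` every batch is full and pending rounds count seeds exactly. For `b ≥ 2` the last
  -- batch may be short, but `ρ_b ≤ 3/4` makes `α` smaller.
  rcases Nat.eq_or_lt_of_le hb with hb1 | hb2
  · have hα2 : α ≤ 0.6322 := by linarith
    rcases le_or_gt η 23 with hsmall | hlarge
    -- The first batch of `π` alone is enough here.
    · refine hreduce 1 ?_ (by rwa [mul_one])
      have h1 := sum_range_le_of_eventually_zero hpend (M := η) (fun r hr => by
        rw [pendingProb_eq_zero hγb hηn (by rw [← hb1, mul_one]; exact hr),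
          ENNReal.toReal_zero]) n
      have h2 := mul_le_log_add_one_sq hη hsmall
      calc _ ≤ α * (η : ℝ) := mul_le_mul_of_nonneg_left h1 hα.le
        _ ≤ 0.6322 * (η : ℝ) := mul_le_mul_of_nonneg_right hα2 (Nat.cast_nonneg _)
        _ ≤ _ := by rw [mul_one]; exact h2
    · refine hreduce _ (mul_sum_pendingProb_le_of_large hα hα2 (by omega) hγ hπ n) ?_
      rw [← hb1, Nat.cast_one, one_mul]
      exact sum_pendingProb_le_seedCount hb hηn hπ n
  · have hρ2 : rho b ≤ 3 / 4 := rho_two ▸ rho_antitone one_le_two hb2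
    have hα2 : α ≤ 0.4742 := by linarith
    rcases le_or_gt η 143 with hsmall | hlarge
    · refine hreduce 1 ?_ (by rwa [mul_one])
      have h1 := sum_range_le_of_eventually_zero hpend (M := (η + 1) / 2) (fun r hr => by
        rw [pendingProb_eq_zero hγb hηn (by
          have : r * 2 ≤ r * b := Nat.mul_le_mul_left r hb2
          omega), ENNReal.toReal_zero]) n
      have h2 := mul_add_one_le_log_add_one_sq hη hsmall
      have h3 : (((η + 1) / 2 : ℕ) : ℝ) ≤ ((η : ℝ) + 1) / 2 := by
        have := Nat.cast_div_le (α := ℝ) (m := η + 1) (n := 2)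
        push_cast at this
        exact this
      calc _ ≤ α * (((η : ℝ) + 1) / 2) := mul_le_mul_of_nonneg_left (h1.trans h3) hα.le
        _ ≤ 0.4742 * (((η : ℝ) + 1) / 2) := mul_le_mul_of_nonneg_right hα2 (by positivity)
        _ = 0.2371 * ((η : ℝ) + 1) := by ring
        _ ≤ _ := by rw [mul_one]; exact h2
    · have hn1 : 1 ≤ n := hη.trans hηn
      refine hreduce _ (mul_sum_pendingProb_le_fullBatch_of_large hα hα2 (by omega) hb hηn hγ hπ
        hn1) ?_
      obtain ⟨m, hm⟩ := Nat.exists_eq_add_of_le' hn1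
      rw [hm]
      exact mul_sum_fullBatchProb_le_seedCount hη hηn hbn hπ m

end Rounds

theorem theorem5 {V : Type*} [DecidableEq V] [Fintype V] (G : SocialNetwork V)
    (η : ℕ) (hη1 : 1 ≤ η) (hηn : η ≤ G.nodes.card)
    (b : ℕ) (hb : 1 ≤ b) (ε : ℝ) (hε0 : 0 < ε) (hε1 : ε < 1)
    (pick : List (Finset V) → Finset V → Finset V → V) (hpick : IsTieBreak pick) :
    IsBatched G b (astiTrimB pick G η ε b) ∧
    IsFeasible G η (astiTrimB pick G η ε b) ∧
    ∀ π : Policy V, IsBatched G b π → IsFeasible G η π →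
      expectedSeeds G η (astiTrimB pick G η ε b) ≤
        (Real.log (η : ℝ) + 1) ^ 2 / (rho b * (1 - 1 / Real.exp 1) * (1 - ε)) *
          expectedSeeds G η π := by
  have hbatched := isBatched_astiTrimB (G := G) hpick η b ε
  refine ⟨hbatched, isFeasible_of_isBatched hb hbatched hηn, fun π hπ _ => ?_⟩
  have hρ := rho_pos hb
  have he := one_sub_inv_exp_pos
  have hε : 0 < 1 - ε := by linarith
  have hα : 0 < rho b * (1 - 1 / Real.exp 1) * (1 - ε) := by positivity
  have hα1 : rho b * (1 - 1 / Real.exp 1) * (1 - ε) ≤ rho b * 0.63213 := by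
    calc _ ≤ rho b * (1 - 1 / Real.exp 1) * 1 :=
          mul_le_mul_of_nonneg_left (by linarith) (by positivity)
      _ = rho b * (1 - 1 / Real.exp 1) := mul_one _
      _ ≤ _ := mul_le_mul_of_nonneg_left one_sub_inv_exp_le hρ.le
  rw [expectedSeeds_eq, expectedSeeds_eq, div_mul_eq_mul_div, le_div_iff₀ hα, mul_comm]
  exact mul_seedCount_le hη1 hηn hb hα hα1 hbatched
    (isApproxGreedy_astiTrimB hpick hηn hb hε0 hε1) hπ
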